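/- Let $N\ge 1$, $w_0,\dots,w_{N-1}\in\mathbb C$, $\hbar\in\mathbb C^*$. On the universal covering $\mathbb C^{N-1}$ of $(\mathbb C^*)^{N-1}$ use the coordinates $s_i=\log u_i$, and write $x=e^t$; functions of $x$ may be multivalued, i.e. they are functions of $t=\log x\in\mathbb C$. Let $$W(u;x)=\sum_{i=1}^{N-1}(u_i+w_i\log u_i)+\frac{x}{u_1\cdots u_{N-1}}+w_0\log\frac{x}{u_1\cdots u_{N-1}} .$$ Fix $x_0=e^{t_0}$, and let $\Gamma$ be a Lefschetz thimble of $W(\cdot;x_0)$ for $\hbar$: a smooth injectively immersed $\gamma:\mathbb R^{N-1}\to\mathbb C^{N-1}$ for which $\gamma(0)=c$ is a non-degenerate critical point of $W(\cdot;x_0)$, $W(\gamma(y);x_0)=W(c;x_0)-\hbar\|y\|^2$ (so that the spheres $\|y\|^2=r$ are vanishing cycles in the fibres over the half-line $W(c;x_0)-\hbar r$, $r\ge0$), and such that the steepest descent field of $\mathrm{Re}(W(\cdot;x_0)/\hbar)$ for the metric $\sum|du_i/u_i|^2$ is everywhere tangent to $\Gamma$. With this fixed cycle $\Gamma$ put $$\mathcal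 I_{\mathbb{CP}^{N-1}_w}(x)=\int_\Gamma e^{\frac1\hbar W(u;x)}\prod_{i=1}^{N-1}\frac{du_i}{u_i},\qquad \hat x f=xf,\qquad \hat y f=\hbar x\frac{df}{dx}=\hbar\frac{df}{dt}.$$ (1) If $U\subset\mathbb C$ is open and the integral converges absolutely for every $t\in U$, then $\mathcal I_{\mathbb{CP}^{N-1}_w}$ is holomorphic in $t\in U$ and on $U$ $$\Big[\prod_{i=0}^{N-1}(\hat y-w_i)-\hat x\Big]\mathcal I_{\mathbb{CP}^{N-1}_w}=0 .$$ (2) Let $n\ge0$, let $l_1,\dots,l_n\ge1$ be integers with $l_1+\dots+l_n<N$, let $\lambda_1,\dots,\lambda_n\in\mathbb C$, and assume $\mathrm{Re}\,\hbar>0$. Let $D\subset\mathbb C$ be open and connected (possibly empty) with $D+\mathbb R=D$. (2a) Let $F$ be holomorphic on $D$ and equal to $\mathcal I_{\mathbb{CP}^{N-1}_w}$ on some non-empty open subset of $D$ on which the integral $\mathcal I_{\mathbb{CP}^{N-1}_w}$ converges absolutely (that is, $F$ is the analytic continuation of $\mathcal I_{\mathbb{CP}^{N-1}_w}$ to $D$).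 Suppose that for every $t\in D$ the Laplace integral $$\mathcal I_{X_{l;w,\lambda}}(x)=\int_{(0,\infty)^n}e^{-\frac1\hbar\sum_a(v_a+\lambda_a\log v_a)}\,F\big(t+\textstyle\sum_a l_a\log v_a\big)\,dv_1\cdots dv_n$$ (in terms of $x$: of the function $F$ at $v_1^{l_1}\cdots v_n^{l_n}x$) converges absolutely. Then $\mathcal I_{X_{l;w,\lambda}}$ is holomorphic in $t\in D$ and on $D$ $$\Big[\prod_{i=0}^{N-1}(\hat y-w_i)-\hat x\prod_{a=1}^n\prod_{m=1}^{l_a}(l_a\hat y-\lambda_a+m\hbar)\Big]\mathcal I_{X_{l;w,\lambda}}=0 .$$ (2b) Suppose that for every $t\in D$ the integral $$\int_{\Gamma\times(0,\infty)^n}e^{\frac1\hbar W_X(u,v;x)}\prod_{i=1}^{N-1}\frac{du_i}{u_i}\prod_{a=1}^n dv_a ,$$ $$W_X(u,v;x)=\sum_{i}(u_i+w_i\log u_i)-\sum_a(v_a+\lambda_a\log v_a)+\frac{v_1^{l_1}\cdots v_n^{l_n}}{u_1\cdots u_{N-1}}x+w_0\log\Big(\frac{v_1^{l_1}\cdots v_n^{l_n}}{u_1\cdots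 u_{N-1}}x\Big),$$ converges absolutely. Then on $D$ it equals the Laplace integral of (2a) with $F$ replaced by the integral $\mathcal I_{\mathbb{CP}^{N-1}_w}$ over $\Gamma$, it is holomorphic, and it satisfies the equation of (2a). -/

import Mathlib

open MeasureTheory

noncomputable section

namespace MirrorGKZ

/-! Logarithmic coordinates are used throughout: `s i = log (u i)` is a global coordinate on the
universal covering of `ℂ*`, so the universal covering of `(ℂ*)^k` is `Fin k → ℂ`, and the form
`du_i / u_i` is `ds_i`.  Likewise `x = exp t`, so that a multivalued function of `x` is a function
of `t`, and `x * d/dx` is `d/dt`.  The projective space has `N = k + 1` homogeneous coordinates. -/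

/-- The mirror potential of equivariant projective space,
`∑ (u_i + w_i log u_i) + x / (u_1 ⋯ u_k) + w_0 log (x / (u_1 ⋯ u_k))`,
at `u_i = exp (s i)`, `x = exp t`. -/
def cpPotential {k : ℕ} (w : Fin (k + 1) → ℂ) (t : ℂ) (s : Fin k → ℂ) : ℂ :=
  (∑ i, (Complex.exp (s i) + w i.succ * s i)) + Complex.exp (t - ∑ i, s i)
    + w 0 * (t - ∑ i, s i)

/-- The mirror potential of the complete intersection of degrees `l a`,
at `u_i = exp (s i)`, `v_a = exp (r a)`, `x = exp t`. -/
def ciPotential {k n : ℕ} (w : Fin (k + 1) → ℂ) (l : Fin n → ℕ) (lam : Fin n → ℂ) (t : ℂ)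
    (s : Fin k → ℂ) (r : Fin n → ℂ) : ℂ :=
  (∑ i, (Complex.exp (s i) + w i.succ * s i)) - (∑ a, (Complex.exp (r a) + lam a * r a))
    + Complex.exp (t + ∑ a, (l a : ℂ) * r a - ∑ i, s i)
    + w 0 * (t + ∑ a, (l a : ℂ) * r a - ∑ i, s i)

/-- The partial derivative `∂f/∂s_i`. -/
def partialDeriv {k : ℕ} (f : (Fin k → ℂ) → ℂ) (i : Fin k) (s : Fin k → ℂ) : ℂ :=
  fderiv ℂ f s (Pi.single i 1)

/-- `c` is a non-degenerate critical point of `f`. -/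
def IsNondegenerateCritical {k : ℕ} (f : (Fin k → ℂ) → ℂ) (c : Fin k → ℂ) : Prop :=
  (∀ i, partialDeriv f i c = 0) ∧
    (Matrix.of fun i j => partialDeriv (partialDeriv f i) j c).det ≠ 0

/-- `γ` parametrizes the Lefschetz thimble of the critical point `c` of `f` for the parameter `ħ`:
an injectively immersed `ℝ^k` through the non-degenerate critical point `c`, whose sphere
`‖y‖ ^ 2 = r` (the vanishing cycle) lies in the fibre of `f` over the point `f c - ħ r` of the
half-line that starts at `f c` in the direction `- ħ`, and which is swept out by steepest descent
lines: the descent direction of `Re (f / ħ)` for the metric `∑ |ds_i|^2 = ∑ |du_i / u_i|^2`,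
namely `- conj (∂f/∂s_i / ħ)`, is everywhere tangent to it. -/
structure IsLefschetzThimble {k : ℕ} (f : (Fin k → ℂ) → ℂ) (ħ : ℂ) (c : Fin k → ℂ)
    (γ : EuclideanSpace ℝ (Fin k) → (Fin k → ℂ)) : Prop where
  critical : IsNondegenerateCritical f c
  smooth : ContDiff ℝ ((⊤ : ℕ∞) : WithTop ℕ∞) γ
  injective : Function.Injective γ
  immersion : ∀ y, Function.Injective (fderiv ℝ γ y)
  base : γ 0 = c
  level : ∀ y, f (γ y) = f c - ħ * ((‖y‖ ^ 2 : ℝ) : ℂ)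
  descent : ∀ y, ∃ η : EuclideanSpace ℝ (Fin k), fderiv ℝ γ y η =
    fun i => - (starRingEnd ℂ) (partialDeriv f i (γ y) / ħ)

/-- The density of the pull-back by `γ` of the form `ds_1 ∧ ⋯ ∧ ds_k`. -/
def formDensity {k : ℕ} (γ : EuclideanSpace ℝ (Fin k) → (Fin k → ℂ))
    (y : EuclideanSpace ℝ (Fin k)) : ℂ :=
  (Matrix.of fun i j : Fin k => fderiv ℝ γ y (EuclideanSpace.single j (1 : ℝ)) i).det

/-- The pull-back by `γ` of `exp (W / ħ) du_1 / u_1 ⋯ du_k / u_k`. -/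
def cpIntegrand {k : ℕ} (w : Fin (k + 1) → ℂ) (ħ : ℂ)
    (γ : EuclideanSpace ℝ (Fin k) → (Fin k → ℂ)) (t : ℂ) (y : EuclideanSpace ℝ (Fin k)) : ℂ :=
  Complex.exp (cpPotential w t (γ y) / ħ) * formDensity γ y

/-- The oscillatory integral of projective space over the cycle parametrized by `γ`. -/
def cpIntegral {k : ℕ} (w : Fin (k + 1) → ℂ) (ħ : ℂ)
    (γ : EuclideanSpace ℝ (Fin k) → (Fin k → ℂ)) (t : ℂ) : ℂ :=
  ∫ y, cpIntegrand w ħ γ t y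

/-- The domain `(0, ∞)^n` of the variables `v_1, …, v_n`. -/
def orthant (n : ℕ) : Set (Fin n → ℝ) := {v | ∀ a, 0 < v a}

/-- The integrand of the Laplace transform of `F`, a function of `t = log x`;
the argument `v_1 ^ l_1 ⋯ v_n ^ l_n * x` of `F` has logarithm `t + ∑ l_a log v_a`. -/
def laplaceIntegrand {n : ℕ} (l : Fin n → ℕ) (lam : Fin n → ℂ) (ħ : ℂ) (F : ℂ → ℂ) (t : ℂ)
    (v : Fin n → ℝ) : ℂ :=
  Complex.exp (-(∑ a, ((v a : ℂ) + lam a * (Real.log (v a) : ℂ))) / ħ)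
    * F (t + ∑ a, (l a : ℂ) * (Real.log (v a) : ℂ))

/-- The oscillatory integral of the complete intersection, as a Laplace transform. -/
def ciLaplace {n : ℕ} (l : Fin n → ℕ) (lam : Fin n → ℂ) (ħ : ℂ) (F : ℂ → ℂ) (t : ℂ) : ℂ :=
  ∫ v in orthant n, laplaceIntegrand l lam ħ F t v

/-- The pull-back by `γ × id` of `exp (W_X / ħ) du_1 / u_1 ⋯ du_k / u_k dv_1 ⋯ dv_n`. -/
def ciIntegrand {k n : ℕ} (w : Fin (k + 1) → ℂ) (l : Fin n → ℕ) (lam : Fin n → ℂ) (ħ : ℂ)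
    (γ : EuclideanSpace ℝ (Fin k) → (Fin k → ℂ)) (t : ℂ)
    (p : EuclideanSpace ℝ (Fin k) × (Fin n → ℝ)) : ℂ :=
  Complex.exp (ciPotential w l lam t (γ p.1) (fun a => (Real.log (p.2 a) : ℂ)) / ħ)
    * formDensity γ p.1

/-- The oscillatory integral of the complete intersection over `Γ × (0, ∞)^n`. -/
def ciIntegral {k n : ℕ} (w : Fin (k + 1) → ℂ) (l : Fin n → ℕ) (lam : Fin n → ℂ) (ħ : ℂ)
    (γ : EuclideanSpace ℝ (Fin k) → (Fin k → ℂ)) (t : ℂ) : ℂ :=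
  ∫ p in (Set.univ ×ˢ orthant n), ciIntegrand w l lam ħ γ t p

/-- The operator `ŷ = ħ x d/dx = ħ d/dt`. -/
def yHat (ħ : ℂ) (F : ℂ → ℂ) : ℂ → ℂ := fun t => ħ * deriv F t

/-- The operator `x̂` of multiplication by `x = exp t`. -/
def xHat (F : ℂ → ℂ) : ℂ → ℂ := fun t => Complex.exp t * F t

/-- Composition of a list of operators, applied to a function. -/
def opProd (L : List ((ℂ → ℂ) → (ℂ → ℂ))) (F : ℂ → ℂ) : ℂ → ℂ :=
  L.foldr (fun A G => A G) F

/-- `∏_{i=0}^{k} (ŷ - w_i)`. -/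
def wProd {k : ℕ} (w : Fin (k + 1) → ℂ) (ħ : ℂ) : (ℂ → ℂ) → (ℂ → ℂ) :=
  opProd ((List.finRange (k + 1)).map fun i F t => yHat ħ F t - w i * F t)

/-- `∏_{a=1}^{n} ∏_{m=1}^{l_a} (l_a ŷ - λ_a + m ħ)`. -/
def lamProd {n : ℕ} (l : Fin n → ℕ) (lam : Fin n → ℂ) (ħ : ℂ) : (ℂ → ℂ) → (ℂ → ℂ) :=
  opProd ((List.finRange n).flatMap fun a => (List.range (l a)).map fun m F t =>
    (l a : ℂ) * yHat ħ F t + (-lam a + ((m : ℂ) + 1) * ħ) * F t)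

/-- The GKZ operator `∏ (ŷ - w_i) - x̂` of projective space. -/
def cpGKZ {k : ℕ} (w : Fin (k + 1) → ℂ) (ħ : ℂ) (F : ℂ → ℂ) : ℂ → ℂ :=
  fun t => wProd w ħ F t - xHat F t

/-- The GKZ operator `∏ (ŷ - w_i) - x̂ ∏ ∏ (l_a ŷ - λ_a + m ħ)` of the complete intersection. -/
def ciGKZ {k n : ℕ} (w : Fin (k + 1) → ℂ) (l : Fin n → ℕ) (lam : Fin n → ℂ) (ħ : ℂ)
    (F : ℂ → ℂ) : ℂ → ℂ :=
  fun t => wProd w ħ F t - xHat (lamProd l lam ħ F) t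

end MirrorGKZ

end

namespace MirrorGKZ

open Filter Topology Metric

/-! ### First-order operators with constant coefficients -/

/-! Projective space. Since `∂W/∂s_i = u_i + w_i - x/(u_1⋯u_k) - w_0` and `ŷ` multiplies `e^{W/ħ}`
by `x/(u_1⋯u_k) + w_0`, the functions `(ŷ - w_i) e^{W/ħ}` and `u_i e^{W/ħ}` differ by the derivative
`ħ ∂/∂s_i e^{W/ħ}`, for `i ≥ 1`. Multiplication by a monomial `u_A` with `i ∉ A` commutes with that
derivative, so formally `∏_{i≥1} (ŷ - w_i)` inserts `u_1⋯u_k` under the integral, and `ŷ - w_0` then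
inserts `x/(u_1⋯u_k)`; the product of both is `x`.

Only the integral itself is assumed to converge, with the cycle fixed at `x_0`, so boundary terms
and the integrals of `u_A` need control. With `f = W(·; x_0)`, the factor `exp(ε (f - f c)/ħ)`
equals `exp(-ε‖y‖²)` on the thimble. On the thimble all monomials are `O(1 + ‖y‖²)`
(`IsLefschetzThimble.exists_norm_exp_le`, where tangency of the descent field is used), so
regularized integrals of `u_A` converge and Stokes applies (`integral_regWeight_cons`). The error
terms carry polynomials in `ε`, `ε u_i`, `ε x_0/(u_1⋯u_k)` without constant term; they disappear as
`ε → 0`, locally uniformly in `t`, hence together with all derivatives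
(`tendstoLocallyUniformlyOn_regWeight`).

Complete intersections. Put `v_a = e^{r_a}`. Integration by parts in `r_a` shows that `l_a ŷ - λ_a +
(m_a + 1)ħ` raises the exponent `m_a` of `v_a` in the Laplace integral by one. Thus the product of
these operators inserts `∏ v_a^{l_a}`, and the equation for `F` at `x ∏ v_a^{l_a}` gives the claim.
The analytic content is `locDominated_laplaceFamily`: pointwise absolute convergence on a
horizontally invariant domain already gives locally uniform domination, even with extra powers of
`v`. Three estimates carry it.

Horizontally, integration by parts on real segments bounds all partial products `∏(ŷ - w_i) F` at a
point by an integral of `‖F‖` over a unit segment (`WeakBound.exists_norm_firstOrderProd_le`).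
Vertically, Gronwall's inequality for the first-order system, rescaled by powers of `μ ≈ e^{Re t /
N}`, bounds the growth by `exp(const · μ)` (`norm_le_exp_of_chain`). As `e^{Re t}` is at most a
constant times `(1 + ∑ v_a)^{∑ l_a}` and `∑ l_a < N`, this growth is subexponential in `∑ v_a`.
Finally, translating `t` to the right frees half of the decay `exp(-Re(1/ħ) ∑ v_a)`
(`integrable_laplaceWindow`), which absorbs the growth.

For the integral over the product, Fubini and a convexity argument in `x` show that the thimble
integral converges on all of `D`, which reduces it to the Laplace transform. -/

/-- The operator `α d/dt + β`. -/
noncomputable def firstOrder (α β : ℂ) (F : ℂ → ℂ) : ℂ → ℂ := fun t => α * deriv F t + β * F t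

/-- The product of the operators `α d/dt + β` for the pairs `(α, β)` of a list. -/
noncomputable def firstOrderProd : List (ℂ × ℂ) → (ℂ → ℂ) → (ℂ → ℂ)
  | [], F => F
  | p :: L, F => firstOrder p.1 p.2 (firstOrderProd L F)

theorem firstOrderProd_append (L M : List (ℂ × ℂ)) (F : ℂ → ℂ) :
    firstOrderProd (L ++ M) F = firstOrderProd L (firstOrderProd M F) := by
  induction L with
  | nil => rfl
  | cons p L ih => simp [firstOrderProd, ih]

theorem wProd_eq_firstOrderProd {k : ℕ} (w : Fin (k + 1) → ℂ) (ħ : ℂ) (F : ℂ → ℂ) :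
    wProd w ħ F = firstOrderProd ((List.finRange (k + 1)).map fun i => (ħ, -w i)) F := by
  unfold wProd opProd
  induction List.finRange (k + 1) with
  | nil => rfl
  | cons i L ih =>
    simp only [List.map_cons, List.foldr_cons, firstOrderProd, ih]
    funext t
    simp only [firstOrder, yHat]
    ring

theorem lamProd_eq_firstOrderProd {n : ℕ} (l : Fin n → ℕ) (lam : Fin n → ℂ) (ħ : ℂ) (F : ℂ → ℂ) :
    lamProd l lam ħ F = firstOrderProd ((List.finRange n).flatMap fun a =>
      (List.range (l a)).map fun m : ℕ => ((l a : ℂ) * ħ, -lam a + ((m : ℂ) + 1) * ħ)) F := by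
  -- The cast of a list of indices to `ℂ` can appear as a monadic bind; written as a map it merges
  -- with the map that produces the operators.
  have coe : ∀ L : List ℕ, (do let a ← L; pure (a : ℂ)) = L.map fun m : ℕ => (m : ℂ) := by
    intro L
    exact List.flatMap_pure_eq_map _ L
  have key : ∀ a (L : List ℕ) (G : ℂ → ℂ),
      List.foldr (fun (A : (ℂ → ℂ) → (ℂ → ℂ)) G => A G) G (L.map fun (m : ℕ) (F : ℂ → ℂ) (t : ℂ) =>
        (l a : ℂ) * yHat ħ F t + (-lam a + ((m : ℂ) + 1) * ħ) * F t) =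
      firstOrderProd (L.map fun m : ℕ => ((l a : ℂ) * ħ, -lam a + ((m : ℂ) + 1) * ħ)) G := by
    intro a L G
    induction L with
    | nil => rfl
    | cons m L ih =>
      simp only [List.map_cons, List.foldr_cons, firstOrderProd, ih]
      funext t
      simp only [firstOrder, yHat]
      ring
  unfold lamProd opProd
  simp only [coe, List.map_map, Function.comp_def]
  induction List.finRange n with
  | nil => rfl
  | cons a L ih =>
    rw [List.flatMap_cons, List.flatMap_cons, List.foldr_append, firstOrderProd_append, ih, key]

theorem firstOrder_differentiableOn {D : Set ℂ} (hD : IsOpen D) (α β : ℂ) {F : ℂ → ℂ}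
    (hF : DifferentiableOn ℂ F D) : DifferentiableOn ℂ (firstOrder α β F) D :=
  ((hF.deriv hD).const_mul α).add (hF.const_mul β)

theorem firstOrderProd_differentiableOn {D : Set ℂ} (hD : IsOpen D) (L : List (ℂ × ℂ))
    {F : ℂ → ℂ} (hF : DifferentiableOn ℂ F D) : DifferentiableOn ℂ (firstOrderProd L F) D := by
  induction L with
  | nil => exact hF
  | cons p L ih => exact firstOrder_differentiableOn hD _ _ ih

theorem firstOrder_congr {D : Set ℂ} (hD : IsOpen D) (α β : ℂ) {F G : ℂ → ℂ}
    (h : Set.EqOn F G D) : Set.EqOn (firstOrder α β F) (firstOrder α β G) D := by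
  intro t ht
  have : F =ᶠ[𝓝 t] G := h.eventuallyEq_of_mem (hD.mem_nhds ht)
  simp only [firstOrder, this.deriv_eq, h ht]

theorem firstOrderProd_congr {D : Set ℂ} (hD : IsOpen D) (L : List (ℂ × ℂ)) {F G : ℂ → ℂ}
    (h : Set.EqOn F G D) : Set.EqOn (firstOrderProd L F) (firstOrderProd L G) D := by
  induction L with
  | nil => exact h
  | cons p L ih => exact firstOrder_congr hD _ _ ih

theorem firstOrder_comm {D : Set ℂ} (hD : IsOpen D) (p q : ℂ × ℂ) {F : ℂ → ℂ}
    (hF : DifferentiableOn ℂ F D) :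
    Set.EqOn (firstOrder p.1 p.2 (firstOrder q.1 q.2 F))
      (firstOrder q.1 q.2 (firstOrder p.1 p.2 F)) D := by
  intro t ht
  have h1 : DifferentiableAt ℂ F t := hF.differentiableAt (hD.mem_nhds ht)
  have h2 : DifferentiableAt ℂ (deriv F) t := (hF.deriv hD).differentiableAt (hD.mem_nhds ht)
  have key : ∀ a b : ℂ, deriv (firstOrder a b F) t = a * deriv (deriv F) t + b * deriv F t :=
    fun a b => ((h2.hasDerivAt.const_mul a).add (h1.hasDerivAt.const_mul b)).deriv
  change p.1 * deriv (firstOrder q.1 q.2 F) t + p.2 * firstOrder q.1 q.2 F t =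
    q.1 * deriv (firstOrder p.1 p.2 F) t + q.2 * firstOrder p.1 p.2 F t
  rw [key, key]
  simp only [firstOrder]
  ring

/-- Operators with constant coefficients commute on holomorphic functions. This allows the factors
of `lamProd` to be applied in the order in which integration by parts produces them. -/
theorem firstOrderProd_perm {D : Set ℂ} (hD : IsOpen D) {L M : List (ℂ × ℂ)} (h : L.Perm M)
    {F : ℂ → ℂ} (hF : DifferentiableOn ℂ F D) :
    Set.EqOn (firstOrderProd L F) (firstOrderProd M F) D := by
  induction h with
  | nil => exact fun t _ => rfl
  | cons p _ ih => exact firstOrder_congr hD _ _ ih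
  | swap p q L => exact firstOrder_comm hD _ _ (firstOrderProd_differentiableOn hD L hF)
  | trans _ _ ih1 ih2 => exact ih1.trans ih2

theorem deriv_comp_add_right (F : ℂ → ℂ) (a t : ℂ) :
    deriv (fun t => F (t + a)) t = deriv F (t + a) := deriv_comp_add_const F a t

theorem firstOrder_const_mul_translate (α β b a : ℂ) (F : ℂ → ℂ) :
    firstOrder α β (fun t => b * F (t + a)) = fun t => b * firstOrder α β F (t + a) := by
  funext t
  simp only [firstOrder, deriv_const_mul_field, deriv_comp_add_right]
  ring

theorem firstOrderProd_const_mul_translate (L : List (ℂ × ℂ)) (b a : ℂ) (F : ℂ → ℂ) :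
    firstOrderProd L (fun t => b * F (t + a)) = fun t => b * firstOrderProd L F (t + a) := by
  induction L with
  | nil => rfl
  | cons p L ih => simp only [firstOrderProd, ih, firstOrder_const_mul_translate]

/-! ### Holomorphic families with locally uniform domination -/

/-- A family of functions of `y`, holomorphic in the parameter `t ∈ U` and locally uniformly
dominated by integrable functions. -/
structure LocDominated {α : Type*} [MeasurableSpace α] (μ : Measure α) (U : Set ℂ)
    (f : ℂ → α → ℂ) : Prop where
  holo : ∀ y, DifferentiableOn ℂ (fun t => f t y) U
  meas : ∀ t ∈ U, AEStronglyMeasurable (f t) μ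
  bound : ∀ t ∈ U, ∃ δ > 0, ball t δ ⊆ U ∧ ∃ b : α → ℝ, Integrable b μ ∧
    ∀ t' ∈ ball t δ, ∀ y, ‖f t' y‖ ≤ b y

namespace LocDominated

variable {α : Type*} [MeasurableSpace α] {μ : Measure α} {U : Set ℂ} {f g : ℂ → α → ℂ}

theorem integrable (hf : LocDominated μ U f) {t : ℂ} (ht : t ∈ U) : Integrable (f t) μ := by
  obtain ⟨δ, hδ, -, b, hb, hle⟩ := hf.bound t ht
  exact hb.mono' (hf.meas t ht) (Eventually.of_forall (hle t (mem_ball_self hδ)))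

theorem const_mul (hf : LocDominated μ U f) (a : ℂ) :
    LocDominated μ U (fun t y => a * f t y) where
  holo y := (hf.holo y).const_mul a
  meas t ht := (hf.meas t ht).const_mul a
  bound t ht := by
    obtain ⟨δ, hδ, hs, b, hb, hle⟩ := hf.bound t ht
    refine ⟨δ, hδ, hs, fun y => ‖a‖ * b y, hb.const_mul _, fun t' ht' y => ?_⟩
    rw [norm_mul]
    exact mul_le_mul_of_nonneg_left (hle t' ht' y) (norm_nonneg a)

theorem add (hf : LocDominated μ U f) (hg : LocDominated μ U g) :
    LocDominated μ U (fun t y => f t y + g t y) where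
  holo y := (hf.holo y).add (hg.holo y)
  meas t ht := (hf.meas t ht).add (hg.meas t ht)
  bound t ht := by
    obtain ⟨δ, hδ, hs, b, hb, hle⟩ := hf.bound t ht
    obtain ⟨δ', hδ', hs', b', hb', hle'⟩ := hg.bound t ht
    refine ⟨min δ δ', lt_min hδ hδ', (ball_subset_ball (min_le_left _ _)).trans hs,
      fun y => b y + b' y, hb.add hb', fun t' ht' y => (norm_add_le _ _).trans ?_⟩
    exact add_le_add (hle t' (ball_subset_ball (min_le_left _ _) ht') y)
      (hle' t' (ball_subset_ball (min_le_right _ _) ht') y)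

/-- Multiplication by a bounded function of `y`. -/
theorem bdd_mul (hf : LocDominated μ U f) {m : α → ℂ} (hm : AEStronglyMeasurable m μ) {C : ℝ}
    (hC : ∀ y, ‖m y‖ ≤ C) : LocDominated μ U (fun t y => m y * f t y) where
  holo y := (hf.holo y).const_mul (m y)
  meas t ht := hm.mul (hf.meas t ht)
  bound t ht := by
    obtain ⟨δ, hδ, hs, b, hb, hle⟩ := hf.bound t ht
    refine ⟨δ, hδ, hs, fun y => C * b y, hb.const_mul _, fun t' ht' y => ?_⟩
    rw [norm_mul]
    exact mul_le_mul (hC y) (hle t' ht' y) (norm_nonneg _) ((norm_nonneg _).trans (hC y))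

/-- Cauchy's estimate on circles of radius `δ / 4` about points of `ball t (δ / 2)`: a majorant for
the functions is, up to a constant, one for their derivatives. Hence domination need never be
checked again after differentiating in `t`. -/
theorem norm_deriv_le (hf : LocDominated μ U f) {t : ℂ} (ht : t ∈ U) :
    ∃ δ > 0, ball t δ ⊆ U ∧ ∃ b : α → ℝ, Integrable b μ ∧
      ∀ t' ∈ ball t δ, ∀ y, ‖deriv (fun t => f t y) t'‖ ≤ b y := by
  obtain ⟨δ, hδ, hs, b, hb, hle⟩ := hf.bound t ht
  have h2 : (0 : ℝ) < δ / 2 := by positivity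
  refine ⟨δ / 2, h2, (ball_subset_ball (by linarith)).trans hs, fun y => b y / (δ / 4),
    hb.div_const _, fun t' ht' y => ?_⟩
  have h4 : (0 : ℝ) < δ / 4 := by positivity
  have hsub : closedBall t' (δ / 4) ⊆ ball t δ := by
    intro z hz
    rw [mem_closedBall] at hz
    rw [mem_ball] at ht' ⊢
    linarith [dist_triangle z t' t]
  refine Complex.norm_deriv_le_of_forall_mem_sphere_norm_le h4 ?_
    fun z hz => hle z (hsub (sphere_subset_closedBall hz)) y
  apply DifferentiableOn.diffContOnCl
  rw [closure_ball _ h4.ne']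
  exact (hf.holo y).mono (hsub.trans hs)

/-- The derivative is a pointwise limit of a sequence of difference quotients, with steps small
enough to stay in the ball around `t`. -/
theorem aestronglyMeasurable_deriv (hf : LocDominated μ U f) (hU : IsOpen U) {t : ℂ}
    (ht : t ∈ U) : AEStronglyMeasurable (fun y => deriv (fun t => f t y) t) μ := by
  obtain ⟨δ, hδ, hs, -⟩ := hf.bound t ht
  set e : ℕ → ℂ := fun n => ((δ / 2 / ((n : ℝ) + 1) : ℝ) : ℂ) with he
  have hpos : ∀ n : ℕ, 0 < δ / 2 / ((n : ℝ) + 1) := fun n => by positivity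
  have hmem : ∀ n, t + e n ∈ U := fun n => hs (by
    rw [mem_ball, dist_eq_norm, add_sub_cancel_left, he, Complex.norm_real, Real.norm_eq_abs,
      abs_of_pos (hpos n)]
    have : δ / 2 / ((n : ℝ) + 1) ≤ δ / 2 := div_le_self (by positivity) (by
      linarith [Nat.cast_nonneg (α := ℝ) n])
    linarith)
  have hlim : Tendsto e atTop (𝓝[≠] 0) := by
    rw [tendsto_nhdsWithin_iff]
    refine ⟨?_, Eventually.of_forall fun n => ?_⟩
    · have : Tendsto (fun n : ℕ => δ / 2 / ((n : ℝ) + 1)) atTop (𝓝 0) :=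
        tendsto_const_nhds.div_atTop (tendsto_atTop_add_const_right _ _ tendsto_natCast_atTop_atTop)
      have h0 := (Complex.continuous_ofReal.tendsto 0).comp this
      rwa [Complex.ofReal_zero] at h0
    · exact Complex.ofReal_ne_zero.mpr (hpos n).ne'
  refine aestronglyMeasurable_of_tendsto_ae atTop
    (f := fun n y => (e n)⁻¹ • (f (t + e n) y - f t y))
    (fun n => ((hf.meas _ (hmem n)).sub (hf.meas t ht)).const_smul (e n)⁻¹)
    (Eventually.of_forall fun y => ?_)
  have hd : HasDerivAt (fun t => f t y) (deriv (fun t => f t y) t) t :=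
    ((hf.holo y).differentiableAt (hU.mem_nhds ht)).hasDerivAt
  exact hd.tendsto_slope_zero.comp hlim

theorem deriv (hf : LocDominated μ U f) (hU : IsOpen U) :
    LocDominated μ U (fun t y => deriv (fun t => f t y) t) where
  holo y := (hf.holo y).deriv hU
  meas _ ht := hf.aestronglyMeasurable_deriv hU ht
  bound _ ht := hf.norm_deriv_le ht

theorem hasDerivAt_integral (hf : LocDominated μ U f) (hU : IsOpen U) {t : ℂ} (ht : t ∈ U) :
    HasDerivAt (fun t => ∫ y, f t y ∂μ) (∫ y, _root_.deriv (fun t => f t y) t ∂μ) t := by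
  obtain ⟨δ, hδ, hs, b, hb, hle⟩ := hf.norm_deriv_le ht
  refine (hasDerivAt_integral_of_dominated_loc_of_deriv_le (ball_mem_nhds t hδ)
    (eventually_of_mem (hU.mem_nhds ht) fun t' ht' => hf.meas t' ht') (hf.integrable ht)
    (F' := fun t y => _root_.deriv (fun t => f t y) t)
    (hf.aestronglyMeasurable_deriv hU ht) (Eventually.of_forall fun y t' ht' => hle t' ht' y) hb
    (Eventually.of_forall fun y t' ht' => ?_)).2
  exact ((hf.holo y).differentiableAt (hU.mem_nhds (hs ht'))).hasDerivAt

theorem differentiableOn_integral (hf : LocDominated μ U f) (hU : IsOpen U) :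
    DifferentiableOn ℂ (fun t => ∫ y, f t y ∂μ) U :=
  fun _ ht => (hf.hasDerivAt_integral hU ht).differentiableAt.differentiableWithinAt

theorem firstOrder (hf : LocDominated μ U f) (hU : IsOpen U) (a b : ℂ) :
    LocDominated μ U (fun t y => firstOrder a b (fun t => f t y) t) :=
  ((hf.deriv hU).const_mul a).add (hf.const_mul b)

theorem firstOrder_integral (hf : LocDominated μ U f) (hU : IsOpen U) (a b : ℂ) {t : ℂ}
    (ht : t ∈ U) : MirrorGKZ.firstOrder a b (fun t => ∫ y, f t y ∂μ) t =
      ∫ y, MirrorGKZ.firstOrder a b (fun t => f t y) t ∂μ := by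
  simp only [MirrorGKZ.firstOrder, (hf.hasDerivAt_integral hU ht).deriv]
  rw [integral_add (((hf.deriv hU).integrable ht).const_mul a) ((hf.integrable ht).const_mul b),
    integral_const_mul, integral_const_mul]

theorem firstOrderProd (hf : LocDominated μ U f) (hU : IsOpen U) (L : List (ℂ × ℂ)) :
    LocDominated μ U (fun t y => firstOrderProd L (fun t => f t y) t) := by
  induction L with
  | nil => exact hf
  | cons p L ih => exact ih.firstOrder hU p.1 p.2

theorem firstOrderProd_integral (hf : LocDominated μ U f) (hU : IsOpen U) (L : List (ℂ × ℂ)) :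
    Set.EqOn (MirrorGKZ.firstOrderProd L (fun t => ∫ y, f t y ∂μ))
      (fun t => ∫ y, MirrorGKZ.firstOrderProd L (fun t => f t y) t ∂μ) U := by
  induction L with
  | nil => exact fun t _ => rfl
  | cons p L ih =>
    intro t ht
    exact (firstOrder_congr hU p.1 p.2 ih ht).trans
      ((hf.firstOrderProd hU L).firstOrder_integral hU p.1 p.2 ht)

/-- Bounded pointwise convergence of multipliers gives locally uniform convergence of the
integrals. -/
theorem tendstoLocallyUniformlyOn (hf : LocDominated μ U f) {ι : Type*} {φ : Filter ι}
    [φ.IsCountablyGenerated] {m : ι → α → ℂ} (hm : ∀ᶠ i in φ, AEStronglyMeasurable (m i) μ)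
    {C : ℝ} (hC : ∀ᶠ i in φ, ∀ y, ‖m i y‖ ≤ C) {κ : ℂ}
    (hκ : ∀ y, Tendsto (fun i => m i y) φ (𝓝 κ)) :
    TendstoLocallyUniformlyOn (fun i t => ∫ y, m i y * f t y ∂μ)
      (fun t => κ * ∫ y, f t y ∂μ) φ U := by
  rw [Metric.tendstoLocallyUniformlyOn_iff]
  intro ε hε t ht
  obtain ⟨δ, hδ, hs, b, hb, hle⟩ := hf.bound t ht
  refine ⟨ball t δ, mem_nhdsWithin_of_mem_nhds (ball_mem_nhds t hδ), ?_⟩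
  -- This quantity bounds the error for every `t'` in the ball at once, which is where uniformity
  -- comes from.
  have hlim : Tendsto (fun i => ∫ y, ‖m i y - κ‖ * b y ∂μ) φ (𝓝 (∫ _, (0 : ℝ) ∂μ)) := by
    refine tendsto_integral_filter_of_dominated_convergence (fun y => (C + ‖κ‖) * ‖b y‖) ?_ ?_
      (hb.norm.const_mul _) (Eventually.of_forall fun y => ?_)
    · filter_upwards [hm] with i hi
      exact (hi.sub aestronglyMeasurable_const).norm.mul hb.aestronglyMeasurable
    · filter_upwards [hC] with i hi
      refine Eventually.of_forall fun y => ?_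
      rw [norm_mul, norm_norm]
      exact mul_le_mul_of_nonneg_right ((norm_sub_le _ _).trans (by linarith [hi y]))
        (norm_nonneg _)
    · have : Tendsto (fun i => ‖m i y - κ‖ * b y) φ (𝓝 (‖κ - κ‖ * b y)) :=
        (((hκ y).sub tendsto_const_nhds).norm).mul tendsto_const_nhds
      simpa using this
  rw [integral_zero] at hlim
  filter_upwards [hm, hC, hlim.eventually (gt_mem_nhds hε)] with i hmi hCi hi t' ht'
  have hint : Integrable (fun y => m i y * f t' y) μ :=
    (hf.bdd_mul hmi hCi).integrable (hs ht')
  rw [dist_comm, dist_eq_norm, ← integral_const_mul,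
    ← integral_sub hint ((hf.integrable (hs ht')).const_mul κ)]
  refine lt_of_le_of_lt ?_ hi
  refine norm_integral_le_of_norm_le ?_ (Eventually.of_forall fun y => ?_)
  · refine ((hb.norm.const_mul (C + ‖κ‖))).mono'
      ((hmi.sub aestronglyMeasurable_const).norm.mul hb.aestronglyMeasurable)
      (Eventually.of_forall fun y => ?_)
    rw [norm_mul, norm_norm]
    exact mul_le_mul_of_nonneg_right ((norm_sub_le _ _).trans (by linarith [hCi y]))
      (norm_nonneg _)
  · rw [← sub_mul, norm_mul]
    exact mul_le_mul_of_nonneg_left (hle t' ht' y) (norm_nonneg _)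

end LocDominated

/-! ### Stokes' theorem for a form `dφ_1 ∧ ⋯ ∧ dφ_k` -/

/-- The integral of `dφ_1 ∧ ⋯ ∧ dφ_k` vanishes when one of the functions has compact support. -/
theorem integral_det_fderiv_eq_zero {ι : Type*} [Fintype ι] [DecidableEq ι]
    {E : Type*} [NormedAddCommGroup E] [NormedSpace ℝ E] [FiniteDimensional ℝ E]
    [MeasurableSpace E] [BorelSpace E] (μ : Measure E) [μ.IsAddHaarMeasure] (v : ι → E)
    (φ : ι → E → ℂ) (hφ : ∀ i, ContDiff ℝ ((⊤ : ℕ∞) : WithTop ℕ∞) (φ i)) (i₀ : ι)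
    (hc : HasCompactSupport (φ i₀)) :
    ∫ y, (Matrix.of fun i j => fderiv ℝ (φ i) y (v j)).det ∂μ = 0 := by
  have hd : ∀ i j, ContDiff ℝ ((⊤ : ℕ∞) : WithTop ℕ∞) fun y => fderiv ℝ (φ i) y (v j) :=
    fun i j => ((hφ i).fderiv_right (by simp)).clm_apply contDiff_const
  have hdd : ∀ i j l y, fderiv ℝ (fun y => fderiv ℝ (φ i) y (v j)) y (v l) =
      fderiv ℝ (fun y => fderiv ℝ (φ i) y (v l)) y (v j) := by
    intro i j l y
    have h1 : DifferentiableAt ℝ (fderiv ℝ (φ i)) y :=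
      ((hφ i).fderiv_right (m := 1) (by norm_cast)).differentiable one_ne_zero y
    have hs : IsSymmSndFDerivAt ℝ (φ i) y :=
      (hφ i).contDiffAt.isSymmSndFDerivAt (by simp only [minSmoothness_of_isRCLikeNormedField]; norm_cast)
    have e : ∀ j l, fderiv ℝ (fun y => fderiv ℝ (φ i) y (v j)) y (v l) =
        fderiv ℝ (fderiv ℝ (φ i)) y (v l) (v j) := by
      intro j l
      rw [fderiv_clm_apply h1 (differentiableAt_const _)]
      simp
    rw [e, e]
    exact hs _ _
  set Q : Equiv.Perm ι → E → ℂ := fun σ y =>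
    ∏ i ∈ Finset.univ.erase i₀, fderiv ℝ (φ i) y (v (σ i)) with hQ
  have hQs : ∀ σ, ContDiff ℝ ((⊤ : ℕ∞) : WithTop ℕ∞) (Q σ) :=
    fun σ => contDiff_prod fun i _ => hd i (σ i)
  have hdet : ∀ y, (Matrix.of fun i j => fderiv ℝ (φ i) y (v j)).det =
      ∑ σ : Equiv.Perm ι, ((Equiv.Perm.sign σ : ℤ) : ℂ) *
        (Q σ y * fderiv ℝ (φ i₀) y (v (σ i₀))) := by
    intro y
    rw [← Matrix.det_transpose, Matrix.det_apply']
    refine Finset.sum_congr rfl fun σ _ => ?_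
    rw [← Finset.prod_erase_mul _ _ (Finset.mem_univ i₀)]
    simp [hQ]
  have hQ' : ∀ σ y, fderiv ℝ (Q σ) y (v (σ i₀)) = ∑ m ∈ Finset.univ.erase i₀,
      (∏ j ∈ (Finset.univ.erase i₀).erase m, fderiv ℝ (φ j) y (v (σ j))) *
        fderiv ℝ (fun y => fderiv ℝ (φ m) y (v (σ m))) y (v (σ i₀)) := by
    intro σ y
    have := fderiv_finsetProd (u := Finset.univ.erase i₀) (x := y)
      (g := fun i y => fderiv ℝ (φ i) y (v (σ i)))
      fun i _ => (hd i (σ i)).differentiable (by simp) y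
    simp only [hQ, this, sum_apply, smul_apply,
      smul_eq_mul]
  -- After the derivative is moved off `φ i₀`, what remains is the coefficient of `d` of a wedge
  -- product of exact forms. It vanishes by symmetry of second derivatives: exchanging the
  -- directions assigned to `i₀` and `m` changes only the sign.
  have hzero : ∀ y, ∑ σ : Equiv.Perm ι, ((Equiv.Perm.sign σ : ℤ) : ℂ) *
      fderiv ℝ (Q σ) y (v (σ i₀)) = 0 := by
    intro y
    simp only [hQ', Finset.mul_sum]
    rw [Finset.sum_comm]
    refine Finset.sum_eq_zero fun m hm => ?_
    have hm0 : m ≠ i₀ := Finset.ne_of_mem_erase hm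
    refine Finset.sum_involution (fun σ _ => σ * Equiv.swap i₀ m) (fun σ _ => ?_)
      (fun σ _ _ h => ?_) (fun σ _ => Finset.mem_univ _) (fun σ _ => ?_)
    · have hp : ∏ j ∈ (Finset.univ.erase i₀).erase m,
          fderiv ℝ (φ j) y (v ((σ * Equiv.swap i₀ m) j)) =
          ∏ j ∈ (Finset.univ.erase i₀).erase m, fderiv ℝ (φ j) y (v (σ j)) := by
        refine Finset.prod_congr rfl fun j hj => ?_
        rw [Equiv.Perm.mul_apply, Equiv.swap_apply_of_ne_of_ne
          (Finset.ne_of_mem_erase (Finset.mem_of_mem_erase hj)) (Finset.ne_of_mem_erase hj)]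
      rw [hp, Equiv.Perm.sign_mul, Equiv.Perm.sign_swap hm0.symm, Equiv.Perm.mul_apply,
        Equiv.Perm.mul_apply, Equiv.swap_apply_left, Equiv.swap_apply_right,
        hdd m (σ i₀) (σ m)]
      simp
    · have h' := congrArg (fun τ : Equiv.Perm ι => (σ⁻¹ * τ) i₀) h
      simp at h'
      exact hm0 h'
    · simp [mul_assoc]
  have hcont : ∀ σ, Continuous fun y => fderiv ℝ (Q σ) y (v (σ i₀)) := fun σ =>
    (((hQs σ).fderiv_right (m := 0) (by simp)).clm_apply contDiff_const).continuous
  have hint1 : ∀ σ, Integrable (fun y => Q σ y * fderiv ℝ (φ i₀) y (v (σ i₀))) μ := fun σ =>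
    ((hQs σ).continuous.mul (hd i₀ _).continuous).integrable_of_hasCompactSupport
      ((hc.fderiv_apply ℝ _).mul_left)
  have hint2 : ∀ σ, Integrable (fun y => fderiv ℝ (Q σ) y (v (σ i₀)) * φ i₀ y) μ := fun σ =>
    ((hcont σ).mul (hφ i₀).continuous).integrable_of_hasCompactSupport hc.mul_left
  have hint3 : ∀ σ, Integrable (fun y => Q σ y * φ i₀ y) μ := fun σ =>
    ((hQs σ).continuous.mul (hφ i₀).continuous).integrable_of_hasCompactSupport hc.mul_left
  simp only [hdet]
  rw [integral_finsetSum _ fun σ _ => (hint1 σ).const_mul _]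
  have step : ∀ σ : Equiv.Perm ι, ∫ y, ((Equiv.Perm.sign σ : ℤ) : ℂ) *
      (Q σ y * fderiv ℝ (φ i₀) y (v (σ i₀))) ∂μ =
      - ∫ y, ((Equiv.Perm.sign σ : ℤ) : ℂ) * (fderiv ℝ (Q σ) y (v (σ i₀)) * φ i₀ y) ∂μ := by
    intro σ
    rw [integral_const_mul, integral_const_mul,
      integral_mul_fderiv_eq_neg_fderiv_mul_of_integrable (hint2 σ) (hint1 σ) (hint3 σ)
        (fun y _ => (hQs σ).differentiable (by simp) y)
        (fun y _ => (hφ i₀).differentiable (by simp) y), mul_neg]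
  simp only [step]
  rw [Finset.sum_neg_distrib, ← integral_finsetSum _ fun σ _ => (hint2 σ).const_mul _]
  have : ∀ y, ∑ σ : Equiv.Perm ι, ((Equiv.Perm.sign σ : ℤ) : ℂ) *
      (fderiv ℝ (Q σ) y (v (σ i₀)) * φ i₀ y) = 0 := by
    intro y
    simp only [← mul_assoc]
    rw [← Finset.sum_mul, hzero, zero_mul]
  simp [this]

/-! ### Stokes' theorem on a thimble -/

theorem fderiv_eq_sum_partialDeriv {k : ℕ} (Φ : (Fin k → ℂ) → ℂ) (s v : Fin k → ℂ) :
    fderiv ℂ Φ s v = ∑ l, v l * partialDeriv Φ l s := by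
  have hv : v = ∑ l, v l • (Pi.single l 1 : Fin k → ℂ) := by
    funext j
    simp [Finset.sum_apply, Pi.single_apply]
  conv_lhs => rw [hv]
  rw [map_sum]
  simp [partialDeriv]

theorem hasFDerivAt_comp_real {k : ℕ} {Φ : (Fin k → ℂ) → ℂ}
    {γ : EuclideanSpace ℝ (Fin k) → (Fin k → ℂ)} {y : EuclideanSpace ℝ (Fin k)}
    (hΦ : DifferentiableAt ℂ Φ (γ y)) (hγ : DifferentiableAt ℝ γ y) :
    HasFDerivAt (fun y => Φ (γ y)) (((fderiv ℂ Φ (γ y)).restrictScalars ℝ).comp (fderiv ℝ γ y)) y :=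
  (hΦ.hasFDerivAt.restrictScalars ℝ).comp y hγ.hasFDerivAt

theorem IsLefschetzThimble.differentiable {k : ℕ} {f : (Fin k → ℂ) → ℂ} {ħ : ℂ} {c : Fin k → ℂ}
    {γ : EuclideanSpace ℝ (Fin k) → (Fin k → ℂ)} (hγ : IsLefschetzThimble f ħ c γ) :
    Differentiable ℝ γ := hγ.smooth.differentiable (by simp)

/-- The level condition differentiated in the direction `v`. It converts derivatives of functions of
`‖y‖²` into partial derivatives of `f` along the thimble. -/
theorem IsLefschetzThimble.sum_partialDeriv {k : ℕ} {f : (Fin k → ℂ) → ℂ} {ħ : ℂ} {c : Fin k → ℂ}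
    {γ : EuclideanSpace ℝ (Fin k) → (Fin k → ℂ)} (hγ : IsLefschetzThimble f ħ c γ)
    (hf : Differentiable ℂ f) (y v : EuclideanSpace ℝ (Fin k)) :
    ∑ l, fderiv ℝ γ y v l * partialDeriv f l (γ y) = -ħ * ((2 * inner ℝ y v : ℝ) : ℂ) := by
  have h1 := hasFDerivAt_comp_real (hf (γ y)) (hγ.differentiable y)
  have h2 : HasFDerivAt (fun y : EuclideanSpace ℝ (Fin k) => f c - ħ * ((‖y‖ ^ 2 : ℝ) : ℂ))
      (-(ħ • (Complex.ofRealCLM.comp (2 • innerSL ℝ y)))) y := by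
    have h3 := Complex.ofRealCLM.hasFDerivAt.comp y (hasStrictFDerivAt_norm_sq y).hasFDerivAt
    exact (h3.const_mul ħ).const_sub (f c)
  have h4 : (fun y => f (γ y)) = fun y => f c - ħ * ((‖y‖ ^ 2 : ℝ) : ℂ) := funext hγ.level
  rw [h4] at h1
  have h5 := DFunLike.congr_fun (h1.unique h2) v
  simp only [ContinuousLinearMap.comp_apply, ContinuousLinearMap.coe_restrictScalars'] at h5
  rw [fderiv_eq_sum_partialDeriv] at h5
  rw [h5]
  simp

theorem formDensity_continuous {k : ℕ} {γ : EuclideanSpace ℝ (Fin k) → (Fin k → ℂ)}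
    (hγ : ContDiff ℝ ((⊤ : ℕ∞) : WithTop ℕ∞) γ) : Continuous (formDensity γ) := by
  refine Continuous.matrix_det (continuous_matrix fun i j => ?_)
  exact (continuous_apply i).comp ((hγ.continuous_fderiv (by simp)).clm_apply continuous_const)

/-- Stokes' theorem on a thimble with a cut-off function of `‖y‖ ^ 2 = (f c - f) / ħ`. -/
theorem IsLefschetzThimble.integral_cutoff_eq_zero {k : ℕ} {f : (Fin k → ℂ) → ℂ} {ħ : ℂ}
    {c : Fin k → ℂ} {γ : EuclideanSpace ℝ (Fin k) → (Fin k → ℂ)} (hγ : IsLefschetzThimble f ħ c γ)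
    (hħ : ħ ≠ 0) (hf : Differentiable ℂ f) {Φ : (Fin k → ℂ) → ℂ}
    (hΦ : ContDiff ℂ ((⊤ : ℕ∞) : WithTop ℕ∞) Φ) (i : Fin k) {χ : ℝ → ℝ}
    (hχ : ContDiff ℝ ((⊤ : ℕ∞) : WithTop ℕ∞) χ) (hχc : HasCompactSupport χ) {R : ℝ} (hR : 0 < R) :
    ∫ y, ((χ (‖y‖ ^ 2 / R) : ℂ) * partialDeriv Φ i (γ y) -
      (deriv χ (‖y‖ ^ 2 / R) / R : ℝ) * Φ (γ y) * partialDeriv f i (γ y) / ħ) *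
        formDensity γ y = 0 := by
  set ψ : EuclideanSpace ℝ (Fin k) → ℂ := fun y => (χ (‖y‖ ^ 2 / R) : ℂ) * Φ (γ y) with hψ
  have hns : ContDiff ℝ ((⊤ : ℕ∞) : WithTop ℕ∞) fun y : EuclideanSpace ℝ (Fin k) => ‖y‖ ^ 2 / R :=
    (contDiff_norm_sq ℝ).div_const R
  have hχs : ContDiff ℝ ((⊤ : ℕ∞) : WithTop ℕ∞)
      fun y : EuclideanSpace ℝ (Fin k) => (χ (‖y‖ ^ 2 / R) : ℂ) :=
    Complex.ofRealCLM.contDiff.comp (hχ.comp hns)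
  have hψs : ContDiff ℝ ((⊤ : ℕ∞) : WithTop ℕ∞) ψ :=
    hχs.mul ((hΦ.restrict_scalars ℝ).comp hγ.smooth)
  have hψc : HasCompactSupport ψ := by
    obtain ⟨r, hr⟩ := hχc.isBounded.subset_closedBall 0
    refine HasCompactSupport.of_support_subset_isCompact
      (isCompact_closedBall (0 : EuclideanSpace ℝ (Fin k)) (Real.sqrt (r * R))) fun y hy => ?_
    have h0 : χ (‖y‖ ^ 2 / R) ≠ 0 := fun h => hy (by simp [hψ, h])
    have h1 := hr (subset_tsupport _ h0)
    rw [mem_closedBall_zero_iff, Real.norm_eq_abs, abs_of_nonneg (by positivity),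
      div_le_iff₀ hR] at h1
    rw [mem_closedBall_zero_iff]
    exact Real.le_sqrt_of_sq_le h1
  -- On the thimble `‖y‖² = (f c - f)/ħ`, so the differential of the cut-off is `-χ' df/(Rħ)`; thus
  -- `dψ` is a combination of the pulled-back `ds_l` although the cut-off is not holomorphic.
  have hψ' : ∀ y v, fderiv ℝ ψ y v = ∑ l, ((χ (‖y‖ ^ 2 / R) : ℂ) * partialDeriv Φ l (γ y) -
      (deriv χ (‖y‖ ^ 2 / R) / R : ℝ) * Φ (γ y) * partialDeriv f l (γ y) / ħ) *
        fderiv ℝ γ y v l := by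
    intro y v
    have h1 := hasFDerivAt_comp_real (hΦ.differentiable (by simp) (γ y)) (hγ.differentiable y)
    have h2 : HasFDerivAt (fun y : EuclideanSpace ℝ (Fin k) => χ (‖y‖ ^ 2 / R))
        (deriv χ (‖y‖ ^ 2 / R) • (R⁻¹ • (2 • innerSL ℝ y))) y := by
      have h3 : HasFDerivAt (fun y : EuclideanSpace ℝ (Fin k) => ‖y‖ ^ 2 / R)
          (R⁻¹ • (2 • innerSL ℝ y)) y := by
        simpa only [div_eq_inv_mul] using
          (hasStrictFDerivAt_norm_sq y).hasFDerivAt.const_mul R⁻¹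
      exact (hχ.differentiable (by simp) _).hasDerivAt.comp_hasFDerivAt y h3
    have h4 := (Complex.ofRealCLM.hasFDerivAt.comp y h2).mul h1
    have h5 : HasFDerivAt ψ _ y := h4
    rw [h5.fderiv]
    have h6 := hγ.sum_partialDeriv hf y v
    simp only [ContinuousLinearMap.comp_apply, ContinuousLinearMap.coe_restrictScalars', add_apply,
      smul_apply, fderiv_eq_sum_partialDeriv, Function.comp_apply]
    simp only [sub_mul, Finset.sum_sub_distrib]
    have h7 : ∑ l, ((deriv χ (‖y‖ ^ 2 / R) / R : ℝ) : ℂ) * Φ (γ y) * partialDeriv f l (γ y) / ħ *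
        fderiv ℝ γ y v l = ((deriv χ (‖y‖ ^ 2 / R) / R : ℝ) : ℂ) * Φ (γ y) / ħ *
        (-ħ * ((2 * inner ℝ y v : ℝ) : ℂ)) := by
      rw [← h6, Finset.mul_sum]
      exact Finset.sum_congr rfl fun l _ => by ring
    rw [h7, Finset.smul_sum, sub_eq_add_neg]
    congr 1
    · exact Finset.sum_congr rfl fun l _ => by simp; ring
    · simp
      field_simp
  -- The form is `ds_1 ∧ ⋯ ∧ dψ ∧ ⋯ ∧ ds_k` with `dψ` in place `i`: only the `ds_i` component of
  -- `dψ` survives, which in matrix terms is the determinant with one row replaced by a combination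
  -- of all rows.
  set φ : Fin k → EuclideanSpace ℝ (Fin k) → ℂ := Function.update (fun l y => γ y l) i ψ with hφ
  have hφs : ∀ l, ContDiff ℝ ((⊤ : ℕ∞) : WithTop ℕ∞) (φ l) := by
    intro l
    by_cases h : l = i
    · subst h
      simpa [hφ] using hψs
    · simpa [hφ, h] using (contDiff_pi.mp hγ.smooth l)
  have := integral_det_fderiv_eq_zero volume (fun j : Fin k => EuclideanSpace.single j (1 : ℝ))
    φ hφs i (by simpa [hφ] using hψc)
  rw [← this]
  refine integral_congr_ae (Eventually.of_forall fun y => ?_)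
  have hM : (Matrix.of fun l j => fderiv ℝ (φ l) y (EuclideanSpace.single j (1 : ℝ))) =
      (Matrix.of fun l j : Fin k => fderiv ℝ γ y (EuclideanSpace.single j (1 : ℝ)) l).updateRow i
        (∑ l, ((χ (‖y‖ ^ 2 / R) : ℂ) * partialDeriv Φ l (γ y) -
      (deriv χ (‖y‖ ^ 2 / R) / R : ℝ) * Φ (γ y) * partialDeriv f l (γ y) / ħ) •
        (Matrix.of fun l j : Fin k => fderiv ℝ γ y (EuclideanSpace.single j (1 : ℝ)) l) l) := by
    ext l j
    by_cases h : l = i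
    · subst h
      simp [hφ, hψ', Finset.sum_apply]
    · rw [Matrix.updateRow_ne h]
      simp only [hφ, Function.update_of_ne h, Matrix.of_apply]
      rw [fderiv_apply (hγ.differentiable y)]
      simp
  simp only [hM, Matrix.det_updateRow_sum, smul_eq_mul]
  rfl

/-- Stokes' theorem on a thimble: the integral of the exact form `d (Φ ι_i Ω)` vanishes. -/
theorem IsLefschetzThimble.integral_partialDeriv_eq_zero {k : ℕ} {f : (Fin k → ℂ) → ℂ} {ħ : ℂ}
    {c : Fin k → ℂ} {γ : EuclideanSpace ℝ (Fin k) → (Fin k → ℂ)} (hγ : IsLefschetzThimble f ħ c γ)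
    (hħ : ħ ≠ 0) (hf : ContDiff ℂ ((⊤ : ℕ∞) : WithTop ℕ∞) f) {Φ : (Fin k → ℂ) → ℂ}
    (hΦ : ContDiff ℂ ((⊤ : ℕ∞) : WithTop ℕ∞) Φ) (i : Fin k) {C : ℝ}
    (hC : ∀ y, ‖partialDeriv f i (γ y)‖ ≤ C * (1 + ‖y‖ ^ 2))
    (h1 : Integrable fun y => (1 + ‖y‖ ^ 2) * ‖Φ (γ y) * formDensity γ y‖)
    (h2 : Integrable fun y => partialDeriv Φ i (γ y) * formDensity γ y) :
    ∫ y, partialDeriv Φ i (γ y) * formDensity γ y = 0 := by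
  have hcont : ∀ {g : (Fin k → ℂ) → ℂ}, ContDiff ℂ ((⊤ : ℕ∞) : WithTop ℕ∞) g →
      Continuous fun y => partialDeriv g i (γ y) := fun hg =>
    ((hg.continuous_fderiv (by simp)).clm_apply continuous_const).comp hγ.smooth.continuous
  let χ : ContDiffBump (0 : ℝ) := ⟨1, 2, one_pos, one_lt_two⟩
  have hχ : ContDiff ℝ ((⊤ : ℕ∞) : WithTop ℕ∞) χ := χ.contDiff
  have hχ' : Continuous (deriv χ) := hχ.continuous_deriv (by simp)
  obtain ⟨K, hK⟩ := χ.hasCompactSupport.deriv.exists_bound_of_continuous hχ'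
  have hK0 : 0 ≤ K := (norm_nonneg _).trans (hK 0)
  have hlim : Tendsto (fun n : ℕ => ∫ y, ((χ (‖y‖ ^ 2 / (n + 1)) : ℂ) * partialDeriv Φ i (γ y) -
      (deriv χ (‖y‖ ^ 2 / (n + 1)) / (n + 1) : ℝ) * Φ (γ y) * partialDeriv f i (γ y) / ħ) *
        formDensity γ y) atTop (𝓝 (∫ y, partialDeriv Φ i (γ y) * formDensity γ y)) := by
    refine tendsto_integral_of_dominated_convergence
      (fun y => ‖partialDeriv Φ i (γ y) * formDensity γ y‖ +
        K * C / ‖ħ‖ * ((1 + ‖y‖ ^ 2) * ‖Φ (γ y) * formDensity γ y‖)) (fun n => ?_)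
      (h2.norm.add (h1.const_mul _)) (fun n => Eventually.of_forall fun y => ?_)
      (Eventually.of_forall fun y => ?_)
    · refine Continuous.aestronglyMeasurable ?_
      have e1 : Continuous fun y : EuclideanSpace ℝ (Fin k) => ‖y‖ ^ 2 / ((n : ℝ) + 1) := by
        fun_prop
      have e2 : Continuous fun y => Φ (γ y) := hΦ.continuous.comp hγ.smooth.continuous
      exact (((Complex.continuous_ofReal.comp (χ.continuous.comp e1)).mul (hcont hΦ)).sub
        ((((Complex.continuous_ofReal.comp ((hχ'.comp e1).div_const _)).mul e2).mul
          (hcont hf)).div_const _)).mul (formDensity_continuous hγ.smooth)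
    · rw [sub_mul]
      refine (norm_sub_le _ _).trans (add_le_add ?_ ?_)
      · rw [mul_assoc, norm_mul, Complex.norm_real, Real.norm_of_nonneg χ.nonneg]
        exact mul_le_of_le_one_left (norm_nonneg _) χ.le_one
      · have e : ∀ a b p d : ℂ, a * b * p / ħ * d = a * p / ħ * (b * d) := fun a b p d => by ring
        rw [e, norm_mul, norm_div, norm_mul, Complex.norm_real, ← mul_assoc]
        refine mul_le_mul_of_nonneg_right ?_ (norm_nonneg _)
        rw [div_mul_eq_mul_div]
        refine div_le_div_of_nonneg_right ?_ (norm_nonneg _)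
        rw [mul_assoc]
        refine mul_le_mul ?_ (hC y) (norm_nonneg _) hK0
        rw [norm_div]
        refine (div_le_self (norm_nonneg _) ?_).trans (hK _)
        rw [Real.norm_of_nonneg (by positivity)]
        linarith [Nat.cast_nonneg (α := ℝ) n]
    -- At a fixed `y` the cut-off is eventually constant `1` near the relevant point, so the
    -- sequence is eventually constant and the term with `χ'` is exactly zero.
    · refine tendsto_const_nhds.congr' ?_
      obtain ⟨m, hm⟩ := exists_nat_gt (‖y‖ ^ 2)
      filter_upwards [eventually_ge_atTop m] with n hn
      have hlt : ‖y‖ ^ 2 / ((n : ℝ) + 1) < 1 := by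
        rw [div_lt_one (by positivity)]
        have : (m : ℝ) ≤ n := by exact_mod_cast hn
        linarith
      have hnn : 0 ≤ ‖y‖ ^ 2 / ((n : ℝ) + 1) := by positivity
      have hball : ‖y‖ ^ 2 / ((n : ℝ) + 1) ∈ ball (0 : ℝ) 1 := by
        rwa [mem_ball_zero_iff, Real.norm_of_nonneg hnn]
      have hev : (χ : ℝ → ℝ) =ᶠ[𝓝 (‖y‖ ^ 2 / ((n : ℝ) + 1))] fun _ => 1 := by
        filter_upwards [isOpen_ball.mem_nhds hball] with x hx
        exact χ.one_of_mem_closedBall (ball_subset_closedBall hx)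
      rw [hev.deriv_eq, hev.eq_of_nhds]
      simp
  have hzero := fun n : ℕ => hγ.integral_cutoff_eq_zero hħ (hf.differentiable (by simp)) hΦ i hχ
    χ.hasCompactSupport (R := (n : ℝ) + 1) (by positivity)
  simp only [hzero] at hlim
  exact (tendsto_nhds_unique tendsto_const_nhds hlim).symm

/-! ### Partial derivatives -/

section PartialDeriv

variable {k : ℕ} {f g : (Fin k → ℂ) → ℂ} {s : Fin k → ℂ}

theorem HasFDerivAt.partialDeriv_eq {f' : (Fin k → ℂ) →L[ℂ] ℂ} (h : HasFDerivAt f f' s)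
    (i : Fin k) : partialDeriv f i s = f' (Pi.single i 1) := by
  rw [partialDeriv, h.fderiv]

theorem partialDeriv_const (a : ℂ) (i : Fin k) (s : Fin k → ℂ) :
    partialDeriv (fun _ => a) i s = 0 := by simp [partialDeriv]

theorem partialDeriv_add (hf : DifferentiableAt ℂ f s) (hg : DifferentiableAt ℂ g s) (i : Fin k) :
    partialDeriv (fun s => f s + g s) i s = partialDeriv f i s + partialDeriv g i s := by
  rw [HasFDerivAt.partialDeriv_eq (hf.hasFDerivAt.fun_add hg.hasFDerivAt)]
  rfl

theorem partialDeriv_mul (hf : DifferentiableAt ℂ f s) (hg : DifferentiableAt ℂ g s) (i : Fin k) :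
    partialDeriv (fun s => f s * g s) i s =
      f s * partialDeriv g i s + partialDeriv f i s * g s := by
  rw [HasFDerivAt.partialDeriv_eq (hf.hasFDerivAt.fun_mul hg.hasFDerivAt)]
  simp [partialDeriv, mul_comm]

theorem partialDeriv_const_mul (hf : DifferentiableAt ℂ f s) (a : ℂ) (i : Fin k) :
    partialDeriv (fun s => a * f s) i s = a * partialDeriv f i s := by
  rw [HasFDerivAt.partialDeriv_eq (hf.hasFDerivAt.const_mul a)]
  rfl

theorem partialDeriv_exp (hf : DifferentiableAt ℂ f s) (i : Fin k) :
    partialDeriv (fun s => Complex.exp (f s)) i s = partialDeriv f i s * Complex.exp (f s) := by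
  rw [HasFDerivAt.partialDeriv_eq hf.hasFDerivAt.cexp]
  simp [partialDeriv, mul_comm]

theorem partialDeriv_coord (i j : Fin k) (s : Fin k → ℂ) :
    partialDeriv (fun s => s j) i s = if j = i then 1 else 0 := by
  rw [HasFDerivAt.partialDeriv_eq (hasFDerivAt_apply j s)]
  simp [Pi.single_apply]

theorem partialDeriv_const_sub_sum (a : ℂ) (i : Fin k) (s : Fin k → ℂ) :
    partialDeriv (fun s => a - ∑ j, s j) i s = -1 := by
  have h : HasFDerivAt (fun s : Fin k → ℂ => a - ∑ j, s j)
      (-∑ j : Fin k, (ContinuousLinearMap.proj j : (Fin k → ℂ) →L[ℂ] ℂ)) s :=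
    (HasFDerivAt.fun_sum fun j _ => hasFDerivAt_apply j s).const_sub a
  rw [HasFDerivAt.partialDeriv_eq h]
  simp [sum_apply, Pi.single_apply]

end PartialDeriv

/-! ### The potential of projective space -/

section Potential

variable {k : ℕ} (w : Fin (k + 1) → ℂ)

theorem contDiff_cpPotential (t : ℂ) :
    ContDiff ℂ ((⊤ : ℕ∞) : WithTop ℕ∞) (cpPotential w t) := by
  unfold cpPotential
  fun_prop

theorem partialDeriv_cpPotential (t : ℂ) (i : Fin k) (s : Fin k → ℂ) :
    partialDeriv (cpPotential w t) i s =
      Complex.exp (s i) + w i.succ - Complex.exp (t - ∑ j, s j) - w 0 := by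
  have hsum : HasFDerivAt (fun s : Fin k → ℂ => ∑ j, (Complex.exp (s j) + w j.succ * s j))
      (∑ j : Fin k, (Complex.exp (s j) • (ContinuousLinearMap.proj j : (Fin k → ℂ) →L[ℂ] ℂ) +
        w j.succ • (ContinuousLinearMap.proj j : (Fin k → ℂ) →L[ℂ] ℂ))) s :=
    HasFDerivAt.fun_sum fun j _ =>
      (hasFDerivAt_apply j s).cexp.add ((hasFDerivAt_apply j s).const_mul (w j.succ))
  have hd : DifferentiableAt ℂ (fun s : Fin k → ℂ => t - ∑ j, s j) s := by fun_prop
  have h1 : partialDeriv (cpPotential w t) i s =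
      partialDeriv (fun s : Fin k → ℂ => ∑ j, (Complex.exp (s j) + w j.succ * s j)) i s +
      partialDeriv (fun s : Fin k → ℂ => Complex.exp (t - ∑ j, s j)) i s +
      partialDeriv (fun s : Fin k → ℂ => w 0 * (t - ∑ j, s j)) i s := by
    unfold cpPotential
    rw [partialDeriv_add (by fun_prop) (by fun_prop), partialDeriv_add (by fun_prop) (by fun_prop)]
  rw [h1, HasFDerivAt.partialDeriv_eq hsum, partialDeriv_exp hd, partialDeriv_const_mul hd,
    partialDeriv_const_sub_sum]
  simp only [sum_apply, add_apply, smul_apply, ContinuousLinearMap.proj_apply, Pi.single_apply,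
    smul_eq_mul, mul_ite, mul_one, mul_zero, Finset.sum_add_distrib, Finset.sum_ite_eq',
    Finset.mem_univ, if_true]
  ring

theorem exp_eq_mul_prod_exp (t : ℂ) (s : Fin k → ℂ) :
    Complex.exp t = Complex.exp (t - ∑ j, s j) * ∏ j, Complex.exp (s j) := by
  rw [← Complex.exp_sum, ← Complex.exp_add]
  simp

/-- The critical locus at infinity is empty: a bound for the gradient bounds all monomials. -/
theorem norm_exp_le_of_norm_partialDeriv_le (t : ℂ) (s : Fin k → ℂ) {P : ℝ} (hP0 : 0 ≤ P)
    (hP : ∀ i, ‖partialDeriv (cpPotential w t) i s‖ ≤ P) :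
    (∀ i, ‖Complex.exp (s i)‖ ≤
      (3 * (1 + ∑ i, ‖w i‖) + ‖Complex.exp t‖) * (1 + P)) ∧
    ‖Complex.exp (t - ∑ j, s j)‖ ≤ (3 * (1 + ∑ i, ‖w i‖) + ‖Complex.exp t‖) * (1 + P) := by
  set z := Complex.exp (t - ∑ j, s j) with hz
  set W := ∑ i, ‖w i‖ with hW
  have hW' : W = ‖w 0‖ + ∑ i : Fin k, ‖w i.succ‖ := Fin.sum_univ_succ _
  have hW0 : 0 ≤ W := Finset.sum_nonneg fun _ _ => norm_nonneg _
  have hdiff : ∀ i, ‖Complex.exp (s i) - z‖ ≤ 1 + P + W := by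
    intro i
    have h1 := hP i
    rw [partialDeriv_cpPotential] at h1
    have h2 : ‖w i.succ‖ ≤ ∑ i : Fin k, ‖w i.succ‖ :=
      Finset.single_le_sum (f := fun i : Fin k => ‖w i.succ‖) (fun _ _ => norm_nonneg _)
        (Finset.mem_univ i)
    have h3 : Complex.exp (s i) - z = (Complex.exp (s i) + w i.succ - z - w 0) - w i.succ + w 0 := by
      ring
    rw [h3]
    refine (norm_add_le _ _).trans ?_
    have := norm_sub_le (Complex.exp (s i) + w i.succ - z - w 0) (w i.succ)
    linarith
  -- All `u_i` are within `1 + P + W` of `z = x/(u_1⋯u_k)`. A very large `z` would force every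
  -- `‖u_i‖ ≥ 1`, and then `x = z u_1⋯u_k` would give `‖z‖ ≤ ‖x‖`.
  have hzle : ‖z‖ ≤ 2 * (1 + P + W) + ‖Complex.exp t‖ := by
    by_contra! hlt
    have h1 : ∀ i, 1 ≤ ‖Complex.exp (s i)‖ := by
      intro i
      have := norm_sub_norm_le z (Complex.exp (s i))
      rw [norm_sub_rev] at this
      have := hdiff i
      have := norm_nonneg (Complex.exp t)
      linarith
    have h2 : 1 ≤ ∏ i, ‖Complex.exp (s i)‖ := by
      simpa using Finset.prod_le_prod (s := Finset.univ) (fun _ _ => zero_le_one) fun i _ => h1 i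
    have h3 : ‖Complex.exp t‖ = ‖z‖ * ∏ i, ‖Complex.exp (s i)‖ := by
      rw [exp_eq_mul_prod_exp t s, norm_mul, norm_prod]
    have h4 : ‖z‖ ≤ ‖Complex.exp t‖ := h3 ▸ le_mul_of_one_le_right (norm_nonneg _) h2
    linarith
  have hX := norm_nonneg (Complex.exp t)
  have hfin : 3 * (1 + P + W) + ‖Complex.exp t‖ ≤ (3 * (1 + W) + ‖Complex.exp t‖) * (1 + P) := by
    nlinarith [mul_nonneg hW0 hP0, mul_nonneg hX hP0]
  refine ⟨fun i => ?_, ?_⟩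
  · have h1 := norm_sub_norm_le (Complex.exp (s i)) z
    have h2 := hdiff i
    linarith
  · linarith

end Potential

/-! ### Growth of the monomials along a thimble -/

/-- A function with positive derivative at `0` takes larger values to the right of `0`. -/
theorem eventually_gt_of_hasDerivAt_pos {g : ℝ → ℝ} {g' : ℝ} (h : HasDerivAt g g' 0)
    (hg' : 0 < g') : ∀ᶠ τ in 𝓝[>] (0 : ℝ), g 0 < g τ := by
  have h1 := (hasDerivAt_iff_tendsto_slope_zero.mp h).mono_left
    (nhdsWithin_mono 0 fun x (hx : 0 < x) => hx.ne')
  filter_upwards [h1.eventually (lt_mem_nhds hg'), self_mem_nhdsWithin] with τ h2 (h3 : 0 < τ)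
  rw [zero_add, smul_eq_mul] at h2
  have := pos_of_mul_pos_right h2 (inv_nonneg.mpr h3.le)
  linarith

/-- On a thimble of the mirror potential of projective space the monomials of the potential grow at
most linearly in the value of the potential. -/
theorem IsLefschetzThimble.exists_norm_exp_le {k : ℕ} {w : Fin (k + 1) → ℂ} {ħ t₀ : ℂ}
    (hħ : ħ ≠ 0) {c : Fin k → ℂ} {γ : EuclideanSpace ℝ (Fin k) → (Fin k → ℂ)}
    (hγ : IsLefschetzThimble (cpPotential w t₀) ħ c γ) :
    ∃ C : ℝ, 1 ≤ C ∧ ∀ y, (∀ i, ‖Complex.exp (γ y i)‖ ≤ C * (1 + ‖y‖ ^ 2)) ∧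
      ‖Complex.exp (t₀ - ∑ j, γ y j)‖ ≤ C * (1 + ‖y‖ ^ 2) := by
  set p : Fin k → EuclideanSpace ℝ (Fin k) → ℂ :=
    fun i y => partialDeriv (cpPotential w t₀) i (γ y) with hp
  set u : EuclideanSpace ℝ (Fin k) → ℝ := fun y => ∑ i, ‖p i y‖ ^ 2 with hu
  set C₀ : ℝ := 3 * (1 + ∑ i, ‖w i‖) + ‖Complex.exp t₀‖ with hC₀
  have hC₀1 : 1 ≤ C₀ := by
    have h1 : 0 ≤ ∑ i, ‖w i‖ := Finset.sum_nonneg fun _ _ => norm_nonneg _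
    have h2 := norm_nonneg (Complex.exp t₀)
    linarith
  have hħ' : 0 < ‖ħ‖ := norm_pos_iff.mpr hħ
  -- The second summand is the ratio between the possible growth rate of `u` and the rate at which
  -- `‖y‖²` changes along the descent field; the `1` makes `P ≥ 1` below, so that `1 + P ≤ 2P`.
  set K : ℝ := 1 + 2 * k * (k + 1) * C₀ * ‖ħ‖ with hK
  have hK1 : 1 ≤ K := by
    have : 0 ≤ 2 * k * (k + 1) * C₀ * ‖ħ‖ := by positivity
    linarith
  have hu0 : ∀ y, 0 ≤ u y := fun y => Finset.sum_nonneg fun _ _ => sq_nonneg _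
  have hpu : ∀ i y, ‖p i y‖ ≤ Real.sqrt (u y) := fun i y => Real.le_sqrt_of_sq_le
    (Finset.single_le_sum (f := fun i => ‖p i y‖ ^ 2) (fun _ _ => sq_nonneg _) (Finset.mem_univ i))
  have hpe : ∀ i y, p i y = Complex.exp (γ y i) + w i.succ - Complex.exp (t₀ - ∑ j, γ y j) - w 0 :=
    fun i y => partialDeriv_cpPotential w t₀ i (γ y)
  have hγi : ∀ i, Continuous fun y => γ y i :=
    fun i => (continuous_apply i).comp hγ.smooth.continuous
  have hpc : ∀ i, Continuous (p i) := by
    intro i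
    rw [funext (hpe i)]
    fun_prop
  have huc : Continuous u := continuous_finsetSum _ fun i _ => (hpc i).norm.pow 2
  have key : ∀ y, Real.sqrt (u y) ≤ K * (1 + ‖y‖ ^ 2) := by
    intro y
    set ψ : EuclideanSpace ℝ (Fin k) → ℝ := fun y => u y / (1 + ‖y‖ ^ 2) ^ 2 with hψ
    have hψc : Continuous ψ := huc.div (by fun_prop) fun y => by positivity
    -- A maximum principle replaces integration of the flow. If the maximum of `‖∇f‖² / (1 + ‖y‖²)²`
    -- on the ball exceeded `K²`, a short move against the descent direction would stay in the ball
    -- and make the quotient larger.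
    obtain ⟨x, hx, hmax⟩ := (isCompact_closedBall (0 : EuclideanSpace ℝ (Fin k)) ‖y‖).exists_isMaxOn
      ⟨y, by simp⟩ hψc.continuousOn
    have hle : ψ x ≤ K ^ 2 := by
      by_contra! hlt
      set M := ψ x with hM
      set P := Real.sqrt (u x) with hP
      have hP0 : 0 ≤ P := Real.sqrt_nonneg _
      have hPsq : P ^ 2 = u x := Real.sq_sqrt (hu0 x)
      have hr1 : 1 ≤ 1 + ‖x‖ ^ 2 := by nlinarith [sq_nonneg ‖x‖]
      have hMu : M * (1 + ‖x‖ ^ 2) ^ 2 = u x := div_mul_cancel₀ _ (by positivity)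
      have hPK : K * (1 + ‖x‖ ^ 2) < P := by
        refine lt_of_pow_lt_pow_left₀ 2 hP0 ?_
        rw [hPsq, ← hMu, mul_pow]
        exact mul_lt_mul_of_pos_right hlt (by positivity)
      have hP1 : 1 ≤ P := by nlinarith
      obtain ⟨η, hη⟩ := hγ.descent x
      have hV : ∀ i, ‖fderiv ℝ γ x η i‖ ≤ P / ‖ħ‖ := by
        intro i
        rw [hη]
        simp only [norm_neg, RCLike.norm_conj, norm_div]
        exact div_le_div_of_nonneg_right (hpu i x) hħ'.le
      -- The value of `f` changes along the descent field at a rate given by `‖∇f‖²`; by the level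
      -- condition this is the speed of `‖y‖²`.
      have hinner : 2 * inner ℝ x η = P ^ 2 / ‖ħ‖ ^ 2 := by
        have h1 := hγ.sum_partialDeriv ((contDiff_cpPotential w t₀).differentiable (by simp)) x η
        have h2 : ∑ l, fderiv ℝ γ x η l * partialDeriv (cpPotential w t₀) l (γ x) =
            -((u x : ℝ) : ℂ) / (starRingEnd ℂ) ħ := by
          rw [hη, hu]
          push_cast
          rw [neg_div, Finset.sum_div, ← Finset.sum_neg_distrib]
          refine Finset.sum_congr rfl fun l _ => ?_
          rw [← Complex.conj_mul', map_div₀]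
          ring
        rw [h2] at h1
        have h3 : (starRingEnd ℂ) ħ ≠ 0 := by simpa using hħ
        have h4 : ((u x : ℝ) : ℂ) = ((‖ħ‖ ^ 2 * (2 * inner ℝ x η) : ℝ) : ℂ) := by
          have h5 : (starRingEnd ℂ) ħ * ħ = ((‖ħ‖ ^ 2 : ℝ) : ℂ) := by
            rw [Complex.conj_mul']; push_cast; rfl
          rw [Complex.ofReal_mul (‖ħ‖ ^ 2), ← h5]
          field_simp at h1
          linear_combination -h1
        have h6 := Complex.ofReal_injective h4
        rw [hPsq, h6]
        field_simp
      have hPpos : 0 < P := by linarith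
      -- the curve `x - τ η`
      have hline : HasDerivAt (fun τ : ℝ => x - τ • η) (-η) 0 := by
        simpa using ((hasDerivAt_id (0 : ℝ)).smul_const η).const_sub x
      have hx0 : x - (0 : ℝ) • η = x := by simp
      have hr : HasDerivAt (fun τ : ℝ => ‖x - τ • η‖ ^ 2) (-(P ^ 2 / ‖ħ‖ ^ 2)) 0 := by
        have := hline.norm_sq
        rw [hx0, inner_neg_right, mul_neg, hinner] at this
        exact this
      have hγl : ∀ i, HasDerivAt (fun τ : ℝ => γ (x - τ • η) i) (-(fderiv ℝ γ x η i)) 0 := by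
        intro i
        have h1 : HasFDerivAt γ (fderiv ℝ γ x) (x - (0 : ℝ) • η) := by
          rw [hx0]; exact (hγ.differentiable x).hasFDerivAt
        have h2 := h1.comp_hasDerivAt (0 : ℝ) hline
        have h3 := hasDerivAt_pi.mp h2 i
        simpa using h3
      -- The derivative of the gradient involves only the monomials `u_i` and `x_0/(u_1⋯u_k)`, which
      -- are themselves `O(1 + P)`. So the gradient changes at rate `O(P²)` when `P ≥ 1`, and its
      -- square at rate `O(P³)`.
      have hpl : ∀ i, ∃ q : ℂ, HasDerivAt (fun τ : ℝ => p i (x - τ • η)) q 0 ∧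
          ‖q‖ ≤ C₀ * (1 + P) * ((k + 1) * (P / ‖ħ‖)) := by
        intro i
        obtain ⟨ha, hz⟩ := norm_exp_le_of_norm_partialDeriv_le w t₀ (γ x) hP0 fun i => hpu i x
        have h1 := (hγl i).cexp
        have h2 := ((HasDerivAt.fun_sum (u := Finset.univ) fun j _ => hγl j).const_sub t₀).cexp
        have h3 := ((h1.add_const (w i.succ)).sub h2).sub_const (w 0)
        rw [hx0] at h3
        have h3' := h3.congr_of_eventuallyEq (Eventually.of_forall fun τ => hpe i (x - τ • η))
        refine ⟨_, h3', ?_⟩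
        · refine (norm_sub_le _ _).trans ?_
          rw [norm_mul, norm_mul, norm_neg, norm_neg]
          have h4 : ‖∑ j, -(fderiv ℝ γ x η j)‖ ≤ k * (P / ‖ħ‖) := by
            refine (norm_sum_le _ _).trans ?_
            refine (Finset.sum_le_card_nsmul _ _ (P / ‖ħ‖) fun j _ => ?_).trans ?_
            · rw [norm_neg]; exact hV j
            · simp
          have h5 : 0 ≤ C₀ * (1 + P) := by positivity
          have h6 := mul_le_mul (ha i) (hV i) (norm_nonneg _) h5
          have h7 := mul_le_mul hz h4 (norm_nonneg _) h5
          calc _ ≤ _ := add_le_add h6 h7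
            _ = _ := by rw [hC₀]; ring
      choose q hq hqle using hpl
      have hul : HasDerivAt (fun τ : ℝ => u (x - τ • η)) (∑ i, 2 * inner ℝ (p i x) (q i)) 0 := by
        have := HasDerivAt.fun_sum (u := Finset.univ) fun i _ => (hq i).norm_sq
        simpa only [hx0] using this
      have hulb : -(k * (2 * (P * (C₀ * (1 + P) * ((k + 1) * (P / ‖ħ‖)))))) ≤
          ∑ i, 2 * inner ℝ (p i x) (q i) := by
        have h1 : ∀ i ∈ (Finset.univ : Finset (Fin k)),
            -(2 * (P * (C₀ * (1 + P) * ((k + 1) * (P / ‖ħ‖))))) ≤ 2 * inner ℝ (p i x) (q i) := by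
          intro i _
          have h2 := neg_le_of_abs_le (abs_real_inner_le_norm (p i x) (q i))
          have h3 := mul_le_mul (hpu i x) (hqle i) (norm_nonneg _) hP0
          linarith
        have := Finset.card_nsmul_le_sum _ _ _ h1
        simpa using this
      -- This function vanishes at `τ = 0` and is nonpositive wherever the curve stays in the ball.
      -- Its derivative is positive: the second term contributes `2P⁴ / ((1 + ‖x‖²)‖ħ‖²)`, which
      -- exceeds the loss of order `P³` because `P > K (1 + ‖x‖²)`.
      have hG : HasDerivAt (fun τ : ℝ => u (x - τ • η) - M * (1 + ‖x - τ • η‖ ^ 2) ^ 2)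
          (∑ i, 2 * inner ℝ (p i x) (q i) + M * (2 * (1 + ‖x‖ ^ 2) * (P ^ 2 / ‖ħ‖ ^ 2))) 0 := by
        refine (hul.fun_sub (((hr.const_add 1).fun_pow 2).const_mul M)).congr_deriv ?_
        rw [hx0]
        norm_num
      have hG' := eventually_gt_of_hasDerivAt_pos hG (by
        have h1 : M * (1 + ‖x‖ ^ 2) = P ^ 2 / (1 + ‖x‖ ^ 2) := by
          rw [eq_div_iff (by positivity), hPsq, ← hMu]; ring
        have h2 : K < P / (1 + ‖x‖ ^ 2) := by rwa [lt_div_iff₀ (by positivity)]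
        have h3 : K * (2 * P ^ 3 / ‖ħ‖ ^ 2) < P / (1 + ‖x‖ ^ 2) * (2 * P ^ 3 / ‖ħ‖ ^ 2) :=
          mul_lt_mul_of_pos_right h2 (by positivity)
        have h4 : k * (2 * (P * (C₀ * (1 + P) * ((k + 1) * (P / ‖ħ‖))))) ≤
            K * (2 * P ^ 3 / ‖ħ‖ ^ 2) := by
          have h5 : k * (2 * (P * (C₀ * (1 + P) * ((k + 1) * (P / ‖ħ‖))))) ≤
              k * (2 * (P * (C₀ * (2 * P) * ((k + 1) * (P / ‖ħ‖))))) := by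
            gcongr; linarith
          refine h5.trans ?_
          have h6 : k * (2 * (P * (C₀ * (2 * P) * ((k + 1) * (P / ‖ħ‖))))) =
              (2 * k * (k + 1) * C₀ * ‖ħ‖) * (2 * P ^ 3 / ‖ħ‖ ^ 2) := by
            field_simp
          rw [h6]
          gcongr
          linarith
        have h7 : M * (2 * (1 + ‖x‖ ^ 2) * (P ^ 2 / ‖ħ‖ ^ 2)) =
            P / (1 + ‖x‖ ^ 2) * (2 * P ^ 3 / ‖ħ‖ ^ 2) := by
          rw [show M * (2 * (1 + ‖x‖ ^ 2) * (P ^ 2 / ‖ħ‖ ^ 2)) =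
            2 * (M * (1 + ‖x‖ ^ 2)) * (P ^ 2 / ‖ħ‖ ^ 2) by ring, h1]
          field_simp
        linarith)
      have hr' := eventually_gt_of_hasDerivAt_pos hr.neg (by simp; positivity)
      obtain ⟨τ, h1, h2⟩ := (hG'.and hr').exists
      simp only [hx0, Pi.neg_apply] at h1 h2
      have h3 : x - τ • η ∈ closedBall (0 : EuclideanSpace ℝ (Fin k)) ‖y‖ := by
        rw [mem_closedBall_zero_iff] at hx ⊢
        have : ‖x - τ • η‖ ^ 2 ≤ ‖y‖ ^ 2 := by nlinarith [norm_nonneg x]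
        exact le_of_sq_le_sq this (norm_nonneg _)
      have h4 : ψ (x - τ • η) ≤ M := hmax h3
      have h5 : u (x - τ • η) ≤ M * (1 + ‖x - τ • η‖ ^ 2) ^ 2 := by
        rwa [hψ, div_le_iff₀ (by positivity)] at h4
      linarith
    have h1 : ψ y ≤ K ^ 2 := (hmax (by simp)).trans hle
    rw [hψ, div_le_iff₀ (by positivity), ← mul_pow] at h1
    exact (Real.sqrt_le_left (by positivity)).mpr h1
  refine ⟨C₀ * (1 + K), by nlinarith, fun y => ?_⟩
  obtain ⟨ha, hz⟩ := norm_exp_le_of_norm_partialDeriv_le w t₀ (γ y) (Real.sqrt_nonneg (u y))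
    fun i => hpu i y
  have h1 : C₀ * (1 + Real.sqrt (u y)) ≤ C₀ * (1 + K) * (1 + ‖y‖ ^ 2) := by
    rw [mul_assoc]
    refine mul_le_mul_of_nonneg_left ?_ (by linarith)
    nlinarith [key y, sq_nonneg ‖y‖]
  exact ⟨fun i => (ha i).trans h1, hz.trans h1⟩

/-! ### Convergence of the integral of projective space -/

section Convergence

variable {k : ℕ} (w : Fin (k + 1) → ℂ) (ħ : ℂ) (γ : EuclideanSpace ℝ (Fin k) → (Fin k → ℂ))

/-- The integrand is the exponential of a linear function of `x = exp t`, up to a factor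
`exp (w 0 * t / ħ)`. -/
theorem cpIntegrand_eq (t : ℂ) (y : EuclideanSpace ℝ (Fin k)) :
    cpIntegrand w ħ γ t y = Complex.exp (w 0 * t / ħ) *
      (Complex.exp (Complex.exp t * (Complex.exp (-∑ i, γ y i) / ħ)) *
      (Complex.exp (((∑ i, (Complex.exp (γ y i) + w i.succ * γ y i)) - w 0 * ∑ i, γ y i) / ħ) *
        formDensity γ y)) := by
  rw [← mul_assoc, ← mul_assoc, ← Complex.exp_add, ← Complex.exp_add, cpIntegrand, cpPotential]
  congr 2
  rw [sub_eq_add_neg t, Complex.exp_add]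
  ring

theorem differentiable_cpIntegrand (y : EuclideanSpace ℝ (Fin k)) :
    Differentiable ℂ fun t => cpIntegrand w ħ γ t y := by
  simp only [cpIntegrand_eq]
  fun_prop

theorem continuous_cpIntegrand (hγ : ContDiff ℝ ((⊤ : ℕ∞) : WithTop ℕ∞) γ) (t : ℂ) :
    Continuous (cpIntegrand w ħ γ t) := by
  unfold cpIntegrand
  have h1 := (contDiff_cpPotential w t).continuous.comp hγ.continuous
  exact ((h1.div_const ħ).cexp).mul (formDensity_continuous hγ)

theorem hasDerivAt_cpIntegrand (t : ℂ) (y : EuclideanSpace ℝ (Fin k)) :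
    HasDerivAt (fun t => cpIntegrand w ħ γ t y)
      ((Complex.exp (t - ∑ i, γ y i) + w 0) / ħ * cpIntegrand w ħ γ t y) t := by
  have h0 : HasDerivAt (fun t : ℂ => t - ∑ i, γ y i) 1 t := (hasDerivAt_id t).sub_const _
  have h1 : HasDerivAt (fun t => cpPotential w t (γ y))
      (Complex.exp (t - ∑ i, γ y i) * 1 + w 0 * 1) t :=
    (h0.cexp.const_add (∑ i, (Complex.exp (γ y i) + w i.succ * γ y i))).add (h0.const_mul (w 0))
  have h2 := ((h1.div_const ħ).cexp).mul_const (formDensity γ y)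
  refine h2.congr_deriv ?_
  simp only [cpIntegrand]
  ring

variable {w ħ γ}

/-- The norm of the integrand is dominated by its values at points `τ` such that `exp t` lies in
the convex hull of the points `exp τ`. -/
theorem norm_cpIntegrand_le {t : ℂ} {S : Finset ℂ}
    (hS : ∀ κ : ℂ, ∃ τ ∈ S, (Complex.exp t * κ).re ≤ (Complex.exp τ * κ).re)
    (y : EuclideanSpace ℝ (Fin k)) :
    ‖cpIntegrand w ħ γ t y‖ ≤ ‖Complex.exp (w 0 * t / ħ)‖ *
      ∑ τ ∈ S, ‖Complex.exp (w 0 * τ / ħ)‖⁻¹ * ‖cpIntegrand w ħ γ τ y‖ := by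
  obtain ⟨τ, hτ, hle⟩ := hS (Complex.exp (-∑ i, γ y i) / ħ)
  have h1 : ‖Complex.exp (w 0 * τ / ħ)‖⁻¹ * ‖cpIntegrand w ħ γ τ y‖ ≤
      ∑ τ ∈ S, ‖Complex.exp (w 0 * τ / ħ)‖⁻¹ * ‖cpIntegrand w ħ γ τ y‖ :=
    Finset.single_le_sum (f := fun τ => ‖Complex.exp (w 0 * τ / ħ)‖⁻¹ * ‖cpIntegrand w ħ γ τ y‖)
      (fun _ _ => by positivity) hτ
  rw [cpIntegrand_eq, norm_mul]
  refine mul_le_mul_of_nonneg_left (le_trans ?_ h1) (norm_nonneg _)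
  have h2 : ‖Complex.exp (w 0 * τ / ħ)‖ ≠ 0 := norm_ne_zero_iff.mpr (Complex.exp_ne_zero _)
  rw [cpIntegrand_eq, norm_mul (Complex.exp (w 0 * τ / ħ)), inv_mul_cancel_left₀ h2, norm_mul,
    norm_mul (Complex.exp (Complex.exp τ * _))]
  refine mul_le_mul_of_nonneg_right ?_ (norm_nonneg _)
  rw [Complex.norm_exp, Complex.norm_exp]
  exact Real.exp_le_exp.mpr hle

theorem integrable_cpIntegrand_of_convex (hγ : ContDiff ℝ ((⊤ : ℕ∞) : WithTop ℕ∞) γ) {t : ℂ}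
    {S : Finset ℂ} (hS : ∀ κ : ℂ, ∃ τ ∈ S, (Complex.exp t * κ).re ≤ (Complex.exp τ * κ).re)
    (hint : ∀ τ ∈ S, Integrable (cpIntegrand w ħ γ τ)) : Integrable (cpIntegrand w ħ γ t) :=
  ((integrable_finsetSum S fun τ hτ => (hint τ hτ).norm.const_mul _).const_mul _).mono'
    (continuous_cpIntegrand w ħ γ hγ t).aestronglyMeasurable
    (Eventually.of_forall fun y => norm_cpIntegrand_le hS y)

/-- The integral converges on a horizontal segment when it converges at the endpoints. -/
theorem integrable_cpIntegrand_of_segment (hγ : ContDiff ℝ ((⊤ : ℕ∞) : WithTop ℕ∞) γ) {t : ℂ}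
    {σ₁ σ₂ : ℝ} (h1 : σ₁ ≤ 0) (h2 : 0 ≤ σ₂) (hi1 : Integrable (cpIntegrand w ħ γ (t + σ₁)))
    (hi2 : Integrable (cpIntegrand w ħ γ (t + σ₂))) : Integrable (cpIntegrand w ħ γ t) := by
  refine integrable_cpIntegrand_of_convex hγ (S := {t + σ₁, t + σ₂}) (fun κ => ?_) ?_
  · have e : ∀ σ : ℝ, (Complex.exp (t + σ) * κ).re = Real.exp σ * (Complex.exp t * κ).re := by
      intro σ
      rw [Complex.exp_add, ← Complex.ofReal_exp, mul_comm (Complex.exp t), mul_assoc,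
        Complex.re_ofReal_mul]
    rcases le_total 0 (Complex.exp t * κ).re with h | h
    · refine ⟨t + σ₂, by simp, ?_⟩
      rw [e]
      exact le_mul_of_one_le_left h (Real.one_le_exp h2)
    · refine ⟨t + σ₁, by simp, ?_⟩
      rw [e]
      have := Real.exp_le_one_iff.mpr h1
      nlinarith
  · intro τ hτ
    rcases Finset.mem_insert.mp hτ with rfl | hτ
    · exact hi1
    · rw [Finset.mem_singleton.mp hτ]
      exact hi2

/-- Up to a factor independent of `y`, the dependence on `x` is `exp(κ x)` with `κ` depending on
`y`, and the norm of this is maximal over a square at one of its corners. Integrability at four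
points therefore dominates the integrand nearby; openness of `exp` supplies logarithms of the
corners inside `U`. -/
theorem locDominated_cpIntegrand (hγ : ContDiff ℝ ((⊤ : ℕ∞) : WithTop ℕ∞) γ) {U : Set ℂ}
    (hU : IsOpen U) (hint : ∀ t ∈ U, Integrable (cpIntegrand w ħ γ t)) :
    LocDominated volume U (cpIntegrand w ħ γ) where
  holo y := (differentiable_cpIntegrand w ħ γ y).differentiableOn
  meas t _ := (continuous_cpIntegrand w ħ γ hγ t).aestronglyMeasurable
  bound t ht := by
    have hopen : Complex.exp '' U ∈ 𝓝 (Complex.exp t) :=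
      (Complex.isOpenMap_exp U hU).mem_nhds ⟨t, ht, rfl⟩
    obtain ⟨r, hr, hball⟩ := Metric.mem_nhds_iff.mp hopen
    set ρ : ℝ := r / 4 with hρ
    have hρ0 : 0 < ρ := by positivity
    have hvert : ∀ a b : ℝ, |a| = ρ → |b| = ρ →
        ∃ τ ∈ U, Complex.exp τ = Complex.exp t + (a + b * Complex.I) := by
      intro a b ha hb
      have : Complex.exp t + (a + b * Complex.I) ∈ ball (Complex.exp t) r := by
        rw [mem_ball, dist_eq_norm, add_sub_cancel_left]
        refine (norm_add_le _ _).trans_lt ?_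
        rw [norm_mul, Complex.norm_I, mul_one, Complex.norm_real, Complex.norm_real,
          Real.norm_eq_abs, Real.norm_eq_abs, ha, hb]
        linarith
      exact hball this
    have hρa : |ρ| = ρ := abs_of_pos hρ0
    have hρn : |-ρ| = ρ := by rw [abs_neg, hρa]
    obtain ⟨τ₁, hτ₁, e₁⟩ := hvert ρ ρ hρa hρa
    obtain ⟨τ₂, hτ₂, e₂⟩ := hvert ρ (-ρ) hρa hρn
    obtain ⟨τ₃, hτ₃, e₃⟩ := hvert (-ρ) ρ hρn hρa
    obtain ⟨τ₄, hτ₄, e₄⟩ := hvert (-ρ) (-ρ) hρn hρn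
    set S : Finset ℂ := {τ₁, τ₂, τ₃, τ₄} with hS
    have hSU : ∀ τ ∈ S, τ ∈ U := by
      intro τ hτ
      simp only [hS, Finset.mem_insert, Finset.mem_singleton] at hτ
      rcases hτ with rfl | rfl | rfl | rfl <;> assumption
    have hev : ∀ᶠ t' in 𝓝 t, ‖Complex.exp t' - Complex.exp t‖ < ρ ∧
        ‖Complex.exp (w 0 * t' / ħ)‖ < ‖Complex.exp (w 0 * t / ħ)‖ + 1 ∧ t' ∈ U := by
      have c1 : Continuous fun t' => ‖Complex.exp t' - Complex.exp t‖ := by fun_prop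
      have c2 : Continuous fun t' => ‖Complex.exp (w 0 * t' / ħ)‖ := by fun_prop
      exact (c1.continuousAt.eventually (gt_mem_nhds (by simpa using hρ0))).and
        ((c2.continuousAt.eventually (gt_mem_nhds (by linarith))).and (hU.mem_nhds ht))
    obtain ⟨δ, hδ, hsub⟩ := Metric.eventually_nhds_iff_ball.mp hev
    refine ⟨δ, hδ, fun t' ht' => (hsub t' ht').2.2, fun y => (‖Complex.exp (w 0 * t / ħ)‖ + 1) *
      ∑ τ ∈ S, ‖Complex.exp (w 0 * τ / ħ)‖⁻¹ * ‖cpIntegrand w ħ γ τ y‖, ?_, fun t' ht' y => ?_⟩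
    · exact (integrable_finsetSum S fun τ hτ => (hint τ (hSU τ hτ)).norm.const_mul _).const_mul _
    · obtain ⟨h1, h2, -⟩ := hsub t' ht'
      refine (norm_cpIntegrand_le (S := S) (fun κ => ?_) y).trans
        (mul_le_mul_of_nonneg_right h2.le (Finset.sum_nonneg fun _ _ => by positivity))
      have hre := (abs_le.mp ((Complex.abs_re_le_norm _).trans h1.le))
      have him := (abs_le.mp ((Complex.abs_im_le_norm _).trans h1.le))
      rw [Complex.sub_re] at hre
      rw [Complex.sub_im] at him
      -- The real part of `(a + b i) κ` is `a Re κ - b Im κ`, so the corner is chosen with `a` of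
      -- the sign of `Re κ` and `b` of the sign opposite to `Im κ`.
      rcases le_total 0 κ.re with hp | hp <;> rcases le_total 0 κ.im with hq | hq
      · refine ⟨τ₂, by simp [hS], ?_⟩
        rw [e₂]
        simp
        nlinarith
      · refine ⟨τ₁, by simp [hS], ?_⟩
        rw [e₁]
        simp
        nlinarith
      · refine ⟨τ₄, by simp [hS], ?_⟩
        rw [e₄]
        simp
        nlinarith
      · refine ⟨τ₃, by simp [hS], ?_⟩
        rw [e₃]
        simp
        nlinarith

end Convergence

/-! ### Regularized integrands -/

/-- Polynomials in `ε`, `ε u_i` and `ε x / (u_1 ⋯ u_k)`, as families of functions of `log u`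
indexed by `ε`, together with their limit at `ε = 0`. -/
inductive IsSymbol {k : ℕ} (t₀ : ℂ) : (ℝ → (Fin k → ℂ) → ℂ) → ℂ → Prop
  | const (a : ℂ) : IsSymbol t₀ (fun _ _ => a) a
  | eps : IsSymbol t₀ (fun ε _ => (ε : ℂ)) 0
  | exp (i : Fin k) : IsSymbol t₀ (fun ε s => ε * Complex.exp (s i)) 0
  | quot : IsSymbol t₀ (fun ε s => ε * Complex.exp (t₀ - ∑ j, s j)) 0
  | add {Q Q' : ℝ → (Fin k → ℂ) → ℂ} {κ κ' : ℂ} : IsSymbol t₀ Q κ → IsSymbol t₀ Q' κ' →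
      IsSymbol t₀ (fun ε s => Q ε s + Q' ε s) (κ + κ')
  | mul {Q Q' : ℝ → (Fin k → ℂ) → ℂ} {κ κ' : ℂ} : IsSymbol t₀ Q κ → IsSymbol t₀ Q' κ' →
      IsSymbol t₀ (fun ε s => Q ε s * Q' ε s) (κ * κ')

namespace IsSymbol

variable {k : ℕ} {t₀ : ℂ} {Q : ℝ → (Fin k → ℂ) → ℂ} {κ : ℂ}

theorem of_eq {Q' : ℝ → (Fin k → ℂ) → ℂ} {κ' : ℂ} (h : IsSymbol t₀ Q κ)
    (hQ : ∀ ε s, Q ε s = Q' ε s) (hκ : κ = κ') : IsSymbol t₀ Q' κ' := by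
  have : Q = Q' := by
    funext ε s
    exact hQ ε s
  rwa [← this, ← hκ]

theorem contDiff (h : IsSymbol t₀ Q κ) (ε : ℝ) :
    ContDiff ℂ ((⊤ : ℕ∞) : WithTop ℕ∞) (Q ε) := by
  induction h with
  | const a => exact contDiff_const
  | eps => exact contDiff_const
  | exp i => fun_prop
  | quot => fun_prop
  | add _ _ h1 h2 => exact h1.add h2
  | mul _ _ h1 h2 => exact h1.mul h2

theorem differentiable (h : IsSymbol t₀ Q κ) (ε : ℝ) : Differentiable ℂ (Q ε) :=
  (h.contDiff ε).differentiable (by simp)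

theorem tendsto (h : IsSymbol t₀ Q κ) (s : Fin k → ℂ) :
    Tendsto (fun ε => Q ε s) (𝓝 0) (𝓝 κ) := by
  have h0 : Tendsto (fun ε : ℝ => (ε : ℂ)) (𝓝 0) (𝓝 0) := by
    simpa using Complex.continuous_ofReal.tendsto 0
  induction h with
  | const a => exact tendsto_const_nhds
  | eps => exact h0
  | exp i => simpa using h0.mul_const (Complex.exp (s i))
  | quot => simpa using h0.mul_const (Complex.exp (t₀ - ∑ j, s j))
  | add _ _ h1 h2 => exact h1.add h2
  | mul _ _ h1 h2 => exact h1.mul h2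

/-- Each generator that depends on `s` carries a factor `ε`, which differentiation preserves; hence
the limit `0` for the derivative. -/
theorem exists_partialDeriv (h : IsSymbol t₀ Q κ) (i : Fin k) :
    ∃ Q', IsSymbol t₀ Q' 0 ∧ ∀ ε s, partialDeriv (Q ε) i s = Q' ε s := by
  induction h with
  | const a => exact ⟨_, const 0, fun ε s => partialDeriv_const _ _ _⟩
  | eps => exact ⟨_, const 0, fun ε s => partialDeriv_const _ _ _⟩
  | exp j =>
    refine ⟨_, ((const (if j = i then 1 else 0)).mul (exp j)).of_eq (fun _ _ => rfl) (mul_zero _),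
      fun ε s => ?_⟩
    rw [partialDeriv_const_mul (by fun_prop), partialDeriv_exp (by fun_prop), partialDeriv_coord]
    ring
  | quot =>
    refine ⟨_, ((const (-1)).mul quot).of_eq (fun _ _ => rfl) (mul_zero _), fun ε s => ?_⟩
    rw [partialDeriv_const_mul (by fun_prop), partialDeriv_exp (by fun_prop),
      partialDeriv_const_sub_sum]
    ring
  | add h1 h2 ih1 ih2 =>
    obtain ⟨R1, hR1, e1⟩ := ih1
    obtain ⟨R2, hR2, e2⟩ := ih2
    refine ⟨_, (hR1.add hR2).of_eq (fun _ _ => rfl) (add_zero _), fun ε s => ?_⟩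
    rw [partialDeriv_add (h1.differentiable ε s) (h2.differentiable ε s), e1, e2]
  | mul h1 h2 ih1 ih2 =>
    obtain ⟨R1, hR1, e1⟩ := ih1
    obtain ⟨R2, hR2, e2⟩ := ih2
    refine ⟨_, ((h1.mul hR2).add (hR1.mul h2)).of_eq (fun _ _ => rfl) (by ring), fun ε s => ?_⟩
    rw [partialDeriv_mul (h1.differentiable ε s) (h2.differentiable ε s), e1, e2]

/-- On a cycle where the monomials grow at most like `1 + ‖y‖ ^ 2`, a symbol is bounded by a power
of `1 + ε (1 + ‖y‖ ^ 2)`. -/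
theorem exists_norm_le (h : IsSymbol t₀ Q κ) {E : Type*} [NormedAddCommGroup E]
    {γ : E → (Fin k → ℂ)} {C : ℝ} (hC1 : 1 ≤ C)
    (hC : ∀ y, (∀ i, ‖Complex.exp (γ y i)‖ ≤ C * (1 + ‖y‖ ^ 2)) ∧
      ‖Complex.exp (t₀ - ∑ j, γ y j)‖ ≤ C * (1 + ‖y‖ ^ 2)) :
    ∃ A : ℝ, 0 ≤ A ∧ ∃ d : ℕ, ∀ ε : ℝ, 0 < ε → ∀ y,
      ‖Q ε (γ y)‖ ≤ A * (1 + ε * (1 + ‖y‖ ^ 2)) ^ d := by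
  have hgen : ∀ {z : ℂ} {ε : ℝ} {y : E}, 0 < ε → ‖z‖ ≤ C * (1 + ‖y‖ ^ 2) →
      ‖(ε : ℂ) * z‖ ≤ C * (1 + ε * (1 + ‖y‖ ^ 2)) ^ 1 := by
    intro z ε y hε hz
    rw [norm_mul, Complex.norm_real, Real.norm_of_nonneg hε.le, pow_one]
    have := mul_le_mul_of_nonneg_left hz hε.le
    nlinarith
  induction h with
  | const a => exact ⟨‖a‖, norm_nonneg _, 0, fun ε hε y => by simp⟩
  | eps =>
    refine ⟨C, by linarith, 1, fun ε hε y => ?_⟩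
    have h1 : ‖(1 : ℂ)‖ ≤ C * (1 + ‖y‖ ^ 2) := by
      rw [norm_one]
      nlinarith [sq_nonneg ‖y‖]
    simpa using hgen hε h1
  | exp i => exact ⟨C, by linarith, 1, fun ε hε y => hgen hε ((hC y).1 i)⟩
  | quot => exact ⟨C, by linarith, 1, fun ε hε y => hgen hε (hC y).2⟩
  | add _ _ ih1 ih2 =>
    obtain ⟨A, hA, d, h1⟩ := ih1
    obtain ⟨A', hA', d', h2⟩ := ih2
    refine ⟨A + A', by positivity, d + d', fun ε hε y => ?_⟩
    have hx : 1 ≤ 1 + ε * (1 + ‖y‖ ^ 2) := by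
      have : 0 ≤ ε * (1 + ‖y‖ ^ 2) := by positivity
      linarith
    refine (norm_add_le _ _).trans ?_
    rw [add_mul]
    exact add_le_add
      ((h1 ε hε y).trans (mul_le_mul_of_nonneg_left (pow_le_pow_right₀ hx (by omega)) hA))
      ((h2 ε hε y).trans (mul_le_mul_of_nonneg_left (pow_le_pow_right₀ hx (by omega)) hA'))
  | mul _ _ ih1 ih2 =>
    obtain ⟨A, hA, d, h1⟩ := ih1
    obtain ⟨A', hA', d', h2⟩ := ih2
    refine ⟨A * A', by positivity, d + d', fun ε hε y => ?_⟩
    rw [norm_mul, pow_add, mul_mul_mul_comm]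
    exact mul_le_mul (h1 ε hε y) (h2 ε hε y) (norm_nonneg _) (by positivity)

end IsSymbol

/-! ### The differential equation of projective space -/

/-- The function `exp (ε (f - f c) / ħ)`, which is `exp (- ε ‖y‖ ^ 2)` on a thimble. -/
noncomputable def regularizer {k : ℕ} (f : (Fin k → ℂ) → ℂ) (ħ : ℂ) (c : Fin k → ℂ) (ε : ℝ)
    (s : Fin k → ℂ) : ℂ := Complex.exp (ε / ħ * (f s - f c))

/-- The monomial `∏_{i ∈ A} u_i`. -/
noncomputable def expMonomial {k : ℕ} (A : List (Fin k)) (s : Fin k → ℂ) : ℂ :=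
  (A.map fun i => Complex.exp (s i)).prod

section

variable {k : ℕ}

theorem expMonomial_cons (i : Fin k) (A : List (Fin k)) (s : Fin k → ℂ) :
    expMonomial (i :: A) s = Complex.exp (s i) * expMonomial A s := by
  simp [expMonomial]

theorem contDiff_expMonomial (A : List (Fin k)) :
    ContDiff ℂ ((⊤ : ℕ∞) : WithTop ℕ∞) (expMonomial A) := by
  induction A with
  | nil => exact contDiff_const
  | cons i A ih =>
    have : expMonomial (i :: A) = fun s => Complex.exp (s i) * expMonomial A s :=
      funext (expMonomial_cons i A)
    rw [this]
    exact ContDiff.mul (by fun_prop) ih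

theorem partialDeriv_expMonomial (A : List (Fin k)) {i : Fin k} (hi : i ∉ A) (s : Fin k → ℂ) :
    partialDeriv (expMonomial A) i s = 0 := by
  induction A with
  | nil => exact partialDeriv_const 1 i s
  | cons j A ih =>
    rw [List.mem_cons, not_or] at hi
    have : expMonomial (j :: A) = fun s => Complex.exp (s j) * expMonomial A s :=
      funext (expMonomial_cons j A)
    rw [this, partialDeriv_mul (by fun_prop) ((contDiff_expMonomial A).differentiable (by simp) s),
      ih hi.2, partialDeriv_exp (by fun_prop), partialDeriv_coord, if_neg (Ne.symm hi.1)]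
    simp

theorem norm_expMonomial_le (A : List (Fin k)) {s : Fin k → ℂ} {B : ℝ}
    (hB : ∀ i, ‖Complex.exp (s i)‖ ≤ B) : ‖expMonomial A s‖ ≤ B ^ A.length := by
  induction A with
  | nil => simp [expMonomial]
  | cons j A ih =>
    rw [expMonomial_cons, norm_mul, List.length_cons, pow_succ']
    exact mul_le_mul (hB j) ih (norm_nonneg _) ((norm_nonneg _).trans (hB j))

theorem expMonomial_finRange (s : Fin k → ℂ) :
    expMonomial (List.finRange k) s = Complex.exp (∑ i, s i) := by
  rw [expMonomial, Complex.exp_sum, ← List.ofFn_eq_map, List.prod_ofFn]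

theorem contDiff_regularizer {f : (Fin k → ℂ) → ℂ} (hf : ContDiff ℂ ((⊤ : ℕ∞) : WithTop ℕ∞) f)
    (ħ : ℂ) (c : Fin k → ℂ) (ε : ℝ) :
    ContDiff ℂ ((⊤ : ℕ∞) : WithTop ℕ∞) (regularizer f ħ c ε) := by
  unfold regularizer
  fun_prop

theorem partialDeriv_regularizer {f : (Fin k → ℂ) → ℂ} {s : Fin k → ℂ}
    (hf : DifferentiableAt ℂ f s) (ħ : ℂ) (c : Fin k → ℂ) (ε : ℝ) (i : Fin k) :
    partialDeriv (regularizer f ħ c ε) i s =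
      ε / ħ * partialDeriv f i s * regularizer f ħ c ε s := by
  have h1 : DifferentiableAt ℂ (fun s => f s - f c) s := hf.sub_const _
  have h2 : partialDeriv (fun s => f s - f c) i s = partialDeriv f i s := by
    rw [HasFDerivAt.partialDeriv_eq (hf.hasFDerivAt.sub_const (f c))]
    rfl
  have h3 : partialDeriv (regularizer f ħ c ε) i s = _ :=
    partialDeriv_exp (h1.const_mul (ε / ħ : ℂ)) i
  rw [h3, partialDeriv_const_mul h1, h2]
  rfl

theorem IsLefschetzThimble.regularizer_eq {f : (Fin k → ℂ) → ℂ} {ħ : ℂ} (hħ : ħ ≠ 0)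
    {c : Fin k → ℂ} {γ : EuclideanSpace ℝ (Fin k) → (Fin k → ℂ)}
    (hγ : IsLefschetzThimble f ħ c γ) (ε : ℝ) (y : EuclideanSpace ℝ (Fin k)) :
    regularizer f ħ c ε (γ y) = (Real.exp (-(ε * ‖y‖ ^ 2)) : ℂ) := by
  rw [regularizer, hγ.level]
  push_cast
  congr 1
  field_simp
  ring

theorem pow_mul_exp_neg_le (n : ℕ) {x : ℝ} (hx : 0 ≤ x) :
    (1 + x) ^ n * Real.exp (-x) ≤ n.factorial * Real.exp 1 := by
  have h1 := Real.pow_div_factorial_le_exp (x := 1 + x) (by linarith) n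
  rw [div_le_iff₀ (by positivity), Real.exp_add] at h1
  have h2 : Real.exp x * Real.exp (-x) = 1 := by rw [← Real.exp_add]; simp
  calc (1 + x) ^ n * Real.exp (-x) ≤ Real.exp 1 * Real.exp x * n.factorial * Real.exp (-x) :=
        mul_le_mul_of_nonneg_right h1 (Real.exp_pos _).le
    _ = n.factorial * Real.exp 1 * (Real.exp x * Real.exp (-x)) := by ring
    _ = _ := by rw [h2, mul_one]

variable {w : Fin (k + 1) → ℂ} {ħ t₀ : ℂ} {c : Fin k → ℂ}
  {γ : EuclideanSpace ℝ (Fin k) → (Fin k → ℂ)} {Q : ℝ → (Fin k → ℂ) → ℂ} {κ : ℂ}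

/-- Differentiating the regularizer produces `ε ∂f/∂s_i / ħ`, where `ε ∂f/∂s_i = ε u_i + ε (w_i -
w_0) - ε x_0/(u_1⋯u_k)` is a symbol with limit `0`. So the error in each integration by parts is
again of the same type, with vanishing limit. -/
theorem IsSymbol.exists_partialDeriv_regularizer_mul (hQ : IsSymbol t₀ Q κ) (w : Fin (k + 1) → ℂ)
    (ħ : ℂ) (c : Fin k → ℂ) (i : Fin k) :
    ∃ Q', IsSymbol t₀ Q' 0 ∧ ∀ ε s,
      partialDeriv (fun s => regularizer (cpPotential w t₀) ħ c ε s * Q ε s) i s =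
        regularizer (cpPotential w t₀) ħ c ε s * Q' ε s := by
  obtain ⟨R, hR, hRe⟩ := hQ.exists_partialDeriv i
  have h1 := ((IsSymbol.const (k := k) (t₀ := t₀) ħ⁻¹).mul ((((IsSymbol.exp i).add
    ((IsSymbol.const (w i.succ - w 0)).mul IsSymbol.eps)).add
    ((IsSymbol.const (-1)).mul IsSymbol.quot)))).mul hQ
  refine ⟨_, (hR.add h1).of_eq (fun _ _ => rfl) (by simp), fun ε s => ?_⟩
  have hf := contDiff_cpPotential w t₀
  rw [partialDeriv_mul ((contDiff_regularizer hf ħ c ε).differentiable (by simp) s)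
    (hQ.differentiable ε s), hRe, partialDeriv_regularizer (hf.differentiable (by simp) s),
    partialDeriv_cpPotential]
  ring

/-- In the variable `X = ε (1 + ‖y‖²)` the symbol is polynomially bounded and the regularizer is at
most `e · e^{-X}`, as `ε ≤ 1`. The bound is uniform in `ε`, which the passage to the limit requires.
-/
theorem IsSymbol.exists_pow_mul_norm_le (hħ : ħ ≠ 0)
    (hγ : IsLefschetzThimble (cpPotential w t₀) ħ c γ) (hQ : IsSymbol t₀ Q κ) (m : ℕ) :
    ∃ B : ℝ, ∀ ε : ℝ, 0 < ε → ε ≤ 1 → ∀ y, (ε * (1 + ‖y‖ ^ 2)) ^ m *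
      ‖regularizer (cpPotential w t₀) ħ c ε (γ y) * Q ε (γ y)‖ ≤ B := by
  obtain ⟨C, hC1, hC⟩ := hγ.exists_norm_exp_le hħ
  obtain ⟨A, hA, d, hle⟩ := hQ.exists_norm_le hC1 hC
  refine ⟨A * (Real.exp 1 * ((m + d).factorial * Real.exp 1)), fun ε hε hε1 y => ?_⟩
  set x := ε * (1 + ‖y‖ ^ 2) with hx
  have hx0 : 0 ≤ x := by positivity
  rw [norm_mul, hγ.regularizer_eq hħ, Complex.norm_real, Real.norm_of_nonneg (Real.exp_pos _).le]
  have h1 : Real.exp (-(ε * ‖y‖ ^ 2)) ≤ Real.exp 1 * Real.exp (-x) := by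
    rw [← Real.exp_add, Real.exp_le_exp]
    nlinarith
  have h2 : x ^ m ≤ (1 + x) ^ m := pow_le_pow_left₀ hx0 (by linarith) m
  calc x ^ m * (Real.exp (-(ε * ‖y‖ ^ 2)) * ‖Q ε (γ y)‖)
      ≤ (1 + x) ^ m * (Real.exp 1 * Real.exp (-x) * (A * (1 + x) ^ d)) :=
        mul_le_mul h2 (mul_le_mul h1 (hle ε hε y) (norm_nonneg _) (by positivity))
          (by positivity) (by positivity)
    _ = A * (Real.exp 1 * ((1 + x) ^ (m + d) * Real.exp (-x))) := by ring
    _ ≤ _ := by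
        have := pow_mul_exp_neg_le (m + d) hx0
        gcongr

/-- The regularized weight `u_A exp (ε (f - f c) / ħ) Q`. -/
noncomputable def regWeight (w : Fin (k + 1) → ℂ) (ħ t₀ : ℂ) (c : Fin k → ℂ) (A : List (Fin k))
    (Q : ℝ → (Fin k → ℂ) → ℂ) (ε : ℝ) (s : Fin k → ℂ) : ℂ :=
  expMonomial A s * (regularizer (cpPotential w t₀) ħ c ε s * Q ε s)

theorem contDiff_regWeight (hQ : IsSymbol t₀ Q κ) (A : List (Fin k)) (ε : ℝ) :
    ContDiff ℂ ((⊤ : ℕ∞) : WithTop ℕ∞) (regWeight w ħ t₀ c A Q ε) :=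
  (contDiff_expMonomial A).mul
    ((contDiff_regularizer (contDiff_cpPotential w t₀) ħ c ε).mul (hQ.contDiff ε))

/-- Each `u_i` costs one factor `1 + ‖y‖²`, and one more is spent on the weight needed for Stokes'
theorem. Trading them for powers of `ε⁻¹` makes `B` depend on `ε`, which is harmless since `ε` is
fixed during the integration by parts. -/
theorem exists_norm_regWeight_le (hħ : ħ ≠ 0) (hγ : IsLefschetzThimble (cpPotential w t₀) ħ c γ)
    (hQ : IsSymbol t₀ Q κ) (A : List (Fin k)) {ε : ℝ} (hε : 0 < ε) (hε1 : ε ≤ 1) :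
    ∃ B : ℝ, ∀ y, (1 + ‖y‖ ^ 2) * ‖regWeight w ħ t₀ c A Q ε (γ y)‖ ≤ B := by
  obtain ⟨C, hC1, hC⟩ := hγ.exists_norm_exp_le hħ
  obtain ⟨B, hB⟩ := hQ.exists_pow_mul_norm_le hħ hγ (A.length + 1)
  refine ⟨C ^ A.length * (ε ^ (A.length + 1))⁻¹ * B, fun y => ?_⟩
  have h1 := norm_expMonomial_le A (hC y).1
  rw [regWeight, norm_mul]
  calc (1 + ‖y‖ ^ 2) * (‖expMonomial A (γ y)‖ *
        ‖regularizer (cpPotential w t₀) ħ c ε (γ y) * Q ε (γ y)‖)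
      ≤ (1 + ‖y‖ ^ 2) * ((C * (1 + ‖y‖ ^ 2)) ^ A.length *
        ‖regularizer (cpPotential w t₀) ħ c ε (γ y) * Q ε (γ y)‖) := by gcongr
    _ = C ^ A.length * (ε ^ (A.length + 1))⁻¹ * ((ε * (1 + ‖y‖ ^ 2)) ^ (A.length + 1) *
        ‖regularizer (cpPotential w t₀) ħ c ε (γ y) * Q ε (γ y)‖) := by
        rw [mul_pow, mul_pow, pow_succ (1 + ‖y‖ ^ 2)]
        have : ε ^ (A.length + 1) ≠ 0 := by positivity
        field_simp
    _ ≤ _ := mul_le_mul_of_nonneg_left (hB ε hε hε1 y) (by positivity)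

theorem exists_norm_regWeight_le' (hħ : ħ ≠ 0) (hγ : IsLefschetzThimble (cpPotential w t₀) ħ c γ)
    (hQ : IsSymbol t₀ Q κ) (A : List (Fin k)) {ε : ℝ} (hε : 0 < ε) (hε1 : ε ≤ 1) :
    ∃ B : ℝ, ∀ y, ‖regWeight w ħ t₀ c A Q ε (γ y)‖ ≤ B := by
  obtain ⟨B, hB⟩ := exists_norm_regWeight_le hħ hγ hQ A hε hε1
  refine ⟨B, fun y => le_trans ?_ (hB y)⟩
  exact le_mul_of_one_le_left (norm_nonneg _) (by nlinarith [sq_nonneg ‖y‖])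

variable {U : Set ℂ}

theorem locDominated_regWeight (hħ : ħ ≠ 0) (hγ : IsLefschetzThimble (cpPotential w t₀) ħ c γ)
    (hU : IsOpen U) (hint : ∀ t ∈ U, Integrable (cpIntegrand w ħ γ t))
    (hQ : IsSymbol t₀ Q κ) (A : List (Fin k)) {ε : ℝ} (hε : 0 < ε) (hε1 : ε ≤ 1) :
    LocDominated volume U fun t y => regWeight w ħ t₀ c A Q ε (γ y) * cpIntegrand w ħ γ t y := by
  obtain ⟨B, hB⟩ := exists_norm_regWeight_le' hħ hγ hQ A hε hε1
  exact (locDominated_cpIntegrand hγ.smooth hU hint).bdd_mul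
    ((contDiff_regWeight hQ A ε).continuous.comp hγ.smooth.continuous).aestronglyMeasurable hB

theorem firstOrder_mul_cpIntegrand (hħ : ħ ≠ 0) (a b : ℂ) (t : ℂ)
    (y : EuclideanSpace ℝ (Fin k)) :
    firstOrder ħ (-b) (fun t => a * cpIntegrand w ħ γ t y) t =
      a * (Complex.exp (t - ∑ j, γ y j) + w 0 - b) * cpIntegrand w ħ γ t y := by
  rw [firstOrder, ((hasDerivAt_cpIntegrand w ħ γ t y).const_mul a).deriv]
  field_simp
  ring

/-- Integration by parts for the regularized integrals. -/
theorem integral_regWeight_cons (hħ : ħ ≠ 0) (hγ : IsLefschetzThimble (cpPotential w t₀) ħ c γ)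
    (hU : IsOpen U) (hint : ∀ t ∈ U, Integrable (cpIntegrand w ħ γ t))
    (hQ : IsSymbol t₀ Q κ) {A : List (Fin k)} {i : Fin k} (hi : i ∉ A)
    {Q' : ℝ → (Fin k → ℂ) → ℂ} (hQ' : IsSymbol t₀ Q' 0)
    (hpart : ∀ ε s, partialDeriv (fun s => regularizer (cpPotential w t₀) ħ c ε s * Q ε s) i s =
        regularizer (cpPotential w t₀) ħ c ε s * Q' ε s)
    {ε : ℝ} (hε : 0 < ε) (hε1 : ε ≤ 1) {t : ℂ} (ht : t ∈ U) :
    ∫ y, regWeight w ħ t₀ c (i :: A) Q ε (γ y) * cpIntegrand w ħ γ t y =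
      firstOrder ħ (-w i.succ)
        (fun t => ∫ y, regWeight w ħ t₀ c A Q ε (γ y) * cpIntegrand w ħ γ t y) t -
      ħ * ∫ y, regWeight w ħ t₀ c A Q' ε (γ y) * cpIntegrand w ħ γ t y := by
  have hdom := locDominated_regWeight hħ hγ hU hint hQ A hε hε1
  have hdom' := locDominated_regWeight hħ hγ hU hint hQ' A hε hε1
  have hdomc := locDominated_regWeight hħ hγ hU hint hQ (i :: A) hε hε1
  set Φ : (Fin k → ℂ) → ℂ := fun s =>
    regWeight w ħ t₀ c A Q ε s * Complex.exp (cpPotential w t s / ħ) with hΦ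
  have hΦs : ContDiff ℂ ((⊤ : ℕ∞) : WithTop ℕ∞) Φ :=
    (contDiff_regWeight hQ A ε).mul ((contDiff_cpPotential w t).div_const ħ).cexp
  have hmon := (contDiff_expMonomial A).differentiable (by simp)
  have hreg := ((contDiff_regularizer (contDiff_cpPotential w t₀) ħ c ε).mul
    (hQ.contDiff ε)).differentiable (by simp)
  have hpot := (contDiff_cpPotential w t).differentiable (by simp)
  -- The hypothesis `i ∉ A` makes `u_A` constant in the direction `i`. The middle term is what `ŷ -
  -- w_i` produces under the integral, so the vanishing of the left side after integration is the
  -- asserted recursion.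
  have hder : ∀ s, ħ * partialDeriv Φ i s = (regWeight w ħ t₀ c (i :: A) Q ε s -
      regWeight w ħ t₀ c A Q ε s * (Complex.exp (t - ∑ j, s j) + w 0 - w i.succ) +
      ħ * regWeight w ħ t₀ c A Q' ε s) * Complex.exp (cpPotential w t s / ħ) := by
    intro s
    have hp : DifferentiableAt ℂ (fun s => cpPotential w t s / ħ) s := by
      simpa only [div_eq_mul_inv] using (hpot s).mul_const ħ⁻¹
    have e1 : partialDeriv (fun s => cpPotential w t s / ħ) i s =
        (Complex.exp (s i) + w i.succ - Complex.exp (t - ∑ j, s j) - w 0) / ħ := by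
      have : (fun s => cpPotential w t s / ħ) = fun s => ħ⁻¹ * cpPotential w t s := by
        funext s
        rw [div_eq_inv_mul]
      rw [this, partialDeriv_const_mul (hpot s), partialDeriv_cpPotential, div_eq_inv_mul]
    have e2 : partialDeriv (regWeight w ħ t₀ c A Q ε) i s = regWeight w ħ t₀ c A Q' ε s := by
      have : regWeight w ħ t₀ c A Q ε = fun s => expMonomial A s *
          (regularizer (cpPotential w t₀) ħ c ε s * Q ε s) := rfl
      rw [this, partialDeriv_mul (hmon s) (hreg s), hpart, partialDeriv_expMonomial A hi, zero_mul,
        add_zero]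
      rfl
    rw [hΦ, partialDeriv_mul ((contDiff_regWeight hQ A ε).differentiable (by simp) s) hp.cexp, e2,
      partialDeriv_exp hp, e1]
    simp only [regWeight, expMonomial_cons]
    field_simp
    ring
  have hfo := hdom.firstOrder_integral hU ħ (-w i.succ) ht
  have hfoi := (hdom.firstOrder hU ħ (-w i.succ)).integrable ht
  have hpt : ∀ y, ħ * (partialDeriv Φ i (γ y) * formDensity γ y) =
      regWeight w ħ t₀ c (i :: A) Q ε (γ y) * cpIntegrand w ħ γ t y -
      firstOrder ħ (-w i.succ) (fun t => regWeight w ħ t₀ c A Q ε (γ y) * cpIntegrand w ħ γ t y) t +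
      ħ * (regWeight w ħ t₀ c A Q' ε (γ y) * cpIntegrand w ħ γ t y) := by
    intro y
    rw [← mul_assoc, hder, firstOrder_mul_cpIntegrand hħ]
    simp only [cpIntegrand]
    ring
  have hsub : Integrable fun y => regWeight w ħ t₀ c (i :: A) Q ε (γ y) * cpIntegrand w ħ γ t y -
      firstOrder ħ (-w i.succ) (fun t => regWeight w ħ t₀ c A Q ε (γ y) * cpIntegrand w ħ γ t y) t :=
    (hdomc.integrable ht).sub hfoi
  have hzero : ∫ y, partialDeriv Φ i (γ y) * formDensity γ y = 0 := by
    obtain ⟨C, hC1, hC⟩ := hγ.exists_norm_exp_le hħ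
    obtain ⟨B, hB⟩ := exists_norm_regWeight_le hħ hγ hQ A hε hε1
    refine hγ.integral_partialDeriv_eq_zero hħ (contDiff_cpPotential w t₀) hΦs i
      (C := 2 * C + ‖w i.succ‖ + ‖w 0‖) (fun y => ?_) ?_ ?_
    · rw [partialDeriv_cpPotential]
      have h1 := norm_sub_le (Complex.exp (γ y i) + w i.succ - Complex.exp (t₀ - ∑ j, γ y j)) (w 0)
      have h2 := norm_sub_le (Complex.exp (γ y i) + w i.succ) (Complex.exp (t₀ - ∑ j, γ y j))
      have h3 := norm_add_le (Complex.exp (γ y i)) (w i.succ)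
      have h4 := (hC y).1 i
      have h5 := (hC y).2
      nlinarith [mul_nonneg (norm_nonneg (w i.succ)) (sq_nonneg ‖y‖),
        mul_nonneg (norm_nonneg (w 0)) (sq_nonneg ‖y‖)]
    · have h1 : Integrable fun y => B * ‖cpIntegrand w ħ γ t y‖ := (hint t ht).norm.const_mul B
      refine h1.mono' ?_ (Eventually.of_forall fun y => ?_)
      · refine Continuous.aestronglyMeasurable ?_
        have h2 := (hΦs.continuous.comp hγ.smooth.continuous).mul
          (formDensity_continuous hγ.smooth)
        have h3 : Continuous fun y : EuclideanSpace ℝ (Fin k) => 1 + ‖y‖ ^ 2 := by fun_prop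
        exact h3.mul h2.norm
      · have e : Φ (γ y) * formDensity γ y =
            regWeight w ħ t₀ c A Q ε (γ y) * cpIntegrand w ħ γ t y := by
          simp only [hΦ, cpIntegrand]
          ring
        rw [e, norm_mul, norm_norm, norm_mul, ← mul_assoc, Real.norm_of_nonneg (by positivity)]
        exact mul_le_mul_of_nonneg_right (hB y) (norm_nonneg _)
    · have : (fun y => partialDeriv Φ i (γ y) * formDensity γ y) =
          fun y => ħ⁻¹ * (ħ * (partialDeriv Φ i (γ y) * formDensity γ y)) := by
        funext y
        rw [inv_mul_cancel_left₀ hħ]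
      rw [this]
      simp only [hpt]
      exact (hsub.add ((hdom'.integrable ht).const_mul ħ)).const_mul ħ⁻¹
  have h0 : ∫ y, ħ * (partialDeriv Φ i (γ y) * formDensity γ y) = 0 := by
    rw [integral_const_mul, hzero, mul_zero]
  simp only [hpt] at h0
  rw [integral_add hsub ((hdom'.integrable ht).const_mul ħ),
    integral_sub (hdomc.integrable ht) hfoi, integral_const_mul] at h0
  rw [hfo]
  linear_combination h0

/-- By Weierstrass' theorem, locally uniform limits of holomorphic functions can be differentiated.
The limits of integrals with `u_A` inserted are therefore obtained by applying operators, although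
these integrals need not converge at `ε = 0`. -/
theorem tendstoLocallyUniformlyOn_firstOrder {φ : Filter ℕ} [φ.NeBot] {F : ℕ → ℂ → ℂ} {G : ℂ → ℂ}
    (h : TendstoLocallyUniformlyOn F G φ U) (hU : IsOpen U)
    (hF : ∀ n, DifferentiableOn ℂ (F n) U) (a b : ℂ) :
    TendstoLocallyUniformlyOn (fun n => firstOrder a b (F n)) (firstOrder a b G) φ U := by
  have h1 := h.deriv (Eventually.of_forall hF) hU
  exact ((ContinuousLinearMap.mul ℂ ℂ a).uniformContinuous.comp_tendstoLocallyUniformlyOn h1).add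
    ((ContinuousLinearMap.mul ℂ ℂ b).uniformContinuous.comp_tendstoLocallyUniformlyOn h)

/-- The regularized integrals of `u_A` converge to the image of the integral under the operators
`ŷ - w_i`, `i ∈ A`. -/
theorem tendstoLocallyUniformlyOn_regWeight (hħ : ħ ≠ 0)
    (hγ : IsLefschetzThimble (cpPotential w t₀) ħ c γ) (hU : IsOpen U)
    (hint : ∀ t ∈ U, Integrable (cpIntegrand w ħ γ t)) {A : List (Fin k)} (hA : A.Nodup)
    (hQ : IsSymbol t₀ Q κ) :
    TendstoLocallyUniformlyOn
      (fun (n : ℕ) t => ∫ y, regWeight w ħ t₀ c A Q (1 / (n + 1)) (γ y) * cpIntegrand w ħ γ t y)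
      (fun t => κ * firstOrderProd (A.map fun i => (ħ, -w i.succ)) (cpIntegral w ħ γ) t)
      atTop U := by
  have hpos : ∀ n : ℕ, (0 : ℝ) < 1 / (n + 1) := fun n => by positivity
  have hle : ∀ n : ℕ, (1 : ℝ) / (n + 1) ≤ 1 := fun n => by
    rw [div_le_one (by positivity)]
    linarith [Nat.cast_nonneg (α := ℝ) n]
  induction A generalizing Q κ with
  | nil =>
    -- Dominated convergence is used only for the empty monomial, where the multiplier is bounded
    -- uniformly in `ε`.
    obtain ⟨B, hB⟩ := hQ.exists_pow_mul_norm_le hħ hγ 0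
    refine (locDominated_cpIntegrand hγ.smooth hU hint).tendstoLocallyUniformlyOn (C := B)
      (Eventually.of_forall fun n =>
        ((contDiff_regWeight hQ [] _).continuous.comp hγ.smooth.continuous).aestronglyMeasurable)
      (Eventually.of_forall fun n y => ?_) fun y => ?_
    · simpa [regWeight, expMonomial] using hB _ (hpos n) (hle n) y
    · have h0 : Tendsto (fun ε : ℝ => regWeight w ħ t₀ c [] Q ε (γ y)) (𝓝 0) (𝓝 κ) := by
        have h1 : Tendsto (fun ε : ℝ => regularizer (cpPotential w t₀) ħ c ε (γ y)) (𝓝 0)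
            (𝓝 1) := by
          have h2 : Continuous fun ε : ℝ => regularizer (cpPotential w t₀) ħ c ε (γ y) := by
            unfold regularizer
            fun_prop
          simpa [regularizer] using h2.tendsto 0
        simpa [regWeight, expMonomial] using h1.mul (hQ.tendsto (γ y))
      exact h0.comp tendsto_one_div_add_atTop_nhds_zero_nat
  | cons i A ih =>
    rw [List.nodup_cons] at hA
    obtain ⟨Q', hQ', hpart⟩ := hQ.exists_partialDeriv_regularizer_mul w ħ c i
    have h1 := tendstoLocallyUniformlyOn_firstOrder (ih hA.2 hQ) hU (fun n =>
      (locDominated_regWeight hħ hγ hU hint hQ A (hpos n) (hle n)).differentiableOn_integral hU)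
      ħ (-w i.succ)
    -- The induction hypothesis is applied a second time, to the error symbol; its limit value `0`
    -- makes the correction disappear.
    have h2 := (ContinuousLinearMap.mul ℂ ℂ ħ).uniformContinuous.comp_tendstoLocallyUniformlyOn
      (ih hA.2 hQ')
    refine ((h1.sub h2).congr fun n t ht => ?_).congr_right fun t ht => ?_
    · exact (integral_regWeight_cons hħ hγ hU hint hQ hA.1 hQ' hpart (hpos n) (hle n) ht).symm
    · simp only [Pi.sub_apply, Function.comp_apply, ContinuousLinearMap.mul_apply', zero_mul,
        mul_zero, sub_zero, List.map_cons, firstOrderProd, firstOrder, deriv_const_mul_field]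
      ring

/-- The integral of projective space is holomorphic wherever it converges and satisfies the GKZ
equation. -/
theorem cpGKZ_cpIntegral (hħ : ħ ≠ 0) (hγ : IsLefschetzThimble (cpPotential w t₀) ħ c γ)
    (hU : IsOpen U) (hint : ∀ t ∈ U, Integrable (cpIntegrand w ħ γ t)) :
    DifferentiableOn ℂ (cpIntegral w ħ γ) U ∧
      ∀ t ∈ U, cpGKZ w ħ (cpIntegral w ħ γ) t = 0 := by
  refine ⟨(locDominated_cpIntegrand hγ.smooth hU hint).differentiableOn_integral hU,
    fun t ht => ?_⟩
  have hpos : ∀ n : ℕ, (0 : ℝ) < 1 / (n + 1) := fun n => by positivity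
  have hle : ∀ n : ℕ, (1 : ℝ) / (n + 1) ≤ 1 := fun n => by
    rw [div_le_one (by positivity)]
    linarith [Nat.cast_nonneg (α := ℝ) n]
  have hQ : IsSymbol (k := k) t₀ (fun _ _ => 1) 1 := IsSymbol.const 1
  have hdom := fun (A : List (Fin k)) (n : ℕ) =>
    locDominated_regWeight hħ hγ hU hint hQ A (hpos n) (hle n)
  have h1 := (tendstoLocallyUniformlyOn_firstOrder
    (tendstoLocallyUniformlyOn_regWeight hħ hγ hU hint (List.nodup_finRange k) hQ) hU
    (fun n => (hdom _ n).differentiableOn_integral hU) ħ (-w 0)).tendsto_at ht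
  have h2 := ((tendstoLocallyUniformlyOn_regWeight hħ hγ hU hint List.nodup_nil hQ).tendsto_at
    ht).const_mul (Complex.exp t)
  -- No integration by parts here: `ŷ - w_0` inserts `x/(u_1⋯u_k)`, which cancels the full monomial
  -- and leaves `x`.
  have h3 : ∀ n : ℕ, firstOrder ħ (-w 0) (fun t => ∫ y, regWeight w ħ t₀ c (List.finRange k)
      (fun _ _ => 1) (1 / (n + 1)) (γ y) * cpIntegrand w ħ γ t y) t =
      Complex.exp t * ∫ y, regWeight w ħ t₀ c [] (fun _ _ => 1) (1 / (n + 1)) (γ y) *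
        cpIntegrand w ħ γ t y := by
    intro n
    rw [(hdom _ n).firstOrder_integral hU _ _ ht, ← integral_const_mul]
    refine integral_congr_ae (Eventually.of_forall fun y => ?_)
    simp only [firstOrder_mul_cpIntegrand hħ]
    rw [regWeight, expMonomial_finRange, regWeight, add_sub_cancel_right]
    have : Complex.exp t = Complex.exp (∑ j, γ y j) * Complex.exp (t - ∑ j, γ y j) := by
      rw [← Complex.exp_add]
      simp
    rw [this]
    simp only [expMonomial, List.map_nil, List.prod_nil]
    ring
  simp only [h3] at h1
  have h4 := tendsto_nhds_unique h1 h2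
  simp only [one_mul, List.map_nil, firstOrderProd] at h4
  rw [cpGKZ, wProd_eq_firstOrderProd, List.finRange_succ, List.map_cons, List.map_map, xHat,
    sub_eq_zero]
  exact h4

end

/-! ### Interior estimates for first-order systems from integrals over real segments -/

/-- The integrals of `σ ^ m q(σ) Z(t + σ)` over `[0, 1]`, for smooth `q` vanishing near `1`, are
bounded by multiples of `B t`. -/
def WeakBound (D : Set ℂ) (B : ℂ → ℝ) (m : ℕ) (Z : ℂ → ℂ) : Prop :=
  ∀ q : ℝ → ℂ, ContDiff ℝ ((⊤ : ℕ∞) : WithTop ℕ∞) q → q =ᶠ[𝓝 1] 0 →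
    ∃ C : ℝ, ∀ t ∈ D, ‖∫ σ in (0 : ℝ)..1, ((σ : ℂ) ^ m * q σ) * Z (t + σ)‖ ≤ C * B t

section WeakBound

variable {D : Set ℂ} {B : ℂ → ℝ} {m : ℕ} {Z : ℂ → ℂ}

theorem hasDerivAt_comp_add_ofReal (hD : IsOpen D) (hZ : DifferentiableOn ℂ Z D) {t : ℂ} {σ : ℝ}
    (h : t + σ ∈ D) : HasDerivAt (fun σ : ℝ => Z (t + σ)) (deriv Z (t + σ)) σ := by
  have h1 : HasDerivAt (fun σ : ℝ => t + (σ : ℂ)) 1 σ := Complex.ofRealCLM.hasDerivAt.const_add t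
  have h2 := (hZ.differentiableAt (hD.mem_nhds h)).hasDerivAt.comp_of_eq σ h1 rfl
  exact h2.congr_deriv (mul_one _)

theorem continuous_comp_add_ofReal (hDr : ∀ t ∈ D, ∀ σ : ℝ, t + (σ : ℂ) ∈ D)
    (hZ : ContinuousOn Z D) {t : ℂ} (ht : t ∈ D) : Continuous fun σ : ℝ => Z (t + σ) :=
  hZ.comp_continuous (by fun_prop) (hDr t ht)

/-- Along a horizontal segment `d/dt` is `d/dσ`. The boundary term at `0` is kept because it
recovers the point value `Z t`; it drops out when the test function vanishes there. -/
theorem integral_mul_firstOrder (hD : IsOpen D) (hDr : ∀ t ∈ D, ∀ σ : ℝ, t + (σ : ℂ) ∈ D)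
    (hZ : DifferentiableOn ℂ Z D) (a b : ℂ) {φ φ' : ℝ → ℂ} (hφ : ∀ σ, HasDerivAt φ (φ' σ) σ)
    (hφ' : Continuous φ') (h1 : φ 1 = 0) {t : ℂ} (ht : t ∈ D) :
    ∫ σ in (0 : ℝ)..1, φ σ * firstOrder a b Z (t + σ) =
      -(a * φ 0 * Z t) + ∫ σ in (0 : ℝ)..1, (-a * φ' σ + b * φ σ) * Z (t + σ) := by
  have hφc : Continuous φ := continuous_iff_continuousAt.mpr fun σ => (hφ σ).continuousAt
  have hZc := continuous_comp_add_ofReal hDr hZ.continuousOn ht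
  have hZ'c := continuous_comp_add_ofReal hDr (hZ.deriv hD).continuousOn ht
  have hparts := intervalIntegral.integral_mul_deriv_eq_deriv_mul (a := 0) (b := 1)
    (fun σ _ => hφ σ) (fun σ _ => hasDerivAt_comp_add_ofReal hD hZ (hDr t ht σ))
    (hφ'.intervalIntegrable _ _) (hZ'c.intervalIntegrable _ _)
  rw [h1] at hparts
  simp only [Complex.ofReal_zero, add_zero, zero_mul, zero_sub] at hparts
  have e1 : ∀ σ : ℝ, φ σ * firstOrder a b Z (t + σ) =
      a * (φ σ * deriv Z (t + σ)) + b * (φ σ * Z (t + σ)) := fun σ => by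
    simp only [firstOrder]; ring
  have e2 : ∀ σ : ℝ, (-a * φ' σ + b * φ σ) * Z (t + σ) =
      -a * (φ' σ * Z (t + σ)) + b * (φ σ * Z (t + σ)) := fun σ => by ring
  simp only [e1, e2]
  have c1 : Continuous fun σ : ℝ => a * (φ σ * deriv Z (t + σ)) :=
    continuous_const.mul (hφc.mul hZ'c)
  have c2 : Continuous fun σ : ℝ => b * (φ σ * Z (t + σ)) := continuous_const.mul (hφc.mul hZc)
  have c3 : Continuous fun σ : ℝ => -a * (φ' σ * Z (t + σ)) :=
    continuous_const.mul (hφ'.mul hZc)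
  rw [intervalIntegral.integral_add (c1.intervalIntegrable _ _) (c2.intervalIntegrable _ _),
    intervalIntegral.integral_add (c3.intervalIntegrable _ _) (c2.intervalIntegrable _ _),
    intervalIntegral.integral_const_mul, intervalIntegral.integral_const_mul,
    intervalIntegral.integral_const_mul, hparts]
  ring

theorem WeakBound.succ (h : WeakBound D B m Z) : WeakBound D B (m + 1) Z := by
  intro q hq hq1
  obtain ⟨C, hC⟩ := h (fun σ => σ * q σ) (Complex.ofRealCLM.contDiff.mul hq)
    (hq1.mono fun σ hσ => by simp [hσ])
  refine ⟨C, fun t ht => le_of_eq_of_le ?_ (hC t ht)⟩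
  congr 2
  funext σ
  ring

theorem WeakBound.of_zero (h : WeakBound D B 0 Z) : ∀ m, WeakBound D B m Z
  | 0 => h
  | m + 1 => (of_zero h m).succ

theorem hasDerivAt_pow_succ_mul {q : ℝ → ℂ} (hq : ContDiff ℝ ((⊤ : ℕ∞) : WithTop ℕ∞) q) (m : ℕ)
    (σ : ℝ) : HasDerivAt (fun σ : ℝ => (σ : ℂ) ^ (m + 1) * q σ)
      ((σ : ℂ) ^ m * ((m + 1) * q σ + σ * deriv q σ)) σ := by
  have h1 : HasDerivAt (fun σ : ℝ => (σ : ℂ)) 1 σ := Complex.ofRealCLM.hasDerivAt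
  refine ((h1.fun_pow (m + 1)).fun_mul
    (hq.differentiable (by simp) σ).hasDerivAt).congr_deriv ?_
  push_cast
  ring

theorem contDiff_deriv_top {q : ℝ → ℂ} (hq : ContDiff ℝ ((⊤ : ℕ∞) : WithTop ℕ∞) q) :
    ContDiff ℝ ((⊤ : ℕ∞) : WithTop ℕ∞) (deriv q) := (contDiff_infty_iff_deriv.mp hq).2

/-- Integration by parts of a test function vanishing to order `m + 1` at `0`. -/
theorem integral_pow_succ_mul_firstOrder (hD : IsOpen D)
    (hDr : ∀ t ∈ D, ∀ σ : ℝ, t + (σ : ℂ) ∈ D) (hZ : DifferentiableOn ℂ Z D) (a b : ℂ) {q : ℝ → ℂ}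
    (hq : ContDiff ℝ ((⊤ : ℕ∞) : WithTop ℕ∞) q) (hq1 : q =ᶠ[𝓝 1] 0) (m : ℕ) {t : ℂ} (ht : t ∈ D) :
    ∫ σ in (0 : ℝ)..1, ((σ : ℂ) ^ (m + 1) * q σ) * firstOrder a b Z (t + σ) =
      ∫ σ in (0 : ℝ)..1, ((σ : ℂ) ^ m * (-a * ((m + 1) * q σ + σ * deriv q σ) + b * (σ * q σ))) *
        Z (t + σ) := by
  have hq' := contDiff_deriv_top hq
  have := integral_mul_firstOrder hD hDr hZ a b (hasDerivAt_pow_succ_mul hq m)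
    (by
      have := hq.continuous
      have := hq'.continuous
      fun_prop) (by simp [hq1.eq_of_nhds]) ht
  rw [this]
  simp only [Complex.ofReal_zero, zero_pow (Nat.succ_ne_zero m), zero_mul, mul_zero, neg_zero,
    zero_add]
  congr 1
  funext σ
  ring

/-- Moving the derivative onto the test function lowers its order of vanishing at `0` by one, so one
more order is required at the start. -/
theorem WeakBound.firstOrder (hD : IsOpen D) (hDr : ∀ t ∈ D, ∀ σ : ℝ, t + (σ : ℂ) ∈ D)
    (hZ : DifferentiableOn ℂ Z D) (h : WeakBound D B m Z) (a b : ℂ) :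
    WeakBound D B (m + 1) (firstOrder a b Z) := by
  intro q hq hq1
  have hq' := contDiff_deriv_top hq
  have hid : ContDiff ℝ ((⊤ : ℕ∞) : WithTop ℕ∞) fun σ : ℝ => (σ : ℂ) :=
    Complex.ofRealCLM.contDiff
  obtain ⟨C, hC⟩ := h (fun σ => -a * ((m + 1) * q σ + σ * deriv q σ) + b * (σ * q σ))
    ((contDiff_const.mul ((contDiff_const.mul hq).add (hid.mul hq'))).add
      (contDiff_const.mul (hid.mul hq))) (by
        filter_upwards [hq1, hq1.deriv] with σ h1 h2
        have h3 : deriv (0 : ℝ → ℂ) σ = 0 := by simp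
        simp [h1, h2, h3])
  refine ⟨C, fun t ht => le_of_eq_of_le ?_ (hC t ht)⟩
  rw [integral_pow_succ_mul_firstOrder hD hDr hZ a b hq hq1 m ht]

/-- The order is recovered by writing `σ^m q` as the leading part of `-a (σ^{m+1} p)'` with `p = -q
/ (a (m + 1))`. The rest vanishes to order `m + 1` and is covered by the two hypotheses. -/
theorem WeakBound.of_succ (hD : IsOpen D) (hDr : ∀ t ∈ D, ∀ σ : ℝ, t + (σ : ℂ) ∈ D)
    (hZ : DifferentiableOn ℂ Z D) {a b : ℂ} (ha : a ≠ 0) (h : WeakBound D B (m + 1) Z)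
    (h' : WeakBound D B (m + 1) (MirrorGKZ.firstOrder a b Z)) : WeakBound D B m Z := by
  intro q hq hq1
  set p : ℝ → ℂ := fun σ => -(a * (m + 1))⁻¹ * q σ with hp
  have hps : ContDiff ℝ ((⊤ : ℕ∞) : WithTop ℕ∞) p := contDiff_const.mul hq
  have hp1 : p =ᶠ[𝓝 1] 0 := hq1.mono fun σ hσ => by simp [hp, hσ]
  have hp' := contDiff_deriv_top hps
  obtain ⟨C, hC⟩ := h' p hps hp1
  obtain ⟨C', hC'⟩ := h (fun σ => -a * deriv p σ + b * p σ)
    ((contDiff_const.mul hp').add (contDiff_const.mul hps)) (by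
        filter_upwards [hp1, hp1.deriv] with σ h1 h2
        have h3 : deriv (0 : ℝ → ℂ) σ = 0 := by simp
        simp [h1, h2, h3])
  refine ⟨C + C', fun t ht => ?_⟩
  have hZc := continuous_comp_add_ofReal hDr hZ.continuousOn ht
  have hm : (a * (m + 1) : ℂ) ≠ 0 := mul_ne_zero ha (by exact_mod_cast Nat.succ_ne_zero m)
  have e := integral_pow_succ_mul_firstOrder hD hDr hZ a b hps hp1 m ht
  have e2 : ∀ σ : ℝ, ((σ : ℂ) ^ m * (-a * ((m + 1) * p σ + σ * deriv p σ) + b * (σ * p σ))) *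
      Z (t + σ) = ((σ : ℂ) ^ m * q σ) * Z (t + σ) +
        ((σ : ℂ) ^ (m + 1) * (-a * deriv p σ + b * p σ)) * Z (t + σ) := by
    intro σ
    have : -a * ((m + 1) * p σ) = q σ := by
      simp only [hp]
      field_simp
    rw [← this]
    ring
  simp only [e2] at e
  have c1 := hq.continuous
  have c2 := hps.continuous
  have c3 := hp'.continuous
  have c4 : Continuous fun σ : ℝ => (σ : ℂ) ^ m * q σ := by fun_prop
  have c5 : Continuous fun σ : ℝ => (σ : ℂ) ^ (m + 1) * (-a * deriv p σ + b * p σ) := by fun_prop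
  have c6 : Continuous fun σ : ℝ => ((σ : ℂ) ^ m * q σ) * Z (t + σ) := c4.mul hZc
  have c7 : Continuous fun σ : ℝ =>
    ((σ : ℂ) ^ (m + 1) * (-a * deriv p σ + b * p σ)) * Z (t + σ) := c5.mul hZc
  rw [intervalIntegral.integral_add (c6.intervalIntegrable _ _)
    (c7.intervalIntegrable _ _)] at e
  rw [eq_sub_of_add_eq e.symm, add_mul]
  exact (norm_sub_le _ _).trans (add_le_add (hC t ht) (hC' t ht))

/-- With a test function equal to `1` at `0` and to `0` near `1`, the boundary term of the
integration by parts is `a Z t`, and everything else is weakly bounded. -/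
theorem WeakBound.exists_norm_le (hD : IsOpen D) (hDr : ∀ t ∈ D, ∀ σ : ℝ, t + (σ : ℂ) ∈ D)
    (hZ : DifferentiableOn ℂ Z D) {a b : ℂ} (ha : a ≠ 0) (h : WeakBound D B 0 Z)
    (h' : WeakBound D B 0 (MirrorGKZ.firstOrder a b Z)) :
    ∃ C : ℝ, ∀ t ∈ D, ‖Z t‖ ≤ C * B t := by
  let χ : ContDiffBump (0 : ℝ) := ⟨1 / 4, 1 / 2, by norm_num, by norm_num⟩
  set q : ℝ → ℂ := fun σ => (χ σ : ℂ) with hq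
  have hqs : ContDiff ℝ ((⊤ : ℕ∞) : WithTop ℕ∞) q := Complex.ofRealCLM.contDiff.comp χ.contDiff
  have hq1 : q =ᶠ[𝓝 1] 0 := by
    filter_upwards [Ioi_mem_nhds (show (1 / 2 : ℝ) < 1 by norm_num)] with σ hσ
    have : χ σ = 0 := χ.zero_of_le_dist (by
      rw [dist_zero_right, Real.norm_eq_abs]
      exact (le_of_lt hσ).trans (le_abs_self σ))
    simp [hq, this]
  have hq0 : q 0 = 1 := by
    have : χ (0 : ℝ) = 1 := χ.one_of_mem_closedBall (mem_closedBall_self (by norm_num [χ]))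
    simp [hq, this]
  have hq' := contDiff_deriv_top hqs
  obtain ⟨C, hC⟩ := h' q hqs hq1
  obtain ⟨C', hC'⟩ := h (fun σ => -a * deriv q σ + b * q σ)
    ((contDiff_const.mul hq').add (contDiff_const.mul hqs)) (by
        filter_upwards [hq1, hq1.deriv] with σ h1 h2
        have h3 : deriv (0 : ℝ → ℂ) σ = 0 := by simp
        simp [h1, h2, h3])
  refine ⟨‖a‖⁻¹ * (C' + C), fun t ht => ?_⟩
  have e := integral_mul_firstOrder hD hDr hZ a b
    (fun σ => (hqs.differentiable (by simp) σ).hasDerivAt) hq'.continuous hq1.eq_of_nhds ht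
  rw [hq0, mul_one] at e
  have h1 := hC t ht
  have h2 := hC' t ht
  simp only [pow_zero, one_mul] at h1 h2
  have h3 : ‖a * Z t‖ ≤ (C' + C) * B t := by
    rw [add_mul]
    have : a * Z t = (∫ σ in (0 : ℝ)..1, (-a * deriv q σ + b * q σ) * Z (t + σ)) -
        ∫ σ in (0 : ℝ)..1, q σ * MirrorGKZ.firstOrder a b Z (t + σ) := by
      rw [e]; ring
    rw [this]
    exact (norm_sub_le _ _).trans (add_le_add h2 h1)
  rw [norm_mul] at h3
  rw [mul_assoc, ← div_eq_inv_mul, le_div_iff₀ (norm_pos_iff.mpr ha), mul_comm]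
  exact h3

/-- All intermediate functions `L' F` of a product of operators `L F` are bounded by `B`, if `F`
and `L F` are weakly bounded. -/
theorem WeakBound.exists_norm_firstOrderProd_le (hD : IsOpen D)
    (hDr : ∀ t ∈ D, ∀ σ : ℝ, t + (σ : ℂ) ∈ D) {F : ℂ → ℂ} (hF : DifferentiableOn ℂ F D)
    (hF0 : WeakBound D B 0 F) (L : List (ℂ × ℂ)) (hL : ∀ p ∈ L, p.1 ≠ 0)
    (h : WeakBound D B 0 (firstOrderProd L F)) {L' : List (ℂ × ℂ)} (hs : L' <:+ L)
    (hne : L'.length < L.length) : ∃ C : ℝ, ∀ t ∈ D, ‖firstOrderProd L' F t‖ ≤ C * B t := by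
  -- From the bottom of the chain, bounds hold at the price of one order of vanishing per operator.
  -- From the top, where the bound has order `0`, these orders are removed again one at a time.
  have hup : ∀ L : List (ℂ × ℂ), WeakBound D B L.length (firstOrderProd L F) := by
    intro L
    induction L with
    | nil => exact hF0
    | cons p L ih => exact ih.firstOrder hD hDr (firstOrderProd_differentiableOn hD L hF) p.1 p.2
  induction L with
  | nil => simp at hne
  | cons p L ih =>
    have hZ := firstOrderProd_differentiableOn hD L hF
    have hp : p.1 ≠ 0 := hL p (by simp)
    have hall := h.of_zero
    have hdown : ∀ m, WeakBound D B m (firstOrderProd L F) →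
        WeakBound D B 0 (firstOrderProd L F) := by
      intro m
      induction m with
      | zero => exact id
      | succ m ihm => exact fun hm => ihm (hm.of_succ hD hDr hZ hp (hall (m + 1)))
    have h0 := hdown _ (hup L)
    rcases List.suffix_cons_iff.mp hs with rfl | hs'
    · simp at hne
    · rcases hs'.length_le.lt_or_eq with hlt | heq
      · exact ih (fun q hq => hL q (by simp [hq])) h0 hs' hlt
      · rw [hs'.eq_of_length heq]
        exact h0.exists_norm_le hD hDr hZ hp h

end WeakBound

/-! ### Growth of solutions in the vertical direction -/

/-- Gronwall's inequality for a chain of functions `Z (j + 1) = (a d/dt + b j) Z j` that is closed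
up by `Z N = exp t * Z 0`, along a vertical segment. -/
theorem norm_le_exp_of_chain {D : Set ℂ} (hD : IsOpen D) {N : ℕ} (hN : 0 < N) {a : ℂ} (ha : a ≠ 0)
    {b : ℕ → ℂ} {β : ℝ} (hb : ∀ j, ‖b j‖ ≤ β) {Z : ℕ → ℂ → ℂ}
    (hZ : ∀ j, DifferentiableOn ℂ (Z j) D)
    (hstep : ∀ j < N, ∀ t ∈ D, Z (j + 1) t = firstOrder a (b j) (Z j) t)
    (hlast : ∀ t ∈ D, Z N t = Complex.exp t * Z 0 t) {t ζ : ℂ} (hζ : ‖ζ‖ = 1) (hζr : ζ.re = 0)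
    {θ : ℝ} (hθ : 0 ≤ θ) (hseg : ∀ s ∈ Set.Icc 0 θ, t + s * ζ ∈ D) {μ : ℝ} (hμ : 1 ≤ μ)
    (hμN : Real.exp t.re ≤ μ ^ N) :
    ‖Z 0 (t + θ * ζ)‖ ≤ (∑ j ∈ Finset.range N, ‖Z j t‖) *
      Real.exp ((1 + β) / ‖a‖ * μ * θ) := by
  have hμ0 : 0 < μ := by linarith
  have hβ : 0 ≤ β := (norm_nonneg _).trans (hb 0)
  have ha' : 0 < ‖a‖ := norm_pos_iff.mpr ha
  -- The rescaling by `μ^{-j}` balances the system: each step up costs one factor `μ`, and closing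
  -- up through `exp t` costs at most `μ^N / μ^{N-1} = μ`. Without it the rate would be of order
  -- `e^{Re t}` instead of `e^{Re t / N}`.
  set f : ℝ → Fin N → ℂ := fun s j => ((μ ^ (j : ℕ))⁻¹ : ℝ) * Z j (t + s * ζ) with hf
  set f' : ℝ → Fin N → ℂ := fun s j => ((μ ^ (j : ℕ))⁻¹ : ℝ) * (deriv (Z j) (t + s * ζ) * ζ) with hf'
  have hder : ∀ s ∈ Set.Icc 0 θ, HasDerivAt f (f' s) s := by
    intro s hs
    rw [hasDerivAt_pi]
    intro j
    have h1 : HasDerivAt (fun s : ℝ => t + (s : ℂ) * ζ) ζ s := by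
      have h1' : HasDerivAt (fun s : ℝ => (s : ℂ)) 1 s := Complex.ofRealCLM.hasDerivAt
      simpa using (h1'.mul_const ζ).const_add t
    have h2 := ((hZ j).differentiableAt (hD.mem_nhds (hseg s hs))).hasDerivAt.comp_of_eq s h1 rfl
    exact h2.const_mul _
  have hbound : ∀ s ∈ Set.Icc 0 θ, ‖f' s‖ ≤ (1 + β) / ‖a‖ * μ * ‖f s‖ := by
    intro s hs
    rw [pi_norm_le_iff_of_nonneg (by positivity)]
    intro j
    have hj : ‖f s j‖ ≤ ‖f s‖ := norm_le_pi_norm _ j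
    have hmem := hseg s hs
    have hre : (t + s * ζ).re = t.re := by simp [hζr]
    have hμj : 0 < μ ^ (j : ℕ) := by positivity
    have hfj : ∀ i : Fin N, ‖f s i‖ = (μ ^ (i : ℕ))⁻¹ * ‖Z i (t + s * ζ)‖ := fun i => by
      rw [hf, norm_mul, Complex.norm_real, Real.norm_of_nonneg (by positivity)]
    have hnext : (μ ^ (j : ℕ))⁻¹ * ‖Z (j + 1) (t + s * ζ)‖ ≤ μ * ‖f s‖ := by
      rcases Nat.lt_or_ge (j + 1) N with hlt | hge
      · have h1 : ‖f s ⟨j + 1, hlt⟩‖ ≤ ‖f s‖ := norm_le_pi_norm _ _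
        rw [hfj] at h1
        calc (μ ^ (j : ℕ))⁻¹ * ‖Z (j + 1) (t + s * ζ)‖
            = μ * ((μ ^ ((j : ℕ) + 1))⁻¹ * ‖Z (j + 1) (t + s * ζ)‖) := by
              rw [pow_succ]; field_simp
          _ ≤ μ * ‖f s‖ := mul_le_mul_of_nonneg_left h1 hμ0.le
      · have hjN : (j : ℕ) + 1 = N := le_antisymm j.2 hge
        have h1 : ‖f s ⟨0, hN⟩‖ ≤ ‖f s‖ := norm_le_pi_norm _ _
        rw [hfj] at h1
        simp only [pow_zero, inv_one, one_mul] at h1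
        rw [hjN, hlast _ hmem, norm_mul, Complex.norm_exp, hre, ← mul_assoc]
        refine mul_le_mul ?_ h1 (norm_nonneg _) hμ0.le
        rw [inv_mul_le_iff₀ hμj, ← pow_succ, hjN]
        exact hμN
    have hd : a * deriv (Z j) (t + s * ζ) = Z (j + 1) (t + s * ζ) - b j * Z j (t + s * ζ) := by
      rw [hstep j j.2 _ hmem, firstOrder]
      ring
    have hd' : ‖a‖ * ‖deriv (Z j) (t + s * ζ)‖ ≤
        ‖Z (j + 1) (t + s * ζ)‖ + β * ‖Z j (t + s * ζ)‖ := by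
      rw [← norm_mul, hd]
      refine (norm_sub_le _ _).trans ?_
      rw [norm_mul]
      gcongr
      exact hb j
    have h2 : ‖f' s j‖ = (μ ^ (j : ℕ))⁻¹ * ‖deriv (Z j) (t + s * ζ)‖ := by
      rw [hf', norm_mul, norm_mul, hζ, mul_one, Complex.norm_real,
        Real.norm_of_nonneg (by positivity)]
    rw [hfj] at hj
    have h3 : ‖a‖ * ‖f' s j‖ ≤ (1 + β) * μ * ‖f s‖ := by
      rw [h2]
      calc ‖a‖ * ((μ ^ (j : ℕ))⁻¹ * ‖deriv (Z j) (t + s * ζ)‖)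
          = (μ ^ (j : ℕ))⁻¹ * (‖a‖ * ‖deriv (Z j) (t + s * ζ)‖) := by ring
        _ ≤ (μ ^ (j : ℕ))⁻¹ * (‖Z (j + 1) (t + s * ζ)‖ + β * ‖Z j (t + s * ζ)‖) := by gcongr
        _ = (μ ^ (j : ℕ))⁻¹ * ‖Z (j + 1) (t + s * ζ)‖ +
            β * ((μ ^ (j : ℕ))⁻¹ * ‖Z j (t + s * ζ)‖) := by ring
        _ ≤ μ * ‖f s‖ + β * ‖f s‖ := by gcongr
        _ ≤ (1 + β) * μ * ‖f s‖ := by nlinarith [mul_nonneg hβ (norm_nonneg (f s))]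
    rw [div_mul_eq_mul_div, div_mul_eq_mul_div, le_div_iff₀ ha', mul_comm]
    exact h3
  have hinit : ‖f 0‖ ≤ ∑ j ∈ Finset.range N, ‖Z j t‖ := by
    rw [pi_norm_le_iff_of_nonneg (Finset.sum_nonneg fun _ _ => norm_nonneg _)]
    intro j
    have h1 : ‖f 0 j‖ ≤ ‖Z j t‖ := by
      rw [hf, norm_mul, Complex.norm_real, Real.norm_of_nonneg (by positivity)]
      simp only [Complex.ofReal_zero, zero_mul, add_zero]
      exact mul_le_of_le_one_left (norm_nonneg _) (inv_le_one_of_one_le₀ (one_le_pow₀ hμ))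
    exact h1.trans (Finset.single_le_sum (f := fun j => ‖Z j t‖) (fun _ _ => norm_nonneg _)
      (Finset.mem_range.mpr j.2))
  have hG := norm_le_gronwallBound_of_norm_deriv_right_le (f := f) (f' := f') (a := 0) (b := θ)
    (K := (1 + β) / ‖a‖ * μ) (ε := 0) (fun s hs => (hder s hs).continuousAt.continuousWithinAt)
    (fun s hs => (hder s (Set.Ico_subset_Icc_self hs)).hasDerivWithinAt) hinit
    (fun s hs => by rw [add_zero]; exact hbound s (Set.Ico_subset_Icc_self hs)) θ ⟨hθ, le_rfl⟩
  rw [gronwallBound_ε0, sub_zero] at hG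
  have h0 : ‖f θ ⟨0, hN⟩‖ ≤ ‖f θ‖ := norm_le_pi_norm _ _
  have e0 : f θ ⟨0, hN⟩ = Z 0 (t + θ * ζ) := by simp [hf]
  rw [e0] at h0
  exact h0.trans hG

/-- A solution of the GKZ equation of projective space on a horizontally invariant domain is bounded
near a horizontal line by its integrals along that line. -/
theorem exists_norm_le_integral_of_cpGKZ {k : ℕ} {w : Fin (k + 1) → ℂ} {ħ : ℂ} (hħ : ħ ≠ 0)
    {D : Set ℂ} (hD : IsOpen D) (hDr : ∀ t ∈ D, ∀ σ : ℝ, t + (σ : ℂ) ∈ D) {F : ℂ → ℂ}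
    (hF : DifferentiableOn ℂ F D) (hGKZ : ∀ t ∈ D, cpGKZ w ħ F t = 0) :
    ∃ C K : ℝ, 0 ≤ C ∧ 0 ≤ K ∧ ∀ t ∈ D, ∀ ζ : ℂ, ‖ζ‖ = 1 → ζ.re = 0 → ∀ θ : ℝ, 0 ≤ θ →
      (∀ s ∈ Set.Icc 0 θ, t + s * ζ ∈ D) → ∀ μ : ℝ, 1 ≤ μ → Real.exp t.re ≤ μ ^ (k + 1) →
      ‖F (t + θ * ζ)‖ ≤ C * Real.exp (K * μ * θ) *
        ((1 + Real.exp t.re) * ∫ σ in (0 : ℝ)..1, ‖F (t + σ)‖) := by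
  set L : List (ℂ × ℂ) := (List.finRange (k + 1)).map fun i => (ħ, -w i) with hL
  have hlen : L.length = k + 1 := by simp [hL]
  set B : ℂ → ℝ := fun t => (1 + Real.exp t.re) * ∫ σ in (0 : ℝ)..1, ‖F (t + σ)‖ with hB
  have hB0 : ∀ t, 0 ≤ B t := fun t => mul_nonneg (by positivity)
    (intervalIntegral.integral_nonneg zero_le_one fun _ _ => norm_nonneg _)
  have hLF : ∀ t ∈ D, firstOrderProd L F t = Complex.exp t * F t := by
    intro t ht
    have := hGKZ t ht
    rwa [cpGKZ, wProd_eq_firstOrderProd, xHat, sub_eq_zero] at this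
  -- both ends of the chain are weakly bounded
  have hweak : ∀ g : ℂ → ℂ, (∀ t ∈ D, ∀ σ ∈ Set.Icc (0 : ℝ) 1,
      ‖g (t + σ)‖ ≤ Real.exp 1 * (1 + Real.exp t.re) * ‖F (t + σ)‖) → WeakBound D B 0 g := by
    intro g hg q hq _
    obtain ⟨M, hM⟩ := isCompact_Icc.exists_bound_of_continuousOn
      (hq.continuous.continuousOn (s := Set.Icc (0 : ℝ) 1))
    refine ⟨M * Real.exp 1, fun t ht => ?_⟩
    have hFc := (continuous_comp_add_ofReal hDr hF.continuousOn ht).norm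
    have h1 : ‖∫ σ in (0 : ℝ)..1, ((σ : ℂ) ^ 0 * q σ) * g (t + σ)‖ ≤
        ∫ σ in (0 : ℝ)..1, M * (Real.exp 1 * (1 + Real.exp t.re)) * ‖F (t + σ)‖ := by
      refine intervalIntegral.norm_integral_le_of_norm_le zero_le_one
        (Eventually.of_forall fun σ hσ => ?_) ((hFc.const_mul _).intervalIntegrable _ _)
      have hσ' := Set.Ioc_subset_Icc_self hσ
      rw [pow_zero, one_mul, norm_mul, mul_assoc]
      exact mul_le_mul (hM σ hσ') (hg t ht σ hσ') (norm_nonneg _)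
        ((norm_nonneg _).trans (hM σ hσ'))
    rw [intervalIntegral.integral_const_mul] at h1
    rw [hB]
    calc _ ≤ _ := h1
      _ = _ := by ring
  have hF0 : WeakBound D B 0 F := hweak F fun t ht σ _ => by
    refine le_mul_of_one_le_left (norm_nonneg _) ?_
    have h1 : 1 ≤ Real.exp 1 := Real.one_le_exp zero_le_one
    nlinarith [Real.exp_pos t.re]
  have hFL : WeakBound D B 0 (firstOrderProd L F) := hweak _ fun t ht σ hσ => by
    rw [hLF _ (hDr t ht σ), norm_mul, Complex.norm_exp]
    refine mul_le_mul_of_nonneg_right ?_ (norm_nonneg _)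
    rw [Complex.add_re, Complex.ofReal_re, Real.exp_add]
    have h1 : Real.exp σ ≤ Real.exp 1 := Real.exp_le_exp.mpr hσ.2
    nlinarith [Real.exp_pos t.re, Real.exp_pos 1]
  -- The head of a list acts last, so the first `j` operators to be applied are the last `j`
  -- entries.
  set Z : ℕ → ℂ → ℂ := fun j => firstOrderProd (L.drop (k + 1 - j)) F with hZ
  have hZd : ∀ j, DifferentiableOn ℂ (Z j) D := fun j => firstOrderProd_differentiableOn hD _ hF
  have hZb : ∀ j : ℕ, ∃ C : ℝ, 0 ≤ C ∧ (j < k + 1 → ∀ t ∈ D, ‖Z j t‖ ≤ C * B t) := by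
    intro j
    by_cases hj : j < k + 1
    · obtain ⟨C, hC⟩ := WeakBound.exists_norm_firstOrderProd_le hD hDr hF hF0 L
        (by simp [hL, hħ]) hFL (List.drop_suffix (k + 1 - j) L)
        (by rw [List.length_drop, hlen]; omega)
      exact ⟨|C|, abs_nonneg _, fun _ t ht => (hC t ht).trans
        (mul_le_mul_of_nonneg_right (le_abs_self C) (hB0 t))⟩
    · exact ⟨0, le_rfl, fun h => absurd h hj⟩
  choose c hc0 hc using hZb
  -- The index `k - j` is truncated and always below `k + 1`, so the default is never used and the
  -- bound on `b j` holds for every `j`.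
  set b : ℕ → ℂ := fun j => (L.getD (k - j) (0, 0)).2 with hb
  have hstep : ∀ j < k + 1, ∀ t ∈ D, Z (j + 1) t = firstOrder ħ (b j) (Z j) t := by
    intro j hj t _
    have h1 : k + 1 - (j + 1) = k - j := by omega
    have h2 : k + 1 - j = k - j + 1 := by omega
    have h3 : k - j < L.length := by omega
    simp only [hZ, hb, h1, h2]
    rw [List.drop_eq_getElem_cons h3, List.getD_eq_getElem _ _ h3]
    simp [firstOrderProd, hL]
  have hbβ : ∀ j, ‖b j‖ ≤ ∑ i, ‖w i‖ := by
    intro j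
    have h3 : k - j < L.length := by omega
    simp only [hb]
    rw [List.getD_eq_getElem _ _ h3]
    simp only [hL, List.getElem_map, norm_neg]
    exact Finset.single_le_sum (f := fun i => ‖w i‖) (fun _ _ => norm_nonneg _) (Finset.mem_univ _)
  refine ⟨∑ j ∈ Finset.range (k + 1), c j, (1 + ∑ i, ‖w i‖) / ‖ħ‖,
    Finset.sum_nonneg fun j _ => hc0 j, by positivity, ?_⟩
  intro t ht ζ hζ hζr θ hθ hseg μ hμ hμN
  have hZ0 : Z 0 = F := by
    simp only [hZ, Nat.sub_zero, ← hlen, List.drop_length, firstOrderProd]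
  have hmain := norm_le_exp_of_chain hD (Nat.succ_pos k) hħ hbβ hZd hstep (fun t ht => by
    rw [hZ0]
    simp only [hZ, Nat.sub_self, List.drop_zero]
    exact hLF t ht) hζ hζr hθ hseg hμ hμN
  rw [hZ0] at hmain
  refine hmain.trans ?_
  have hsum : ∑ j ∈ Finset.range (k + 1), ‖Z j t‖ ≤ (∑ j ∈ Finset.range (k + 1), c j) * B t := by
    rw [Finset.sum_mul]
    exact Finset.sum_le_sum fun j hj => hc j (Finset.mem_range.mp hj) t ht
  calc _ ≤ (∑ j ∈ Finset.range (k + 1), c j) * B t * _ :=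
        mul_le_mul_of_nonneg_right hsum (Real.exp_pos _).le
    _ = _ := by ring

/-! ### The Laplace transform in logarithmic coordinates -/

/-- The weight `exp (-(∑ v_a + lam_a log v_a) / ħ) ∏ v_a ^ (m_a + 1)` at `v_a = exp (r a)`. -/
noncomputable def laplaceWeight {n : ℕ} (lam : Fin n → ℂ) (ħ : ℂ) (m : Fin n → ℕ)
    (r : Fin n → ℝ) : ℂ :=
  Complex.exp (∑ a, (((m a : ℂ) + 1) * r a - (Complex.exp (r a) + lam a * r a) / ħ))

/-- The integrand of the Laplace transform in the coordinates `r a = log (v a)`, with the additional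
factor `∏ v_a ^ m_a`. -/
noncomputable def laplaceFamily {n : ℕ} (l : Fin n → ℕ) (lam : Fin n → ℂ) (ħ : ℂ) (F : ℂ → ℂ)
    (m : Fin n → ℕ) (t : ℂ) (r : Fin n → ℝ) : ℂ :=
  laplaceWeight lam ħ m r * F (t + ∑ a, (l a : ℂ) * (r a : ℂ))

section Laplace

variable {n : ℕ} {l : Fin n → ℕ} {lam : Fin n → ℂ} {ħ : ℂ} {F : ℂ → ℂ} {m : Fin n → ℕ}

theorem add_sum_mem {D : Set ℂ} (hDr : ∀ t ∈ D, ∀ σ : ℝ, t + (σ : ℂ) ∈ D) {t : ℂ}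
    (ht : t ∈ D) (l : Fin n → ℕ) (r : Fin n → ℝ) : t + ∑ b, (l b : ℂ) * (r b : ℂ) ∈ D := by
  have := hDr t ht (∑ b, (l b : ℝ) * r b)
  push_cast at this
  exact this

theorem continuous_laplaceWeight : Continuous (laplaceWeight lam ħ m) := by
  unfold laplaceWeight
  fun_prop

theorem image_exp_eq_orthant :
    (fun (r : Fin n → ℝ) a => Real.exp (r a)) '' Set.univ = orthant n := by
  ext v
  simp only [Set.image_univ, Set.mem_range, orthant, Set.mem_ofPred_eq]
  constructor
  · rintro ⟨r, rfl⟩ a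
    exact Real.exp_pos _
  · intro h
    exact ⟨fun a => Real.log (v a), funext fun a => Real.exp_log (h a)⟩

theorem injective_exp_pi : Function.Injective fun (r : Fin n → ℝ) a => Real.exp (r a) :=
  fun _ _ h => funext fun a => Real.exp_injective (congrFun h a)

theorem hasFDerivAt_exp_pi (r : Fin n → ℝ) :
    HasFDerivAt (fun (r : Fin n → ℝ) a => Real.exp (r a))
      (ContinuousLinearMap.pi fun a =>
        Real.exp (r a) • (ContinuousLinearMap.proj a : (Fin n → ℝ) →L[ℝ] ℝ)) r := by
  rw [hasFDerivAt_pi]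
  intro a
  exact HasFDerivAt.exp (hasFDerivAt_apply a r)

theorem det_pi_smul_proj (d : Fin n → ℝ) :
    (ContinuousLinearMap.pi fun a =>
      d a • (ContinuousLinearMap.proj a : (Fin n → ℝ) →L[ℝ] ℝ)).det = ∏ a, d a := by
  have : ((ContinuousLinearMap.pi fun a =>
      d a • (ContinuousLinearMap.proj a : (Fin n → ℝ) →L[ℝ] ℝ)) : (Fin n → ℝ) →ₗ[ℝ] Fin n → ℝ) =
      Matrix.toLin' (Matrix.diagonal d) := by
    refine LinearMap.ext fun v => funext fun a => ?_
    simp [Matrix.mulVec_diagonal]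
  rw [ContinuousLinearMap.det, this, LinearMap.det_toLin', Matrix.det_diagonal]

/-- The Jacobian of `v = e^r` is `∏ e^{r_a}`, which accounts for the `1` in the exponents `m_a + 1`
of `laplaceWeight`. -/
theorem abs_det_smul_laplaceIntegrand (t : ℂ) (r : Fin n → ℝ) :
    |(ContinuousLinearMap.pi fun a =>
      Real.exp (r a) • (ContinuousLinearMap.proj a : (Fin n → ℝ) →L[ℝ] ℝ)).det| •
      laplaceIntegrand l lam ħ F t (fun a => Real.exp (r a)) = laplaceFamily l lam ħ F 0 t r := by
  rw [det_pi_smul_proj, abs_of_pos (Finset.prod_pos fun a _ => Real.exp_pos _), Complex.real_smul]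
  simp only [laplaceIntegrand, laplaceFamily, laplaceWeight, Real.log_exp]
  rw [← mul_assoc]
  congr 1
  rw [Complex.ofReal_prod]
  simp only [Complex.ofReal_exp]
  rw [← Complex.exp_sum, ← Complex.exp_add, neg_div, ← sub_eq_add_neg, Finset.sum_div,
    ← Finset.sum_sub_distrib]
  simp

theorem ciLaplace_eq_integral (t : ℂ) :
    ciLaplace l lam ħ F t = ∫ r, laplaceFamily l lam ħ F 0 t r := by
  rw [ciLaplace, ← image_exp_eq_orthant, integral_image_eq_integral_abs_det_fderiv_smul volume
    MeasurableSet.univ (fun r _ => (hasFDerivAt_exp_pi r).hasFDerivWithinAt)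
    injective_exp_pi.injOn, Measure.restrict_univ]
  simp only [abs_det_smul_laplaceIntegrand]

theorem integrableOn_laplaceIntegrand_iff (t : ℂ) :
    IntegrableOn (laplaceIntegrand l lam ħ F t) (orthant n) ↔
      Integrable (laplaceFamily l lam ħ F 0 t) := by
  rw [← image_exp_eq_orthant, integrableOn_image_iff_integrableOn_abs_det_fderiv_smul volume
    MeasurableSet.univ (fun r _ => (hasFDerivAt_exp_pi r).hasFDerivWithinAt)
    injective_exp_pi.injOn, integrableOn_univ]
  simp only [abs_det_smul_laplaceIntegrand]

theorem laplaceWeight_update (m : Fin n → ℕ) (a : Fin n) (r : Fin n → ℝ) :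
    laplaceWeight lam ħ (Function.update m a (m a + 1)) r =
      Complex.exp (r a) * laplaceWeight lam ħ m r := by
  simp only [laplaceWeight]
  rw [← Complex.exp_add]
  congr 1
  rw [← Finset.add_sum_erase _ _ (Finset.mem_univ a),
    ← Finset.add_sum_erase (a := a) Finset.univ (fun a => ((m a : ℂ) + 1) * r a -
      (Complex.exp (r a) + lam a * r a) / ħ) (Finset.mem_univ a),
    Finset.sum_congr rfl fun b hb => by
      rw [Function.update_of_ne (Finset.ne_of_mem_erase hb)], Function.update_self]
  push_cast
  ring

theorem hasLineDerivAt_laplaceWeight (a : Fin n) (r : Fin n → ℝ) :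
    HasLineDerivAt ℝ (laplaceWeight lam ħ m)
      ((((m a : ℂ) + 1) - (Complex.exp (r a) + lam a) / ħ) * laplaceWeight lam ħ m r) r
      (Pi.single a 1) := by
  have h1 : ∀ b, HasDerivAt (fun s : ℝ => (((r + s • (Pi.single a 1 : Fin n → ℝ)) b : ℝ) : ℂ))
      (Pi.single (M := fun _ => ℂ) a (1 : ℂ) b) 0 := by
    intro b
    have : HasDerivAt (fun s : ℝ => r b + s * Pi.single (M := fun _ => ℝ) a (1 : ℝ) b)
        (1 * Pi.single (M := fun _ => ℝ) a (1 : ℝ) b) 0 :=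
      ((hasDerivAt_id (0 : ℝ)).mul_const _).const_add _
    refine this.ofReal_comp.congr_deriv ?_
    rcases eq_or_ne b a with rfl | h
    · simp
    · simp [Pi.single_eq_of_ne h]
  have h2 : HasDerivAt (fun s : ℝ => laplaceWeight lam ħ m (r + s • (Pi.single a 1 : Fin n → ℝ)))
      _ 0 :=
    (HasDerivAt.fun_sum (u := Finset.univ) fun b _ => ((h1 b).const_mul ((m b : ℂ) + 1)).sub
      (((h1 b).cexp.add ((h1 b).const_mul (lam b))).div_const ħ)).cexp
  refine h2.congr_deriv ?_
  simp only [Pi.sub_apply, Pi.add_apply, Pi.zero_apply, zero_smul, add_zero, laplaceWeight]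
  rw [mul_comm]
  congr 1
  rw [Finset.sum_eq_single a]
  · simp
  · intro b _ hb
    simp [Pi.single_eq_of_ne hb]
  · simp

theorem hasLineDerivAt_laplaceFamily {D : Set ℂ} (hD : IsOpen D)
    (hDr : ∀ t ∈ D, ∀ σ : ℝ, t + (σ : ℂ) ∈ D) (hF : DifferentiableOn ℂ F D) {t : ℂ} (ht : t ∈ D)
    (a : Fin n) (r : Fin n → ℝ) :
    HasLineDerivAt ℝ (laplaceFamily l lam ħ F m t)
      ((((m a : ℂ) + 1) - (Complex.exp (r a) + lam a) / ħ) * laplaceFamily l lam ħ F m t r +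
        laplaceWeight lam ħ m r * (l a * deriv F (t + ∑ b, (l b : ℂ) * (r b : ℂ)))) r
      (Pi.single a 1) := by
  have h1 : ∀ s : ℝ, t + ∑ b, (l b : ℂ) * (((r + s • (Pi.single a 1 : Fin n → ℝ)) b : ℝ) : ℂ) =
      (t + ∑ b, (l b : ℂ) * (r b : ℂ)) + ((l a * s : ℝ) : ℂ) := by
    intro s
    simp only [Pi.add_apply, Pi.smul_apply, smul_eq_mul, Complex.ofReal_add, mul_add,
      Finset.sum_add_distrib]
    rw [add_assoc, Finset.sum_eq_single (M := ℂ) a (f := fun b => (l b : ℂ) *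
      ((s * Pi.single (M := fun _ => ℝ) a (1 : ℝ) b : ℝ) : ℂ))]
    · simp
    · intro b _ hb
      simp [Pi.single_eq_of_ne hb]
    · simp
  have hmem : t + ∑ b, (l b : ℂ) * (r b : ℂ) ∈ D := add_sum_mem hDr ht l r
  have h2 : HasDerivAt (fun s : ℝ => F ((t + ∑ b, (l b : ℂ) * (r b : ℂ)) + ((l a * s : ℝ) : ℂ)))
      (l a * deriv F (t + ∑ b, (l b : ℂ) * (r b : ℂ))) 0 := by
    have h3 : HasDerivAt (fun s : ℝ => (l a : ℝ) * s) (l a) 0 := by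
      simpa using (hasDerivAt_id (0 : ℝ)).const_mul (l a : ℝ)
    have h4 := (hF.differentiableAt (hD.mem_nhds hmem)).hasDerivAt.comp_of_eq (0 : ℝ)
      (h3.ofReal_comp.const_add (t + ∑ b, (l b : ℂ) * (r b : ℂ))) (by simp)
    exact h4.congr_deriv (by push_cast; ring)
  have h5 : HasDerivAt (fun s : ℝ => laplaceWeight lam ħ m (r + s • (Pi.single a 1 : Fin n → ℝ)))
      _ 0 := hasLineDerivAt_laplaceWeight (lam := lam) (ħ := ħ) (m := m) a r
  unfold HasLineDerivAt laplaceFamily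
  simp only [h1]
  refine (HasDerivAt.mul h5 h2).congr_deriv ?_
  simp only [zero_smul, add_zero, mul_zero, Complex.ofReal_zero]
  ring

/-- Integration by parts in the Laplace integral. -/
theorem firstOrder_integral_laplaceFamily (hħ : ħ ≠ 0) {D : Set ℂ} (hD : IsOpen D)
    (hDr : ∀ t ∈ D, ∀ σ : ℝ, t + (σ : ℂ) ∈ D) (hF : DifferentiableOn ℂ F D)
    (hdom : ∀ m, LocDominated volume D (laplaceFamily l lam ħ F m)) (m : Fin n → ℕ) (a : Fin n) :
    Set.EqOn (firstOrder (l a * ħ) (-lam a + ((m a : ℂ) + 1) * ħ)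
        fun t => ∫ r, laplaceFamily l lam ħ F m t r)
      (fun t => ∫ r, laplaceFamily l lam ħ F (Function.update m a (m a + 1)) t r) D := by
  intro t ht
  rw [(hdom m).firstOrder_integral hD _ _ ht]
  have hi1 := ((hdom m).firstOrder hD (l a * ħ) (-lam a + ((m a : ℂ) + 1) * ħ)).integrable ht
  have hi2 := (hdom (Function.update m a (m a + 1))).integrable ht
  rw [← sub_eq_zero, ← integral_sub hi1 hi2]
  set φ' : (Fin n → ℝ) → ℂ := fun r =>
    ((((m a : ℂ) + 1) - (Complex.exp (r a) + lam a) / ħ) * laplaceFamily l lam ħ F m t r +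
      laplaceWeight lam ħ m r * (l a * deriv F (t + ∑ b, (l b : ℂ) * (r b : ℂ)))) with hφ'
  -- The difference of the two integrands is `ħ` times the derivative of the first family in the
  -- direction `r_a`: the term `-e^{r_a}/ħ` from the exponential raises `m_a`, and the remaining
  -- terms reproduce the operator.
  have key : ∀ r, firstOrder (l a * ħ) (-lam a + ((m a : ℂ) + 1) * ħ)
        (fun t => laplaceFamily l lam ħ F m t r) t -
      laplaceFamily l lam ħ F (Function.update m a (m a + 1)) t r = ħ * φ' r := by
    intro r
    have : (fun t => laplaceFamily l lam ħ F m t r) =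
      fun t => laplaceWeight lam ħ m r * F (t + ∑ a, (l a : ℂ) * (r a : ℂ)) := rfl
    rw [this, firstOrder_const_mul_translate, hφ']
    simp only [laplaceFamily, laplaceWeight_update, firstOrder]
    field_simp
    ring
  have hi3 : Integrable φ' := by
    have := (hi1.sub hi2).const_mul ħ⁻¹
    refine this.congr (Eventually.of_forall fun r => ?_)
    change ħ⁻¹ * (_ - _) = _
    rw [key, inv_mul_cancel_left₀ hħ]
  have hparts := integral_bilinear_hasLineDerivAt_right_eq_neg_left_of_integrable
    (B := ContinuousLinearMap.mul ℝ ℂ) (f := fun _ : Fin n → ℝ => (1 : ℂ)) (f' := fun _ => 0)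
    (g := laplaceFamily l lam ħ F m t) (g' := φ') (v := Pi.single a 1) (μ := volume)
    (by simp) (by simpa using hi3) (by simpa using (hdom m).integrable ht)
    (fun x _ => by simpa [HasLineDerivAt] using hasDerivAt_const (0 : ℝ) (1 : ℂ))
    (fun r _ => hasLineDerivAt_laplaceFamily hD hDr hF ht a r)
  simp only [ContinuousLinearMap.mul_apply', one_mul, zero_mul, integral_zero, neg_zero] at hparts
  simp only [key]
  rw [integral_const_mul, hparts, mul_zero]

/-- The constant in the operator has to match the current exponent of `v_a`, so the factor with `i =
0` must act first. As the head of a list acts last, the range is reversed. -/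
theorem firstOrderProd_range_reverse_integral_laplaceFamily (hħ : ħ ≠ 0) {D : Set ℂ}
    (hD : IsOpen D) (hDr : ∀ t ∈ D, ∀ σ : ℝ, t + (σ : ℂ) ∈ D) (hF : DifferentiableOn ℂ F D)
    (hdom : ∀ m, LocDominated volume D (laplaceFamily l lam ħ F m)) {m : Fin n → ℕ} {a : Fin n}
    (hm : m a = 0) (j : ℕ) :
    Set.EqOn (firstOrderProd ((List.range j).reverse.map fun i : ℕ =>
        ((l a : ℂ) * ħ, -lam a + ((i : ℂ) + 1) * ħ)) fun t => ∫ r, laplaceFamily l lam ħ F m t r)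
      (fun t => ∫ r, laplaceFamily l lam ħ F (Function.update m a j) t r) D := by
  induction j with
  | zero =>
    intro t _
    simp only [List.range_zero, List.reverse_nil, List.map_nil, firstOrderProd]
    rw [← hm, Function.update_eq_self]
  | succ j ih =>
    rw [List.range_succ, List.reverse_append, List.reverse_singleton, List.singleton_append,
      List.map_cons]
    refine (firstOrder_congr hD _ _ ih).trans ?_
    have := firstOrder_integral_laplaceFamily hħ hD hDr hF hdom (Function.update m a j) a
    simpa only [Function.update_self, Function.update_idem] using this

theorem lamProd_integral_laplaceFamily (hħ : ħ ≠ 0) {D : Set ℂ} (hD : IsOpen D)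
    (hDr : ∀ t ∈ D, ∀ σ : ℝ, t + (σ : ℂ) ∈ D) (hF : DifferentiableOn ℂ F D)
    (hdom : ∀ m, LocDominated volume D (laplaceFamily l lam ħ F m)) :
    Set.EqOn (lamProd l lam ħ fun t => ∫ r, laplaceFamily l lam ħ F 0 t r)
      (fun t => ∫ r, laplaceFamily l lam ħ F l t r) D := by
  rw [lamProd_eq_firstOrderProd]
  have hperm := List.Perm.flatMap_left (List.finRange n)
    (f := fun a => (List.range (l a)).map fun m : ℕ =>
      ((l a : ℂ) * ħ, -lam a + ((m : ℂ) + 1) * ħ))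
    (g := fun a => (List.range (l a)).reverse.map fun m : ℕ =>
      ((l a : ℂ) * ħ, -lam a + ((m : ℂ) + 1) * ħ))
    fun a _ => (List.reverse_perm _).symm.map _
  refine (firstOrderProd_perm hD hperm ((hdom 0).differentiableOn_integral hD)).trans ?_
  have key : ∀ A : List (Fin n), A.Nodup → Set.EqOn
      (firstOrderProd (A.flatMap fun a => (List.range (l a)).reverse.map fun m : ℕ =>
        ((l a : ℂ) * ħ, -lam a + ((m : ℂ) + 1) * ħ)) fun t => ∫ r, laplaceFamily l lam ħ F 0 t r)
      (fun t => ∫ r, laplaceFamily l lam ħ F (fun a => if a ∈ A then l a else 0) t r) D := by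
    intro A hA
    induction A with
    | nil => intro t _; simp [firstOrderProd]; rfl
    | cons a A ih =>
      rw [List.nodup_cons] at hA
      rw [List.flatMap_cons, firstOrderProd_append]
      refine (firstOrderProd_congr hD _ (ih hA.2)).trans ?_
      have h := firstOrderProd_range_reverse_integral_laplaceFamily hħ hD hDr hF hdom
        (m := fun a => if a ∈ A then l a else 0) (a := a) (if_neg hA.1) (l a)
      have e : Function.update (fun b => if b ∈ A then l b else 0) a (l a) =
          fun b => if b ∈ a :: A then l b else 0 := by
        funext b
        rcases eq_or_ne b a with rfl | hb
        · simp
        · simp [hb]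
      rwa [e] at h
  simpa using key _ (List.nodup_finRange n)

theorem laplaceWeight_degrees (r : Fin n → ℝ) : laplaceWeight lam ħ l r =
    Complex.exp (∑ a, (l a : ℂ) * (r a : ℂ)) * laplaceWeight lam ħ 0 r := by
  simp only [laplaceWeight]
  rw [← Complex.exp_add, ← Finset.sum_add_distrib]
  congr 2
  funext a
  simp
  ring

/-- Both terms of the equation become integrals against the same weight. Under the integral, `∏ (ŷ -
w_i)` turns `F` into `x ∏ v_a^{l_a} F` by the equation of `F` at the translated point, and the
second product of operators produces `∏ v_a^{l_a}`. -/
theorem ciGKZ_ciLaplace_of_locDominated {k : ℕ} {w : Fin (k + 1) → ℂ} (hħ : ħ ≠ 0) {D : Set ℂ}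
    (hD : IsOpen D) (hDr : ∀ t ∈ D, ∀ σ : ℝ, t + (σ : ℂ) ∈ D) (hF : DifferentiableOn ℂ F D)
    (hGKZ : ∀ t ∈ D, cpGKZ w ħ F t = 0)
    (hdom : ∀ m, LocDominated volume D (laplaceFamily l lam ħ F m)) :
    DifferentiableOn ℂ (ciLaplace l lam ħ F) D ∧
      ∀ t ∈ D, ciGKZ w l lam ħ (ciLaplace l lam ħ F) t = 0 := by
  have e : ciLaplace l lam ħ F = fun t => ∫ r, laplaceFamily l lam ħ F 0 t r :=
    funext ciLaplace_eq_integral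
  rw [e]
  refine ⟨(hdom 0).differentiableOn_integral hD, fun t ht => ?_⟩
  rw [ciGKZ, xHat, lamProd_integral_laplaceFamily hħ hD hDr hF hdom ht, wProd_eq_firstOrderProd,
    (hdom 0).firstOrderProd_integral hD _ ht, sub_eq_zero, ← integral_const_mul]
  refine integral_congr_ae (Eventually.of_forall fun r => ?_)
  change firstOrderProd _ (fun t => laplaceFamily l lam ħ F 0 t r) t = _
  have : (fun t => laplaceFamily l lam ħ F 0 t r) =
    fun t => laplaceWeight lam ħ 0 r * F (t + ∑ a, (l a : ℂ) * (r a : ℂ)) := rfl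
  have hmem : t + ∑ b, (l b : ℂ) * (r b : ℂ) ∈ D := add_sum_mem hDr ht l r
  have h := hGKZ _ hmem
  rw [cpGKZ, xHat, sub_eq_zero] at h
  rw [this, firstOrderProd_const_mul_translate, ← wProd_eq_firstOrderProd]
  simp only [h, laplaceFamily]
  rw [laplaceWeight_degrees (l := l), Complex.exp_add]
  ring

end Laplace

/-! ### Domination of the Laplace integrand -/

/-- Eventually `C x^α + K log x ≤ c x`; the remaining range of `x` is compact. This is how `∑ l_a <
N` enters, through `α = ∑ l_a / N`. -/
theorem exists_exp_mul_rpow_mul_pow_le {α : ℝ} (hα : α < 1) (C : ℝ) (K : ℕ) {c : ℝ} (hc : 0 < c) :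
    ∃ M : ℝ, 0 ≤ M ∧ ∀ x : ℝ, 1 ≤ x → Real.exp (C * x ^ α) * x ^ K ≤ M * Real.exp (c * x) := by
  have h1 : Tendsto (fun x : ℝ => C * x ^ (-(1 - α)) + K * (Real.log x / x)) atTop (𝓝 0) := by
    have h2 := (tendsto_rpow_neg_atTop (show 0 < 1 - α by linarith)).const_mul C
    have h3 := (Real.isLittleO_log_id_atTop.tendsto_div_nhds_zero).const_mul (K : ℝ)
    simpa using h2.add h3
  obtain ⟨R, hR⟩ := eventually_atTop.mp (h1.eventually (gt_mem_nhds hc))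
  have hcont : ContinuousOn (fun x : ℝ => Real.exp (C * x ^ α) * x ^ K) (Set.Icc 1 R) := by
    have : ContinuousOn (fun x : ℝ => x ^ α) (Set.Icc 1 R) := fun x hx =>
      (Real.continuousAt_rpow_const x α (Or.inl (by linarith [hx.1]))).continuousWithinAt
    exact (Real.continuous_exp.comp_continuousOn (continuousOn_const.mul this)).mul
      (continuousOn_id.pow K)
  obtain ⟨B, hB⟩ := isCompact_Icc.exists_bound_of_continuousOn hcont
  refine ⟨max B 1, le_max_of_le_right zero_le_one, fun x hx => ?_⟩
  have hx0 : 0 < x := by linarith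
  rcases le_total x R with h | h
  · refine ((le_abs_self _).trans (hB x ⟨hx, h⟩)).trans ((le_max_left _ 1).trans ?_)
    exact le_mul_of_one_le_right (le_max_of_le_right zero_le_one)
      (Real.one_le_exp (by positivity))
  · refine le_trans ?_ (le_mul_of_one_le_left (Real.exp_pos _).le (le_max_right _ _))
    have h4 := mul_le_mul_of_nonneg_right (hR x h).le hx0.le
    have h5 : x ^ (-(1 - α)) * x = x ^ α := by
      rw [← Real.rpow_add_one hx0.ne']
      congr 1
      ring
    have h6 : x ^ K = Real.exp (K * Real.log x) := by
      rw [mul_comm, Real.exp_mul, Real.exp_log hx0, Real.rpow_natCast]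
    rw [h6, ← Real.exp_add]
    refine Real.exp_le_exp.mpr (le_trans (le_of_eq ?_) h4)
    rw [add_mul, mul_assoc, h5, mul_assoc, div_mul_cancel₀ _ hx0.ne']

section Laplace

variable {n : ℕ} {l : Fin n → ℕ} {lam : Fin n → ℂ} {ħ : ℂ} {F : ℂ → ℂ} {m : Fin n → ℕ} {D : Set ℂ}

theorem norm_laplaceWeight_zero (r : Fin n → ℝ) : ‖laplaceWeight lam ħ 0 r‖ =
    Real.exp (∑ a, (1 - (lam a / ħ).re) * r a - (ħ⁻¹).re * ∑ a, Real.exp (r a)) := by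
  rw [laplaceWeight, Complex.norm_exp, Complex.re_sum, Finset.mul_sum, ← Finset.sum_sub_distrib]
  congr 2
  funext a
  have : ((((0 : Fin n → ℕ) a : ℕ) : ℂ) + 1) * r a - (Complex.exp (r a) + lam a * r a) / ħ =
      (r a : ℂ) * (1 - lam a / ħ) - (Real.exp (r a) : ℂ) * ħ⁻¹ := by
    rw [Complex.ofReal_exp]
    simp
    ring
  rw [this, Complex.sub_re, Complex.re_ofReal_mul, Complex.re_ofReal_mul, Complex.sub_re,
    Complex.one_re]
  ring

theorem sum_mul_le_log (m : Fin n → ℕ) (r : Fin n → ℝ) :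
    ∑ a, (m a : ℝ) * r a ≤ (∑ a, m a : ℕ) * Real.log (1 + ∑ a, Real.exp (r a)) := by
  rw [Nat.cast_sum, Finset.sum_mul]
  refine Finset.sum_le_sum fun a _ => mul_le_mul_of_nonneg_left ?_ (Nat.cast_nonneg _)
  rw [Real.le_log_iff_exp_le (by positivity)]
  have := Finset.single_le_sum (f := fun a => Real.exp (r a)) (fun b _ => (Real.exp_pos _).le)
    (Finset.mem_univ a)
  linarith

theorem exp_sum_mul_le_pow (m : Fin n → ℕ) (r : Fin n → ℝ) :
    Real.exp (∑ a, (m a : ℝ) * r a) ≤ (1 + ∑ a, Real.exp (r a)) ^ (∑ a, m a) := by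
  refine (Real.exp_le_exp.mpr (sum_mul_le_log m r)).trans (le_of_eq ?_)
  rw [mul_comm, Real.exp_mul, Real.exp_log (by positivity), Real.rpow_natCast]

theorem norm_laplaceWeight_le (m : Fin n → ℕ) (r : Fin n → ℝ) : ‖laplaceWeight lam ħ m r‖ ≤
    (1 + ∑ a, Real.exp (r a)) ^ (∑ a, m a) * ‖laplaceWeight lam ħ 0 r‖ := by
  have : laplaceWeight lam ħ m r =
      Complex.exp ((∑ a, (m a : ℝ) * r a : ℝ) : ℂ) * laplaceWeight lam ħ 0 r := by
    push_cast
    exact laplaceWeight_degrees r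
  rw [this, norm_mul, Complex.norm_exp, Complex.ofReal_re]
  exact mul_le_mul_of_nonneg_right (exp_sum_mul_le_pow m r) (norm_nonneg _)

theorem continuous_laplaceFamily (hDr : ∀ t ∈ D, ∀ σ : ℝ, t + (σ : ℂ) ∈ D)
    (hF : ContinuousOn F D) {t : ℂ} (ht : t ∈ D) : Continuous (laplaceFamily l lam ħ F m t) :=
  continuous_laplaceWeight.mul (hF.comp_continuous (by fun_prop) (add_sum_mem hDr ht l))

/-- Convergence of the Laplace integral at a translate of `t` controls the integrals over a window
of translates, with half of the exponential decay to spare. -/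
theorem integrable_laplaceWindow (hl : 0 < ∑ a, l a) (hħ : 0 < ħ.re)
    (hDr : ∀ t ∈ D, ∀ σ : ℝ, t + (σ : ℂ) ∈ D) (hF : ContinuousOn F D)
    (hint : ∀ t ∈ D, Integrable (laplaceFamily l lam ħ F 0 t)) {t : ℂ} (ht : t ∈ D) :
    Integrable fun r : Fin n → ℝ => ∫ σ in (-1 : ℝ)..2,
      Real.exp ((ħ⁻¹).re / 2 * ∑ a, Real.exp (r a)) * ‖laplaceWeight lam ħ 0 r‖ *
        ‖F (t + ∑ a, (l a : ℂ) * (r a : ℂ) + σ)‖ := by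
  have hc : 0 < (ħ⁻¹).re := by
    rw [Complex.inv_re]
    exact div_pos hħ (Complex.normSq_pos.mpr fun h => by simp [h] at hħ)
  set c := (ħ⁻¹).re with hc_def
  set κ : ℝ := ∑ a, (1 - (lam a / ħ).re) with hκ
  set ℓ : ℝ := ((∑ a, l a : ℕ) : ℝ) with hℓ
  have hℓ0 : 0 < ℓ := Nat.cast_pos.mpr hl
  -- Chosen so that the shift `(S - σ)/ℓ` is at least `log 2` for all `σ ≤ 2`; every `v_a` is then
  -- at least doubled.
  set S : ℝ := 2 + ℓ * Real.log 2 with hS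
  set g : (Fin n → ℝ) × ℝ → ℝ := fun p =>
    Real.exp (c / 2 * ∑ a, Real.exp (p.1 a)) * ‖laplaceWeight lam ħ 0 p.1‖ *
      ‖F (t + ∑ a, (l a : ℂ) * (p.1 a : ℂ) + (p.2 : ℂ))‖ with hg
  have hgc : Continuous g := by
    have h1 : Continuous fun p : (Fin n → ℝ) × ℝ =>
        F (t + ∑ a, (l a : ℂ) * (p.1 a : ℂ) + (p.2 : ℂ)) :=
      hF.comp_continuous (by fun_prop) fun p => hDr _ (add_sum_mem hDr ht l p.1) p.2
    have h2 : Continuous fun p : (Fin n → ℝ) × ℝ => laplaceWeight lam ħ 0 p.1 :=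
      continuous_laplaceWeight.comp continuous_fst
    exact (Continuous.mul (by fun_prop) h2.norm).mul h1.norm
  have hg0 : ∀ p, 0 ≤ g p := fun p => by positivity
  set M : ℝ := Real.exp ((S + 1) / ℓ * |κ|) with hM
  -- Shifting all `r_a` by `s = (S - σ)/ℓ` moves the argument of `F` to that of the Laplace integral
  -- at `t + S`. The decay left over in `g` is `exp(-(c/2) e^s ∑ v_a)`, and `e^s ≥ 2` makes it at
  -- least the full decay available there.
  have key : ∀ σ ∈ Set.Ioc (-1 : ℝ) 2, ∀ r : Fin n → ℝ,
      g (r + (fun _ => (S - σ) / ℓ), σ) ≤ M * ‖laplaceFamily l lam ħ F 0 (t + S) r‖ := by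
    intro σ hσ r
    set s : ℝ := (S - σ) / ℓ with hs
    have hs1 : Real.log 2 ≤ s := by
      rw [hs, le_div_iff₀ hℓ0, hS]
      linarith [hσ.2]
    have hs0 : 0 ≤ s := (Real.log_nonneg one_le_two).trans hs1
    have hs2 : s ≤ (S + 1) / ℓ := by
      rw [hs]
      gcongr
      linarith [hσ.1]
    have h2 : 2 ≤ Real.exp s := by
      rwa [← Real.log_le_iff_le_exp (by norm_num)]
    have harg : t + ∑ a, (l a : ℂ) * ((r + fun _ : Fin n => s : Fin n → ℝ) a : ℂ) + (σ : ℂ) =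
        t + S + ∑ a, (l a : ℂ) * (r a : ℂ) := by
      have : ((ℓ * s : ℝ) : ℂ) = ((S - σ : ℝ) : ℂ) := by
        rw [hs, mul_div_cancel₀ _ hℓ0.ne']
      simp only [Pi.add_apply, Complex.ofReal_add, mul_add, Finset.sum_add_distrib]
      rw [← Finset.sum_mul]
      rw [hℓ] at this
      push_cast at this
      rw [this]
      ring
    have hsum : ∑ a, Real.exp ((r + fun _ : Fin n => s : Fin n → ℝ) a) = Real.exp s * ∑ a, Real.exp (r a) := by
      rw [Finset.mul_sum]
      exact Finset.sum_congr rfl fun a _ => by rw [Pi.add_apply, add_comm, Real.exp_add]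
    have hlin : ∑ a, (1 - (lam a / ħ).re) * (r + fun _ : Fin n => s : Fin n → ℝ) a =
        ∑ a, (1 - (lam a / ħ).re) * r a + s * κ := by
      simp only [Pi.add_apply, mul_add, Finset.sum_add_distrib]
      rw [hκ, Finset.mul_sum]
      simp only [mul_comm]
    simp only [hg, harg, laplaceFamily, norm_mul]
    rw [← mul_assoc]
    refine mul_le_mul_of_nonneg_right ?_ (norm_nonneg _)
    rw [norm_laplaceWeight_zero, norm_laplaceWeight_zero, hM, ← Real.exp_add, ← Real.exp_add,
      Real.exp_le_exp, hsum, hlin]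
    have h3 : s * κ ≤ (S + 1) / ℓ * |κ| :=
      (mul_le_mul_of_nonneg_left (le_abs_self κ) hs0).trans
        (mul_le_mul_of_nonneg_right hs2 (abs_nonneg κ))
    have hv : 0 ≤ ∑ a, Real.exp (r a) := Finset.sum_nonneg fun a _ => (Real.exp_pos _).le
    have h4 := mul_le_mul_of_nonneg_right h2 (mul_nonneg hc.le hv)
    linarith
  have hfam := (hint _ (hDr t ht S)).norm.const_mul M
  have hshift : ∀ σ ∈ Set.Ioc (-1 : ℝ) 2,
      Integrable fun r : Fin n → ℝ => g (r + (fun _ => (S - σ) / ℓ), σ) := fun σ hσ =>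
    hfam.mono' (Continuous.aestronglyMeasurable (by fun_prop)) (Eventually.of_forall fun r => by
      rw [Real.norm_of_nonneg (hg0 _)]
      exact key σ hσ r)
  -- Translation invariance of Lebesgue measure undoes the shift on each slice of constant `σ`,
  -- giving a bound independent of `σ`.
  have hprod : Integrable g (volume.prod (volume.restrict (Set.Ioc (-1 : ℝ) 2))) := by
    rw [integrable_prod_iff' hgc.aestronglyMeasurable]
    constructor
    · refine (ae_restrict_mem measurableSet_Ioc).mono fun σ hσ => ?_
      simpa using (hshift σ hσ).comp_sub_right (fun _ => (S - σ) / ℓ)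
    · refine Measure.integrableOn_of_bounded (M := ∫ r, M * ‖laplaceFamily l lam ħ F 0 (t + S) r‖)
        (by simp) ?_ ((ae_restrict_mem measurableSet_Ioc).mono fun σ hσ => ?_)
      · have hm : AEStronglyMeasurable (fun p : ℝ × (Fin n → ℝ) => ‖g (p.2, p.1)‖)
            (volume.prod volume) := Continuous.aestronglyMeasurable (by fun_prop)
        exact hm.integral_prod_right'
      · rw [Real.norm_of_nonneg (integral_nonneg fun _ => norm_nonneg _),
          ← integral_add_right_eq_self (fun r => ‖g (r, σ)‖) (fun _ => (S - σ) / ℓ)]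
        refine integral_mono (hshift σ hσ).norm hfam fun r => ?_
        change ‖g _‖ ≤ _
        rw [Real.norm_of_nonneg (hg0 _)]
        exact key σ hσ r
  have := hprod.integral_prod_left
  simpa only [intervalIntegral.integral_of_le (show (-1 : ℝ) ≤ 2 by norm_num)] using this

/-- A displacement is split into a horizontal move and then a vertical one in the direction `±i`;
the vertical path never leaves the ball of radius `‖d‖`. -/
theorem exists_norm_ofReal_add_le (d : ℂ) : ∃ ζ : ℂ, ‖ζ‖ = 1 ∧ ζ.re = 0 ∧
    (d.re : ℂ) + (|d.im| : ℝ) * ζ = d ∧ ∀ s ∈ Set.Icc 0 |d.im|, ‖(d.re : ℂ) + (s : ℂ) * ζ‖ ≤ ‖d‖ := by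
  obtain ⟨ε, hε, hd⟩ : ∃ ε : ℝ, |ε| = 1 ∧ d.im = |d.im| * ε := by
    rcases abs_cases d.im with h | h
    · exact ⟨1, by simp, by linarith⟩
    · exact ⟨-1, by simp, by linarith⟩
  refine ⟨ε * Complex.I, by simp [hε], by simp, ?_, fun s hs => ?_⟩
  · rw [← mul_assoc, ← Complex.ofReal_mul, ← hd, Complex.re_add_im]
  · rw [← sq_le_sq₀ (norm_nonneg _) (norm_nonneg _), Complex.sq_norm, Complex.sq_norm, ← mul_assoc,
      ← Complex.ofReal_mul, Complex.normSq_add_mul_I, mul_pow, ← sq_abs ε, hε, Complex.normSq_apply]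
    nlinarith [hs.1, hs.2, abs_mul_abs_self d.im]

/-- For `t` near `t₀`, the value of `F` at the translate of `t` is reached from the horizontal line
through the translate of `t₀` by a bounded vertical move. The GKZ equation bounds it by a window
integral of `‖F‖` on that line, times a factor that half of the exponential decay absorbs. -/
theorem locDominated_laplaceFamily {k : ℕ} {w : Fin (k + 1) → ℂ} (hħ : 0 < ħ.re)
    (hl : ∀ a, 0 < l a) (hlk : ∑ a, l a < k + 1) (hD : IsOpen D)
    (hDr : ∀ t ∈ D, ∀ σ : ℝ, t + (σ : ℂ) ∈ D) (hF : DifferentiableOn ℂ F D)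
    (hGKZ : ∀ t ∈ D, cpGKZ w ħ F t = 0)
    (hint : ∀ t ∈ D, Integrable (laplaceFamily l lam ħ F 0 t)) (m : Fin n → ℕ) :
    LocDominated volume D (laplaceFamily l lam ħ F m) where
  holo r := by
    refine DifferentiableOn.const_mul ?_ _
    exact hF.comp (by fun_prop) fun t ht => add_sum_mem hDr ht l r
  meas t ht := (continuous_laplaceFamily hDr hF.continuousOn ht).aestronglyMeasurable
  bound t₀ ht₀ := by
    obtain ⟨ε, hε, hball⟩ := Metric.isOpen_iff.mp hD t₀ ht₀
    -- Without Laplace variables there is nothing to shift, as `∑ l_a = 0`; the domain is a point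
    -- and continuity of `F` suffices.
    rcases n.eq_zero_or_pos with rfl | hn
    · obtain ⟨δ, hδ, hle⟩ := Metric.continuousAt_iff.mp
        (hF.continuousOn.continuousAt (hD.mem_nhds ht₀)) 1 one_pos
      refine ⟨min ε δ, lt_min hε hδ, (ball_subset_ball (min_le_left _ _)).trans hball,
        fun r => ‖laplaceWeight lam ħ m r‖ * (‖F t₀‖ + 1), ?_, fun t ht r => ?_⟩
      · have : IsFiniteMeasure (volume : Measure (Fin 0 → ℝ)) := by
          rw [volume_pi, Measure.pi_of_empty]
          infer_instance
        exact Integrable.of_finite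
      · rw [laplaceFamily, norm_mul]
        refine mul_le_mul_of_nonneg_left ?_ (norm_nonneg _)
        have h1 := hle (mem_ball.mp (ball_subset_ball (min_le_right _ _) ht))
        rw [dist_eq_norm] at h1
        rw [Finset.univ_eq_empty, Finset.sum_empty, add_zero]
        linarith [norm_sub_norm_le (F t) (F t₀)]
    have hħ0 : ħ ≠ 0 := fun h => by simp [h] at hħ
    have hc : 0 < (ħ⁻¹).re := by
      rw [Complex.inv_re]
      exact div_pos hħ (Complex.normSq_pos.mpr hħ0)
    have hl0 : 0 < ∑ a, l a := Finset.sum_pos (fun a _ => hl a) ⟨⟨0, hn⟩, Finset.mem_univ _⟩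
    obtain ⟨C, K, hC, hK, hbound⟩ := exists_norm_le_integral_of_cpGKZ hħ0 hD hDr hF hGKZ
    set E : ℝ := Real.exp (t₀.re + 1) with hE
    have hE0 : 0 < E := Real.exp_pos _
    set ℓ : ℕ := ∑ a, l a with hℓ
    set α : ℝ := (ℓ : ℝ) / ((k + 1 : ℕ) : ℝ) with hα
    have hk0 : (0 : ℝ) < ((k + 1 : ℕ) : ℝ) := by positivity
    have hα0 : 0 ≤ α := by positivity
    have hα1 : α < 1 := by
      rw [hα, div_lt_one hk0]
      exact_mod_cast hlk
    -- The power `∑ m_a` comes from the extra factor `∏ v_a^{m_a}`, and `ℓ` from the factor `1 +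
    -- e^{Re t₁}` in the interior estimate.
    obtain ⟨M, hM0, hM⟩ := exists_exp_mul_rpow_mul_pow_le hα1 (K * (1 + E)) ((∑ a, m a) + ℓ)
      (half_pos hc)
    -- The radius `1 / 2` keeps the unit segment starting at the shifted base point inside the
    -- window from `-1` to `2`.
    refine ⟨min ε (1 / 2), lt_min hε (by norm_num),
      (ball_subset_ball (min_le_left _ _)).trans hball, _,
      (integrable_laplaceWindow hl0 hħ hDr hF.continuousOn hint ht₀).const_mul
        (C * (1 + E) * (M * Real.exp ((ħ⁻¹).re / 2))), fun t ht r => ?_⟩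
    set d := t - t₀ with hd
    have hdn : ‖d‖ < min ε (1 / 2) := by rwa [mem_ball, dist_eq_norm] at ht
    have hd1 : |d.re| ≤ 1 / 2 :=
      (Complex.abs_re_le_norm d).trans (hdn.le.trans (min_le_right _ _))
    have hd2 : |d.im| ≤ 1 / 2 :=
      (Complex.abs_im_le_norm d).trans (hdn.le.trans (min_le_right _ _))
    obtain ⟨ζ, hζ, hζr, hdζ, hseg⟩ := exists_norm_ofReal_add_le d
    set Z : ℂ := ∑ a, (l a : ℂ) * (r a : ℂ) with hZ
    set Zr : ℝ := ∑ a, (l a : ℝ) * r a with hZr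
    have hZZ : Z = (Zr : ℂ) := by rw [hZ, hZr]; push_cast; rfl
    set x : ℝ := 1 + ∑ a, Real.exp (r a) with hx
    have hx1 : 1 ≤ x := by
      rw [hx]
      linarith [Finset.sum_nonneg fun a (_ : a ∈ Finset.univ) => (Real.exp_pos (r a)).le]
    have hx0 : 0 ≤ x := by linarith
    set t₁ : ℂ := t₀ + d.re + Z with ht₁
    have ht₁D : t₁ ∈ D := by
      rw [ht₁, hZZ]
      exact hDr _ (hDr _ ht₀ _) _
    have ht₁re : t₁.re = t₀.re + d.re + Zr := by
      rw [ht₁, hZZ]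
      simp
    have hexp : Real.exp t₁.re ≤ E * x ^ ℓ := by
      rw [ht₁re, Real.exp_add]
      refine mul_le_mul (Real.exp_le_exp.mpr ?_) (exp_sum_mul_le_pow l r) (Real.exp_pos _).le hE0.le
      linarith [le_abs_self d.re]
    have hxα : (x ^ α) ^ (k + 1) = x ^ ℓ := by
      rw [← Real.rpow_mul_natCast hx0, hα, div_mul_cancel₀ _ hk0.ne', Real.rpow_natCast]
    -- The Gronwall parameter: its `(k + 1)`-st power dominates `E x^ℓ`, hence `e^{Re t₁}`, while it
    -- is itself only of order `x^α` with `α < 1`.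
    have hμ1 : 1 ≤ (1 + E) * x ^ α :=
      one_le_mul_of_one_le_of_one_le (by linarith) (Real.one_le_rpow hx1 hα0)
    have hμ2 : Real.exp t₁.re ≤ ((1 + E) * x ^ α) ^ (k + 1) := by
      rw [mul_pow, hxα]
      refine hexp.trans (mul_le_mul_of_nonneg_right ?_ (by positivity))
      exact le_trans (by linarith) (le_self_pow₀ (by linarith) (Nat.succ_ne_zero k))
    have hval := hbound t₁ ht₁D ζ hζ hζr |d.im| (abs_nonneg _) (fun s hs => by
      have : t₁ + s * ζ = (t₀ + (d.re + s * ζ)) + (Zr : ℂ) := by rw [ht₁, hZZ]; ring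
      rw [this]
      refine hDr _ (hball ?_) _
      rw [mem_ball, dist_eq_norm, add_sub_cancel_left]
      exact (hseg s hs).trans_lt (hdn.trans_le (min_le_left _ _))) _ hμ1 hμ2
    have harg : t₁ + (|d.im| : ℝ) * ζ = t + Z := by
      have : t = t₀ + d := by rw [hd]; ring
      rw [this]
      conv_rhs => rw [← hdζ]
      rw [ht₁]
      ring
    rw [harg] at hval
    have hFc : Continuous fun σ : ℝ => F (t₀ + Z + σ) :=
      continuous_comp_add_ofReal hDr hF.continuousOn (add_sum_mem hDr ht₀ l r)
    have hwin : ∫ σ in (0 : ℝ)..1, ‖F (t₁ + σ)‖ ≤ ∫ σ in (-1 : ℝ)..2, ‖F (t₀ + Z + σ)‖ := by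
      have h1 := intervalIntegral.integral_comp_add_left (a := 0) (b := 1)
        (fun σ : ℝ => ‖F (t₀ + Z + σ)‖) d.re
      have h2 : ∀ σ : ℝ, t₀ + Z + ((d.re + σ : ℝ) : ℂ) = t₁ + σ := fun σ => by
        rw [ht₁]; push_cast; ring
      simp only [h2] at h1
      rw [h1]
      have := abs_le.mp hd1
      exact intervalIntegral.integral_mono_interval (by linarith) (by linarith) (by linarith)
        (Eventually.of_forall fun _ => norm_nonneg _) (hFc.norm.intervalIntegrable _ _)
    have hwin0 : 0 ≤ ∫ σ in (-1 : ℝ)..2, ‖F (t₀ + Z + σ)‖ :=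
      intervalIntegral.integral_nonneg (by norm_num) fun _ _ => norm_nonneg _
    rw [intervalIntegral.integral_const_mul, laplaceFamily, norm_mul]
    set J := ∫ σ in (-1 : ℝ)..2, ‖F (t₀ + Z + σ)‖ with hJ
    set A := ‖laplaceWeight lam ħ 0 r‖ with hA
    have h1 : Real.exp (K * ((1 + E) * x ^ α) * |d.im|) ≤ Real.exp (K * (1 + E) * x ^ α) := by
      refine Real.exp_le_exp.mpr ?_
      rw [← mul_assoc K]
      exact mul_le_of_le_one_right (by positivity) (by linarith)
    have h2 : 1 + Real.exp t₁.re ≤ (1 + E) * x ^ ℓ := by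
      have := one_le_pow₀ hx1 (n := ℓ)
      linarith
    have h3 : ‖F (t + Z)‖ ≤ C * Real.exp (K * (1 + E) * x ^ α) * ((1 + E) * x ^ ℓ * J) := by
      refine hval.trans ?_
      have hI : 0 ≤ ∫ σ in (0 : ℝ)..1, ‖F (t₁ + σ)‖ :=
        intervalIntegral.integral_nonneg zero_le_one fun _ _ => norm_nonneg _
      exact mul_le_mul (mul_le_mul_of_nonneg_left h1 hC) (mul_le_mul h2 hwin hI (by positivity))
        (by positivity) (by positivity)
    calc ‖laplaceWeight lam ħ m r‖ * ‖F (t + Z)‖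
        ≤ (x ^ (∑ a, m a) * A) *
          (C * Real.exp (K * (1 + E) * x ^ α) * ((1 + E) * x ^ ℓ * J)) :=
          mul_le_mul (norm_laplaceWeight_le m r) h3 (norm_nonneg _) (by positivity)
      _ = C * (1 + E) * (Real.exp (K * (1 + E) * x ^ α) * x ^ ((∑ a, m a) + ℓ)) * (A * J) := by
          rw [pow_add]; ring
      _ ≤ C * (1 + E) * (M * Real.exp ((ħ⁻¹).re / 2 * x)) * (A * J) := by
          exact mul_le_mul_of_nonneg_right
            (mul_le_mul_of_nonneg_left (hM x hx1) (by positivity)) (by positivity)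
      _ = _ := by
          rw [hx, mul_add ((ħ⁻¹).re / 2), mul_one, Real.exp_add]
          ring

end Laplace

/-! ### Complete intersections -/

section CompleteIntersection

variable {k n : ℕ} {w : Fin (k + 1) → ℂ} {l : Fin n → ℕ} {lam : Fin n → ℂ} {ħ t₀ : ℂ}
  {c : Fin k → ℂ} {γ : EuclideanSpace ℝ (Fin k) → (Fin k → ℂ)} {D : Set ℂ} {F : ℂ → ℂ}

theorem cpGKZ_differentiableOn (hD : IsOpen D) (hF : DifferentiableOn ℂ F D) :
    DifferentiableOn ℂ (cpGKZ w ħ F) D := by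
  have h := firstOrderProd_differentiableOn hD
    ((List.finRange (k + 1)).map fun i => (ħ, -w i)) hF
  rw [← wProd_eq_firstOrderProd] at h
  exact h.sub (Complex.differentiable_exp.differentiableOn.mul hF)

theorem cpGKZ_congr {U : Set ℂ} (hU : IsOpen U) {G : ℂ → ℂ} (h : Set.EqOn F G U) :
    Set.EqOn (cpGKZ w ħ F) (cpGKZ w ħ G) U := by
  intro t ht
  simp only [cpGKZ, xHat, wProd_eq_firstOrderProd]
  rw [firstOrderProd_congr hU _ h ht, h ht]

theorem ciGKZ_congr (hD : IsOpen D) {G : ℂ → ℂ} (h : Set.EqOn F G D) :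
    Set.EqOn (ciGKZ w l lam ħ F) (ciGKZ w l lam ħ G) D := by
  intro t ht
  simp only [ciGKZ, xHat, wProd_eq_firstOrderProd, lamProd_eq_firstOrderProd]
  rw [firstOrderProd_congr hD _ h ht, firstOrderProd_congr hD _ h ht]

/-- The GKZ equation of projective space persists under analytic continuation. -/
theorem cpGKZ_eq_zero_of_eqOn (hD : IsOpen D) (hDc : IsPreconnected D)
    (hF : DifferentiableOn ℂ F D) {U : Set ℂ} (hUD : U ⊆ D) (hU : IsOpen U) (hUne : U.Nonempty)
    {G : ℂ → ℂ} (hFG : Set.EqOn F G U) (hG : ∀ t ∈ U, cpGKZ w ħ G t = 0) :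
    ∀ t ∈ D, cpGKZ w ħ F t = 0 := by
  obtain ⟨z, hz⟩ := hUne
  refine ((cpGKZ_differentiableOn hD hF).analyticOnNhd
    hD).eqOn_zero_of_preconnected_of_eventuallyEq_zero hDc (hUD hz) ?_
  filter_upwards [hU.mem_nhds hz] with t ht
  rw [cpGKZ_congr hU hFG ht, hG t ht, Pi.zero_apply]

/-- The Laplace transform of a solution of the GKZ equation of projective space solves the GKZ
equation of the complete intersection. -/
theorem ciGKZ_ciLaplace (hħ : 0 < ħ.re) (hl : ∀ a, 0 < l a) (hlk : ∑ a, l a < k + 1)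
    (hD : IsOpen D) (hDr : ∀ t ∈ D, ∀ σ : ℝ, t + (σ : ℂ) ∈ D) (hF : DifferentiableOn ℂ F D)
    (hGKZ : ∀ t ∈ D, cpGKZ w ħ F t = 0)
    (hint : ∀ t ∈ D, IntegrableOn (laplaceIntegrand l lam ħ F t) (orthant n)) :
    DifferentiableOn ℂ (ciLaplace l lam ħ F) D ∧
      ∀ t ∈ D, ciGKZ w l lam ħ (ciLaplace l lam ħ F) t = 0 :=
  ciGKZ_ciLaplace_of_locDominated (fun h => by simp [h] at hħ) hD hDr hF hGKZ
    (locDominated_laplaceFamily hħ hl hlk hD hDr hF hGKZ fun t ht =>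
      (integrableOn_laplaceIntegrand_iff t).mp (hint t ht))

theorem measurableSet_orthant : MeasurableSet (orthant n) := by
  have : orthant n = Set.univ.pi fun _ => Set.Ioi 0 := by
    ext v
    simp [orthant]
  rw [this]
  exact MeasurableSet.univ_pi fun _ => measurableSet_Ioi

/-- The weight of the Laplace transform. -/
noncomputable def orthantWeight (lam : Fin n → ℂ) (ħ : ℂ) (v : Fin n → ℝ) : ℂ :=
  Complex.exp (-(∑ a, ((v a : ℂ) + lam a * (Real.log (v a) : ℂ))) / ħ)

theorem ciIntegrand_eq (t : ℂ) (y : EuclideanSpace ℝ (Fin k)) {v : Fin n → ℝ} (hv : v ∈ orthant n) :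
    ciIntegrand w l lam ħ γ t (y, v) =
      orthantWeight lam ħ v * cpIntegrand w ħ γ (t + ∑ a, (l a : ℂ) * (Real.log (v a) : ℂ)) y := by
  simp only [ciIntegrand, cpIntegrand, orthantWeight]
  rw [← mul_assoc, ← Complex.exp_add, ← add_div]
  congr 3
  have : ∀ a, Complex.exp (Real.log (v a) : ℂ) = v a := fun a => by
    rw [← Complex.ofReal_exp, Real.exp_log (hv a)]
  simp only [ciPotential, cpPotential, this]
  ring

theorem restrict_univ_prod_orthant :
    (volume : Measure (EuclideanSpace ℝ (Fin k) × (Fin n → ℝ))).restrict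
      (Set.univ ×ˢ orthant n) = volume.prod (volume.restrict (orthant n)) := by
  rw [Measure.volume_eq_prod, ← Measure.prod_restrict, Measure.restrict_univ]

theorem integrable_prod_of_integrableOn_ciIntegrand {t : ℂ}
    (h : IntegrableOn (ciIntegrand w l lam ħ γ t) (Set.univ ×ˢ orthant n)) :
    Integrable (fun p : EuclideanSpace ℝ (Fin k) × (Fin n → ℝ) => orthantWeight lam ħ p.2 *
      cpIntegrand w ħ γ (t + ∑ a, (l a : ℂ) * (Real.log (p.2 a) : ℂ)) p.1)
      (volume.prod (volume.restrict (orthant n))) := by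
  rw [← restrict_univ_prod_orthant]
  refine (integrableOn_congr_fun (fun p hp => ?_)
    (MeasurableSet.univ.prod measurableSet_orthant)).mp h
  exact ciIntegrand_eq t p.1 hp.2

/-- Fubini: the integral over the product is the Laplace transform of the thimble integral. -/
theorem ciIntegral_eq_ciLaplace {t : ℂ}
    (h : IntegrableOn (ciIntegrand w l lam ħ γ t) (Set.univ ×ˢ orthant n)) :
    IntegrableOn (laplaceIntegrand l lam ħ (cpIntegral w ħ γ) t) (orthant n) ∧
      ciIntegral w l lam ħ γ t = ciLaplace l lam ħ (cpIntegral w ħ γ) t := by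
  have hprod := integrable_prod_of_integrableOn_ciIntegrand h
  have e : ∀ v : Fin n → ℝ, ∫ y, orthantWeight lam ħ v *
      cpIntegrand w ħ γ (t + ∑ a, (l a : ℂ) * (Real.log (v a) : ℂ)) y =
      laplaceIntegrand l lam ħ (cpIntegral w ħ γ) t v := fun v => integral_const_mul _ _
  constructor
  · have := hprod.integral_prod_right
    simp only [e] at this
    exact this
  · rw [ciIntegral, setIntegral_congr_fun (MeasurableSet.univ.prod measurableSet_orthant)
      (fun p hp => ciIntegrand_eq t p.1 hp.2), restrict_univ_prod_orthant,
      integral_prod_symm _ hprod]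
    simp only [e]
    rfl

theorem exists_mem_of_ae_restrict {α : Type*} [TopologicalSpace α] [MeasurableSpace α]
    [OpensMeasurableSpace α] {μ : Measure α} [μ.IsOpenPosMeasure] {s A : Set α} {p : α → Prop}
    (h : ∀ᵐ x ∂μ.restrict s, p x) (hA : IsOpen A) (hAne : A.Nonempty) (hAs : A ⊆ s) :
    ∃ x ∈ A, p x := by
  have : (ae (μ.restrict A)).NeBot := ae_restrict_neBot.mpr (hA.measure_pos μ hAne).ne'
  exact ((ae_restrict_mem hA.measurableSet).and
    (ae_restrict_of_ae_restrict_of_subset hAs h)).exists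

/-- Fubini gives convergence of the thimble integral at `t + ∑ l_a log v_a` for almost every `v`.
Some such `v` has all entries in `(0, 1)` and another has all entries in `(1, 2)`, so `t` lies on a
horizontal segment between two points of convergence. -/
theorem integrable_cpIntegrand_of_ciIntegrand
    (hγ : ContDiff ℝ ((⊤ : ℕ∞) : WithTop ℕ∞) γ) {t : ℂ}
    (h : IntegrableOn (ciIntegrand w l lam ħ γ t) (Set.univ ×ˢ orthant n)) :
    Integrable (cpIntegrand w ħ γ t) := by
  have hae : ∀ᵐ v ∂(volume : Measure (Fin n → ℝ)).restrict (orthant n),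
      Integrable (cpIntegrand w ħ γ (t + ((∑ a, (l a : ℝ) * Real.log (v a) : ℝ) : ℂ))) := by
    filter_upwards [(integrable_prod_of_integrableOn_ciIntegrand h).prod_left_ae] with v hv
    have := hv.const_mul (orthantWeight lam ħ v)⁻¹
    push_cast
    exact this.congr (Eventually.of_forall fun y => inv_mul_cancel_left₀ (Complex.exp_ne_zero _) _)
  have key : ∀ a b : ℝ, 0 ≤ a → a < b → ∃ v : Fin n → ℝ, (∀ i, v i ∈ Set.Ioo a b) ∧
      Integrable (cpIntegrand w ħ γ (t + ((∑ a, (l a : ℝ) * Real.log (v a) : ℝ) : ℂ))) := by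
    intro a b ha hab
    obtain ⟨v, hv, hp⟩ := exists_mem_of_ae_restrict hae
      (isOpen_set_pi Set.finite_univ fun _ _ => isOpen_Ioo (a := a) (b := b))
      ⟨fun _ => (a + b) / 2, fun _ _ => ⟨by linarith, by linarith⟩⟩
      fun v hv i => ha.trans_lt (hv i (Set.mem_univ i)).1
    exact ⟨v, fun i => hv i (Set.mem_univ i), hp⟩
  obtain ⟨v₁, hv₁, hi₁⟩ := key 0 1 le_rfl one_pos
  obtain ⟨v₂, hv₂, hi₂⟩ := key 1 2 zero_le_one one_lt_two
  refine integrable_cpIntegrand_of_segment hγ ?_ ?_ hi₁ hi₂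
  · exact Finset.sum_nonpos fun a _ => mul_nonpos_of_nonneg_of_nonpos (Nat.cast_nonneg _)
      (Real.log_nonpos (hv₁ a).1.le (hv₁ a).2.le)
  · exact Finset.sum_nonneg fun a _ => mul_nonneg (Nat.cast_nonneg _)
      (Real.log_nonneg (hv₂ a).1.le)

end CompleteIntersection

end MirrorGKZ

theorem mainTheorem2 (k : ℕ) (w : Fin (k + 1) → ℂ) (ħ : ℂ) (hħ : ħ ≠ 0) (t₀ : ℂ)
    (c : Fin k → ℂ) (γ : EuclideanSpace ℝ (Fin k) → (Fin k → ℂ))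
    (hγ : MirrorGKZ.IsLefschetzThimble (MirrorGKZ.cpPotential w t₀) ħ c γ) :
    -- projective space: the integral over the thimble, wherever it converges
    (∀ U : Set ℂ, IsOpen U →
      (∀ t ∈ U, MeasureTheory.Integrable (MirrorGKZ.cpIntegrand w ħ γ t)) →
      DifferentiableOn ℂ (MirrorGKZ.cpIntegral w ħ γ) U ∧
        ∀ t ∈ U, MirrorGKZ.cpGKZ w ħ (MirrorGKZ.cpIntegral w ħ γ) t = 0) ∧
    -- complete intersections
    (∀ (n : ℕ) (l : Fin n → ℕ) (lam : Fin n → ℂ), (∀ a, 0 < l a) → ∑ a, l a < k + 1 →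
      0 < ħ.re →
      ∀ D : Set ℂ, IsOpen D → IsPreconnected D → (∀ t ∈ D, ∀ σ : ℝ, t + (σ : ℂ) ∈ D) →
        -- the Laplace transform of the (analytically continued) integral of projective space
        (∀ F : ℂ → ℂ, DifferentiableOn ℂ F D →
          (∃ U : Set ℂ, U ⊆ D ∧ IsOpen U ∧ U.Nonempty ∧
            ∀ t ∈ U, MeasureTheory.Integrable (MirrorGKZ.cpIntegrand w ħ γ t) ∧
              F t = MirrorGKZ.cpIntegral w ħ γ t) →
          (∀ t ∈ D, MeasureTheory.IntegrableOn (MirrorGKZ.laplaceIntegrand l lam ħ F t)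
            (MirrorGKZ.orthant n)) →
          DifferentiableOn ℂ (MirrorGKZ.ciLaplace l lam ħ F) D ∧
            ∀ t ∈ D, MirrorGKZ.ciGKZ w l lam ħ (MirrorGKZ.ciLaplace l lam ħ F) t = 0) ∧
        -- the integral over the product of the thimble and the positive orthant
        ((∀ t ∈ D, MeasureTheory.IntegrableOn (MirrorGKZ.ciIntegrand w l lam ħ γ t)
            (Set.univ ×ˢ MirrorGKZ.orthant n)) →
          (∀ t ∈ D, MirrorGKZ.ciIntegral w l lam ħ γ t =
            MirrorGKZ.ciLaplace l lam ħ (MirrorGKZ.cpIntegral w ħ γ) t) ∧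
          DifferentiableOn ℂ (MirrorGKZ.ciIntegral w l lam ħ γ) D ∧
            ∀ t ∈ D, MirrorGKZ.ciGKZ w l lam ħ (MirrorGKZ.ciIntegral w l lam ħ γ) t = 0)) := by
  refine ⟨fun U hU hint => MirrorGKZ.cpGKZ_cpIntegral hħ hγ hU hint, ?_⟩
  intro n l lam hl hlk hre D hD hDc hDr
  refine ⟨?_, fun hint => ?_⟩
  · rintro F hF ⟨U, hUD, hU, hUne, hFU⟩ hint
    refine MirrorGKZ.ciGKZ_ciLaplace hre hl hlk hD hDr hF ?_ hint
    exact MirrorGKZ.cpGKZ_eq_zero_of_eqOn hD hDc hF hUD hU hUne (fun t ht => (hFU t ht).2)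
      (MirrorGKZ.cpGKZ_cpIntegral hħ hγ hU fun t ht => (hFU t ht).1).2
  -- Here the thimble integral converges on all of `D`, so it serves as `F` itself and no analytic
  -- continuation is involved.
  · obtain ⟨hI, hI0⟩ := MirrorGKZ.cpGKZ_cpIntegral hħ hγ hD fun t ht =>
      MirrorGKZ.integrable_cpIntegrand_of_ciIntegrand hγ.smooth (hint t ht)
    obtain ⟨h1, h2⟩ := MirrorGKZ.ciGKZ_ciLaplace hre hl hlk hD hDr hI hI0 fun t ht =>
      (MirrorGKZ.ciIntegral_eq_ciLaplace (hint t ht)).1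
    have heq : ∀ t ∈ D, _ := fun t ht => (MirrorGKZ.ciIntegral_eq_ciLaplace (hint t ht)).2
    exact ⟨heq, h1.congr heq, fun t ht => (MirrorGKZ.ciGKZ_congr hD heq ht).trans (h2 t ht)⟩
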